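/- All graphs are finite, simple, nonempty, with $n$ vertices and $m$ edges. For $k'\ge 1$, a $k'$-partial Grundy coloring of $G$ is a proper coloring $f:V(G)\to\{1,\dots,k'\}$ such that for each $i\in\{1,\dots,k'\}$ there is a vertex $v$ with $f(v)=i$ that has, for every $j<i$, a neighbor $u$ with $f(u)=j$. For a graph $G$ and a positive integer $k$, call $(G,k)$ a yes-instance if $G$ has a $k'$-partial Grundy coloring for some $k'\ge k$, and a no-instance otherwise. Partial Grundy Coloring (PGC) asks, given $(G,k)$, whether it is a yes-instance. A biclique in $G$ is given by two nonempty disjoint vertex sets $L,R$ such that every vertex of $L$ is adjacent in $G$ to every vertex of $R$; its edges are those between $L$ and $R$. Structural Partial Grundy Coloring (SPGC) is the same question for $(G,k)$, where the input consists of integers $k\ge 1$, $d\ge 0$, $\ell\ge 0$, the graph $G$, and $\ell$ bicliques in $G$ such that $G-F$ is $d$-degenerate (every nonempty subgraph has a vertex of degree at most $d$), $F$ being the union of the edge sets of the bicliques. Algorithms are randomized word-RAM programs (unit-cost word operations, including drawing a uniformly random element of $\{0,\dots,b-1\}$ for a word $b$); graphs are given by adjacency lists and bicliques by lists of the vertices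 of their two sides. The word length may be any number that is at least a constant (depending only on the program) times the logarithm of the input length plus the sum of the numbers in the input. Running times are worst-case bounds over all random choices, with constants depending only on the program. **Theorem.** 1. There is a randomized algorithm for PGC running in time $2^{O(k^4)}\cdot n^{O(1)}$ such that if $(G,k)$ is a no-instance, then it outputs No with probability $1$, and if $(G,k)$ is a yes-instance, then it outputs Yes with probability at least $2/3$. 2. There is a randomized algorithm for SPGC running in time $O\big((k(d+1))^{2k^2+k}\cdot 2^{\ell k}\cdot (m+n)\big)$ such that if $(G,k)$ is a no-instance, then it outputs No with probability $1$, and if $(G,k)$ is a yes-instance, then it outputs Yes with probability at least $2/3$. -/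

import Mathlib

open scoped ENNReal

/-! ### Partial Grundy colorings, bicliques, degeneracy -/

/-- A `k`-partial Grundy coloring: a proper coloring with color set `Fin k` (the color `i` in
`{1, …, k}` is `i - 1` here) in which every color class `i` has a vertex with a neighbor in each
smaller color class. In particular all `k` colors are used. -/
def IsPartialGrundyColoring {V : Type*} (G : SimpleGraph V) (k : ℕ) (f : V → Fin k) : Prop :=
  (∀ u v, G.Adj u v → f u ≠ f v) ∧
    ∀ i : Fin k, ∃ v, f v = i ∧ ∀ j < i, ∃ u, G.Adj v u ∧ f u = j

/-- `(G, k)` is a yes-instance: `G` has a partial Grundy coloring with at least `k` colors. -/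
def HasPartialGrundyColoring {V : Type*} (G : SimpleGraph V) (k : ℕ) : Prop :=
  ∃ k' ≥ k, ∃ f : V → Fin k', IsPartialGrundyColoring G k' f

/-- `L` and `R` are the two (nonempty, disjoint) sides of a biclique that is a subgraph of `G`. -/
def IsBiclique {V : Type*} (G : SimpleGraph V) (L R : Set V) : Prop :=
  L.Nonempty ∧ R.Nonempty ∧ Disjoint L R ∧ ∀ u ∈ L, ∀ v ∈ R, G.Adj u v

/-- The edges of the biclique with sides `L` and `R`. -/
def bicliqueEdges {V : Type*} (L R : Set V) : Set (Sym2 V) :=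
  {e | ∃ u ∈ L, ∃ v ∈ R, e = s(u, v)}

/-- Every (nonempty) subgraph has a vertex of degree at most `d`. -/
def IsDegenerate {V : Type*} (G : SimpleGraph V) (d : ℕ) : Prop :=
  ∀ H : G.Subgraph, H.verts.Nonempty →
    ∃ v ∈ H.verts, (H.neighborSet v).Finite ∧ (H.neighborSet v).ncard ≤ d

/-! ### A randomized word RAM

Machine words are the numbers below `2 ^ w`. A machine has registers and a random access memory,
all holding words. Programs are structured (sequencing, conditionals, while-loops); every
execution step performs one command, whose expressions have a size fixed by the program, so that
a step is a constant number of machine instructions. -/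

namespace WordRAM

/-- Binary operations on words; `sub` is truncated at `0`, and `lt`, `eq` return `0` or `1`. -/
inductive Op
  | add | sub | mul | div | mod | lt | eq

/-- Expressions: constants, registers, the memory cell at a computed address, operations. -/
inductive Expr
  | const (a : ℕ)
  | reg (r : ℕ)
  | load (addr : Expr)
  | bin (o : Op) (e₁ e₂ : Expr)

/-- Programs. `rand r e` puts into register `r` a uniformly random element of
`{0, …, b - 1}`, where `b` is the value of `e` (and `0` if `b = 0`). -/
inductive Cmd
  | skip
  | assign (r : ℕ) (e : Expr)
  | store (addr val : Expr)
  | rand (r : ℕ) (e : Expr)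
  | seq (p q : Cmd)
  | cond (e : Expr) (p q : Cmd)
  | loop (e : Expr) (p : Cmd)

/-- Contents of the registers and of the memory. -/
@[ext]
structure State where
  reg : ℕ → ℕ
  mem : ℕ → ℕ

/-- The value of an operation before reduction to a word. -/
def Op.apply : Op → ℕ → ℕ → ℕ
  | .add, a, b => a + b
  | .sub, a, b => a - b
  | .mul, a, b => a * b
  | .div, a, b => a / b
  | .mod, a, b => a % b
  | .lt, a, b => if a < b then 1 else 0
  | .eq, a, b => if a = b then 1 else 0

/-- Evaluation with word length `w`: arithmetic is modulo `2 ^ w`. -/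
def Expr.eval (w : ℕ) (s : State) : Expr → ℕ
  | .const a => a % 2 ^ w
  | .reg r => s.reg r
  | .load e => s.mem (e.eval w s)
  | .bin o e₁ e₂ => o.apply (e₁.eval w s) (e₂.eval w s) % 2 ^ w

def State.setReg (s : State) (r a : ℕ) : State := ⟨Function.update s.reg r a, s.mem⟩

def State.setMem (s : State) (i a : ℕ) : State := ⟨s.reg, Function.update s.mem i a⟩

/-- A configuration: the commands still to be executed, and the current state. The machine has
halted when no command is left. -/
abbrev Config := List Cmd × State

/-- The uniform distribution on `{0, …, b - 1}`; for `b = 0` the point mass at `0`. -/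
noncomputable def uniformBelow (b : ℕ) : PMF ℕ :=
  (PMF.uniformOfFintype (Fin (b - 1 + 1))).map Fin.val

/-- One execution step, as a probability distribution on the next configuration. -/
noncomputable def step (w : ℕ) : Config → PMF Config
  | ([], s) => PMF.pure ([], s)
  | (.skip :: K, s) => PMF.pure (K, s)
  | (.assign r e :: K, s) => PMF.pure (K, s.setReg r (e.eval w s))
  | (.store a e :: K, s) => PMF.pure (K, s.setMem (a.eval w s) (e.eval w s))
  | (.rand r e :: K, s) => (uniformBelow (e.eval w s)).map fun i => (K, s.setReg r i)
  | (.seq p q :: K, s) => PMF.pure (p :: q :: K, s)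
  | (.cond e p q :: K, s) => PMF.pure ((if e.eval w s ≠ 0 then p else q) :: K, s)
  | (.loop e p :: K, s) =>
      PMF.pure (if e.eval w s ≠ 0 then (p :: .loop e p :: K, s) else (K, s))

/-- The distribution of the configuration after `t` steps. -/
noncomputable def run (w : ℕ) : ℕ → Config → PMF Config
  | 0, c => PMF.pure c
  | t + 1, c => (step w c).bind (run w t)

/-- Initially the input occupies the first cells of the memory, and everything else is `0`. -/
def start (P : Cmd) (x : List ℕ) : Config := ([P], ⟨fun _ => 0, fun i => x.getD i 0⟩)

/-- The answer of a configuration: none if it has not halted; otherwise "Yes" if register `0`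
holds a nonzero word, and "No" if it holds `0`. -/
def answer (c : Config) : Option Bool :=
  match c.1 with
  | [] => some (decide (c.2.reg 0 ≠ 0))
  | _ :: _ => none

/-- The distribution of the answer of `P` on input `x` after `t` steps. -/
noncomputable def answerAfter (w t : ℕ) (P : Cmd) (x : List ℕ) : PMF (Option Bool) :=
  (run w t (start P x)).map answer

/-- The word length is admissible for the input `x`: it is at least `c` times the binary
logarithm of the length of the input plus the sum of its entries (plus `2`). -/
def Admissible (c w : ℕ) (x : List ℕ) : Prop := (x.length + x.sum + 2) ^ c ≤ 2 ^ w

/-- With word length `w`, the program `P` on input `x` always halts within `t` steps, whatever the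
random choices; on a no-instance it answers "No" with probability `1`, and on a yes-instance it
answers "Yes" with probability at least `2/3`. -/
def DecidesOneSided (P : Cmd) (w t : ℕ) (x : List ℕ) (yes : Prop) : Prop :=
  (∀ a ∈ (answerAfter w t P x).support, a ≠ none) ∧
    (¬ yes → answerAfter w t P x (some false) = 1) ∧
    (yes → 2 / 3 ≤ answerAfter w t P x (some true))

end WordRAM

/-! ### Inputs -/

/-- `adj` is an adjacency list representation of `G`: `adj v` lists the neighbors of `v`, in any
order, each exactly once. -/
def IsAdjacencyList {n : ℕ} (G : SimpleGraph (Fin n)) (adj : Fin n → List (Fin n)) : Prop :=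
  ∀ v, (adj v).Nodup ∧ ∀ u, u ∈ adj v ↔ G.Adj v u

/-- A list of vertices, preceded by its length. -/
def encodeVertices {n : ℕ} (l : List (Fin n)) : List ℕ := l.length :: l.map Fin.val

/-- An adjacency list representation: the lists of all vertices, one after the other. -/
def encodeAdjacency {n : ℕ} (adj : Fin n → List (Fin n)) : List ℕ :=
  (List.finRange n).flatMap fun v => encodeVertices (adj v)

/-- The input of Partial Grundy Coloring. -/
def encodePGC {n : ℕ} (k : ℕ) (adj : Fin n → List (Fin n)) : List ℕ :=
  [n, k] ++ encodeAdjacency adj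

/-- The input of Structural Partial Grundy Coloring; the `i`-th biclique is given by its two sides,
the lists `L i` and `R i`. -/
def encodeSPGC {n : ℕ} (k d ℓ : ℕ) (adj : Fin n → List (Fin n)) (L R : Fin ℓ → List (Fin n)) :
    List ℕ :=
  [n, k, d, ℓ] ++ encodeAdjacency adj ++
    (List.finRange ℓ).flatMap fun i => encodeVertices (L i) ++ encodeVertices (R i)

/-- The promise of Structural Partial Grundy Coloring: `L i` and `R i` list, without repetitions,
the sides of bicliques in `G`, and deleting the edges of all these bicliques from `G` leaves a
`d`-degenerate graph. -/
def IsSPGCInstance {n : ℕ} (G : SimpleGraph (Fin n)) (d ℓ : ℕ) (L R : Fin ℓ → List (Fin n)) :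
    Prop :=
  (∀ i, (L i).Nodup ∧ (R i).Nodup ∧ IsBiclique G {v | v ∈ L i} {v | v ∈ R i}) ∧
    IsDegenerate (G.deleteEdges (⋃ i, bicliqueEdges {v | v ∈ L i} {v | v ∈ R i})) d

/-!
Both algorithms rest on one randomized search. It takes a graph, a number `k`, and `l` bicliques
whose deletion leaves a `d`-degenerate graph.

A coloring that shows that `(G, k)` is a yes-instance can be witnessed by a set `W` of at most
`k (k + 1) / 2` colored vertices (`HasPartialGrundyColoring.exists_small`). Conversely, a partial
coloring with this property always extends to a partial Grundy coloring with at least `k` colors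
(`hasPartialGrundyColoring_of_partial`), so it suffices to find one. In one round of the search,
every vertex draws one of `k` colors, or no color, the latter with probability `d / (d + 1)`. Then
conflicts are resolved in two ways. For each biclique and each color but the last, one side, chosen
by a coin, loses that color; the sides are completely joined, so that `W` needs the color on one
side at most. The remaining conflicts are on edges that are in none of the bicliques; of two such
neighbors of the same color, the one that comes first in the degeneracy order loses the color. The
last color needs no treatment, since only one vertex of it is needed. A round preserves the colors
of `W` if `W` gets the right colors, the at most `d * |W|` vertices behind `W` in the order get
none, and all coins fall the right way. This has probability at least `successProb k d l`, and
`(k (d + 1)) ^ (k (k + 1)) * 2 ^ (l (k - 1))` rounds succeed with probability at least `2 / 3`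
(`two_le_rounds_mul_successProb`, `one_sub_pow_le_third`). As "Yes" is only answered when a coloring
is known to exist, the error is one-sided.

For Structural Partial Grundy Coloring the bicliques are given. For Partial Grundy Coloring they are
computed, with `d = 2 k ^ 4` and `l ≤ k ^ 3`. A greedy coloring with `k - 1` colors either leaves a
vertex uncolored, which yields a coloring with `k` colors (`Inst.Greedy.found`), or it is a proper
coloring. In the latter case fix a color `q`, and call two vertices of one color close if their
neighborhoods in the class `q` differ in fewer than `2 k ^ 2` vertices. Among `k` vertices of one
color of which no two are close there is a witness by Hall's theorem (`Inst.found_of_far`). So in a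
no-instance all vertices are close to one of fewer than `k` representatives of their color. The
vertices with a common representative `c` and their common neighbors of color `q` form a biclique.
All but few of the neighbors of `c` of color `q` belong to it, since otherwise a co-matching of size
`k` between two color classes gives a witness (`Inst.card_exceptional_le`). Hence, in a no-instance,
deleting all these bicliques leaves maximum degree at most `2 k ^ 4` (`Inst.card_keep_le`); whenever
the computation finds this violated, it may answer "Yes".

The programs are written in a small language with variables and arrays, which is translated into
word RAM programs. The judgment `Exec Γ c s t p Q` expresses that the command `c`, started in the
state `s`, ends within `t` steps, and that the whole execution fails to answer "Yes" with
probability at most `p` provided that it does so with probability at most `p'` from each state `s'`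
that is reached, where `Q s' p'` holds. So `p` is passed through commands that draw nothing, and a
random draw averages. The rules of this program logic are sound for the machine (`Exec.sound`,
`decidesOneSided_of_exec`), and the running times are read off from `t`.

Variables have fixed roles throughout: `0` is the answer, `1` to `5` hold `n`, `k`, `d`, `l` and
`k (d + 1)`. The arrays `0` and `1` hold the positions of the neighbor lists and the bicliques.
During the search, array `3` holds the order of the vertices and array `5` their colors.
-/

/-! ### A language with variables and arrays -/

namespace ArrayLang

/-- Expressions over the natural numbers: literals, variables, array cells, cells of the read-only
input, and the operations of the word RAM. -/
inductive HExpr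
  | lit (a : ℕ)
  | var (x : ℕ)
  | arr (a : ℕ) (i : HExpr)
  | inp (i : HExpr)
  | bin (o : WordRAM.Op) (e₁ e₂ : HExpr)

/-- Commands; `rand x e` draws a uniformly random number below the value of `e`. -/
inductive HCmd
  | skip
  | assign (x : ℕ) (e : HExpr)
  | store (a : ℕ) (i e : HExpr)
  | rand (x : ℕ) (e : HExpr)
  | seq (p q : HCmd)
  | cond (e : HExpr) (p q : HCmd)
  | loop (e : HExpr) (p : HCmd)

infixr:60 " ;; " => HCmd.seq

/-- Values of the variables, and contents of the arrays. -/
structure St where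
  var : ℕ → ℕ
  arr : ℕ → ℕ → ℕ

/-- What stays fixed during an execution: the input `x`, and a bound `I` below which all computed
numbers have to stay. -/
structure Env where
  x : List ℕ
  I : ℕ

/-- The state after an assignment to the variable `x`. -/
def St.setVar (s : St) (x a : ℕ) : St := ⟨Function.update s.var x a, s.arr⟩

/-- The state after an assignment to the cell `i` of the array `a`. -/
def St.setArr (s : St) (a i v : ℕ) : St :=
  ⟨s.var, Function.update s.arr a (Function.update (s.arr a) i v)⟩

@[simp] theorem St.setVar_var (s : St) (x a y : ℕ) :
    (s.setVar x a).var y = if y = x then a else s.var y := by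
  simp [St.setVar, Function.update_apply]

@[simp] theorem St.setVar_arr (s : St) (x a : ℕ) : (s.setVar x a).arr = s.arr := rfl

@[simp] theorem St.setArr_var (s : St) (a i v : ℕ) : (s.setArr a i v).var = s.var := rfl

@[simp] theorem St.setArr_arr (s : St) (a i v b j : ℕ) :
    (s.setArr a i v).arr b j = if b = a ∧ j = i then v else s.arr b j := by
  simp only [St.setArr, Function.update_apply]
  split_ifs <;> simp_all

theorem St.setArr_arr_eq (s : St) (a i v b : ℕ) :
    (s.setArr a i v).arr b = if b = a then Function.update (s.arr a) i v else s.arr b := by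
  simp [St.setArr, Function.update_apply]

instance : Add HExpr := ⟨HExpr.bin .add⟩
instance : Sub HExpr := ⟨HExpr.bin .sub⟩
instance : Mul HExpr := ⟨HExpr.bin .mul⟩

/-- `1` if `a < b`, and `0` otherwise. -/
def HExpr.lt (a b : HExpr) : HExpr := .bin .lt a b

/-- `1` if `a = b`, and `0` otherwise. -/
def HExpr.eq (a b : HExpr) : HExpr := .bin .eq a b

variable {Γ : Env}

/-- The value of an expression, computed in `ℕ`. -/
def HExpr.eval (Γ : Env) (s : St) : HExpr → ℕ
  | .lit a => a
  | .var x => s.var x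
  | .arr a i => s.arr a (i.eval Γ s)
  | .inp i => Γ.x.getD (i.eval Γ s) 0
  | .bin o e₁ e₂ => o.apply (e₁.eval Γ s) (e₂.eval Γ s)

/-- No intermediate result of the evaluation reaches the bound, and the input is read within its
length. Only additions and multiplications can produce a number that is too large. -/
def HExpr.Ok (Γ : Env) (s : St) : HExpr → Prop
  | .lit a => a < 16
  | .var _ => True
  | .arr a i => a < 16 ∧ i.Ok Γ s
  | .inp i => i.Ok Γ s ∧ i.eval Γ s < Γ.x.length
  | .bin .add e₁ e₂ => e₁.Ok Γ s ∧ e₂.Ok Γ s ∧ e₁.eval Γ s + e₂.eval Γ s < Γ.I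
  | .bin .mul e₁ e₂ => e₁.Ok Γ s ∧ e₂.Ok Γ s ∧ e₁.eval Γ s * e₂.eval Γ s < Γ.I
  | .bin _ e₁ e₂ => e₁.Ok Γ s ∧ e₂.Ok Γ s

section simps
variable (s : St) (a b : HExpr)
@[simp] theorem eval_lit (c : ℕ) : (HExpr.lit c).eval Γ s = c := rfl
@[simp] theorem eval_var (c : ℕ) : (HExpr.var c).eval Γ s = s.var c := rfl
@[simp] theorem eval_arr (c : ℕ) : (HExpr.arr c a).eval Γ s = s.arr c (a.eval Γ s) := rfl
@[simp] theorem eval_inp : (HExpr.inp a).eval Γ s = Γ.x.getD (a.eval Γ s) 0 := rfl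
@[simp] theorem eval_add : (a + b).eval Γ s = a.eval Γ s + b.eval Γ s := rfl
@[simp] theorem eval_sub : (a - b).eval Γ s = a.eval Γ s - b.eval Γ s := rfl
@[simp] theorem eval_mul : (a * b).eval Γ s = a.eval Γ s * b.eval Γ s := rfl
@[simp] theorem eval_lt : (a.lt b).eval Γ s = if a.eval Γ s < b.eval Γ s then 1 else 0 := rfl
@[simp] theorem eval_eq : (a.eq b).eval Γ s = if a.eval Γ s = b.eval Γ s then 1 else 0 := rfl
@[simp] theorem ok_lit (c : ℕ) : (HExpr.lit c).Ok Γ s ↔ c < 16 := Iff.rfl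
@[simp] theorem ok_var (c : ℕ) : (HExpr.var c).Ok Γ s ↔ True := Iff.rfl
@[simp] theorem ok_arr (c : ℕ) : (HExpr.arr c a).Ok Γ s ↔ c < 16 ∧ a.Ok Γ s := Iff.rfl
@[simp] theorem ok_inp : (HExpr.inp a).Ok Γ s ↔ a.Ok Γ s ∧ a.eval Γ s < Γ.x.length := Iff.rfl
@[simp] theorem ok_add :
    (a + b).Ok Γ s ↔ a.Ok Γ s ∧ b.Ok Γ s ∧ a.eval Γ s + b.eval Γ s < Γ.I := Iff.rfl
@[simp] theorem ok_sub : (a - b).Ok Γ s ↔ a.Ok Γ s ∧ b.Ok Γ s := Iff.rfl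
@[simp] theorem ok_mul :
    (a * b).Ok Γ s ↔ a.Ok Γ s ∧ b.Ok Γ s ∧ a.eval Γ s * b.eval Γ s < Γ.I := Iff.rfl
@[simp] theorem ok_lt : (a.lt b).Ok Γ s ↔ a.Ok Γ s ∧ b.Ok Γ s := Iff.rfl
@[simp] theorem ok_eq : (a.eq b).Ok Γ s ↔ a.Ok Γ s ∧ b.Ok Γ s := Iff.rfl
end simps

/-- `Exec Γ c s t p Q`: started in the state `s`, the command `c` ends within `t` steps whatever
the random choices, and if from every final state `s'` one fails with probability at most some `p'`
with `Q s' p'`, then from `s` one fails with probability at most `p`. So a single judgement carries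
correctness, running time and a bound for the probability of failure. -/
inductive Exec (Γ : Env) : HCmd → St → ℕ → ℝ → (St → ℝ → Prop) → Prop
  | skip {s : St} {p : ℝ} {Q : St → ℝ → Prop} : Q s p → Exec Γ .skip s 1 p Q
  | assign {x : ℕ} {e : HExpr} {s : St} {p : ℝ} {Q : St → ℝ → Prop} :
      e.Ok Γ s → Q (s.setVar x (e.eval Γ s)) p → Exec Γ (.assign x e) s 1 p Q
  | store {a : ℕ} {i e : HExpr} {s : St} {p : ℝ} {Q : St → ℝ → Prop} :
      a < 16 → i.Ok Γ s → e.Ok Γ s → Q (s.setArr a (i.eval Γ s) (e.eval Γ s)) p →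
        Exec Γ (.store a i e) s 1 p Q
  | rand {x : ℕ} {e : HExpr} {s : St} {p : ℝ} {Q : St → ℝ → Prop} (g : ℕ → ℝ) :
      e.Ok Γ s → 0 < e.eval Γ s → (∀ i < e.eval Γ s, Q (s.setVar x i) (g i)) →
        ∑ i ∈ Finset.range (e.eval Γ s), g i ≤ e.eval Γ s * p → Exec Γ (.rand x e) s 1 p Q
  | seq {a b : HCmd} {s : St} {t t' : ℕ} {p : ℝ} {Q : St → ℝ → Prop} (R : St → ℝ → Prop) :
      Exec Γ a s t p R → (∀ s' p', R s' p' → Exec Γ b s' t' p' Q) →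
        Exec Γ (.seq a b) s (t + t' + 1) p Q
  | cond {e : HExpr} {a b : HCmd} {s : St} {t : ℕ} {p : ℝ} {Q : St → ℝ → Prop} :
      e.Ok Γ s → Exec Γ (if e.eval Γ s ≠ 0 then a else b) s t p Q →
        Exec Γ (.cond e a b) s (t + 1) p Q
  | loop_done {e : HExpr} {c : HCmd} {s : St} {p : ℝ} {Q : St → ℝ → Prop} :
      e.Ok Γ s → e.eval Γ s = 0 → Q s p → Exec Γ (.loop e c) s 1 p Q
  | loop_step {e : HExpr} {c : HCmd} {s : St} {t t' : ℕ} {p : ℝ} {Q : St → ℝ → Prop}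
      (R : St → ℝ → Prop) :
      e.Ok Γ s → e.eval Γ s ≠ 0 → Exec Γ c s t p R →
        (∀ s' p', R s' p' → Exec Γ (.loop e c) s' t' p' Q) → Exec Γ (.loop e c) s (t + t' + 1) p Q
  | conseq {c : HCmd} {s : St} {t t' : ℕ} {p p' : ℝ} {Q Q' : St → ℝ → Prop} :
      Exec Γ c s t p Q → t ≤ t' → p ≤ p' → (∀ s p, Q s p → Q' s p) → Exec Γ c s t' p' Q'

/-! ### Translation into word RAM programs -/

/-- Variable `x` lives in register `2 x`; register `1` holds an address `b` behind the input; and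
cell `i` of array `a < 16` lives at the address `b + 16 i + a`. -/
def HExpr.compile : HExpr → WordRAM.Expr
  | .lit a => .const a
  | .var x => .reg (2 * x)
  | .arr a i => .load (.bin .add (.reg 1)
      (.bin .add (.bin .mul i.compile (.const 16)) (.const a)))
  | .inp i => .load i.compile
  | .bin o e₁ e₂ => .bin o e₁.compile e₂.compile

/-- Variables become the even registers. Register `1` holds an address behind the input, the base of
the memory for the arrays, of which there are at most `16`: they are interleaved, so that the cell
`i` of the array `a` has the address `base + (16 * i + a)` and arrays need no bound on their length.
-/
def HCmd.compile : HCmd → WordRAM.Cmd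
  | .skip => .skip
  | .assign x e => .assign (2 * x) e.compile
  | .store a i e => .store (.bin .add (.reg 1)
      (.bin .add (.bin .mul i.compile (.const 16)) (.const a))) e.compile
  | .rand x e => .rand (2 * x) e.compile
  | .seq p q => .seq p.compile q.compile
  | .cond e p q => .cond e.compile p.compile q.compile
  | .loop e p => .loop e.compile p.compile

/-- The word RAM state `S` represents the state `s`. -/
structure Sim (Γ : Env) (b : ℕ) (s : St) (S : WordRAM.State) : Prop where
  base : S.reg 1 = b
  var : ∀ x, S.reg (2 * x) = s.var x
  inp : ∀ i < Γ.x.length, S.mem i = Γ.x.getD i 0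
  arr : ∀ a < 16, ∀ i, S.mem (b + (i * 16 + a)) = s.arr a i
  var_lt : ∀ x, s.var x < Γ.I
  arr_lt : ∀ a i, s.arr a i < Γ.I

/-- The words of length `w` have room for the input, and for arrays of length `Γ.I` behind it. -/
structure Room (Γ : Env) (b w : ℕ) : Prop where
  len : Γ.x.length ≤ b
  entries : ∀ i, Γ.x.getD i 0 < Γ.I
  small : 16 ≤ Γ.I
  large : b + 16 * Γ.I + 16 ≤ 2 ^ w

theorem HExpr.eval_lt_bound {b w : ℕ} (hr : Room Γ b w) {s : St} {S : WordRAM.State}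
    (hs : Sim Γ b s S) (e : HExpr) (he : e.Ok Γ s) : e.eval Γ s < Γ.I := by
  induction e with
  | lit a => exact lt_of_lt_of_le he hr.small
  | var x => exact hs.var_lt x
  | arr a i _ => exact hs.arr_lt _ _
  | inp i _ => exact hr.entries _
  | bin o e₁ e₂ h₁ h₂ =>
    have h16 := hr.small
    cases o with
    | add => exact he.2.2
    | mul => exact he.2.2
    | sub => exact lt_of_le_of_lt (Nat.sub_le _ _) (h₁ he.1)
    | div => exact lt_of_le_of_lt (Nat.div_le_self _ _) (h₁ he.1)
    | mod => exact lt_of_le_of_lt (Nat.mod_le _ _) (h₁ he.1)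
    | lt => simp only [eval, WordRAM.Op.apply]; split_ifs <;> omega
    | eq => simp only [eval, WordRAM.Op.apply]; split_ifs <;> omega

theorem addr_eval {b w a : ℕ} {e : WordRAM.Expr} {v : ℕ} (hr : Room Γ b w) {S : WordRAM.State}
    (hb : S.reg 1 = b) (ha : a < 16) (he : e.eval w S = v) (hv : v < Γ.I) :
    (WordRAM.Expr.bin .add (.reg 1) (.bin .add (.bin .mul e (.const 16)) (.const a))).eval w S
      = b + (v * 16 + a) := by
  have := hr.large
  simp only [WordRAM.Expr.eval, WordRAM.Op.apply, hb, he]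
  rw [Nat.mod_eq_of_lt (a := 16) (by omega), Nat.mod_eq_of_lt (a := a) (by omega),
    Nat.mod_eq_of_lt (a := v * 16) (by omega), Nat.mod_eq_of_lt (a := v * 16 + a) (by omega),
    Nat.mod_eq_of_lt (by omega)]

/-- Since the values of legal expressions are below `I`, the machine arithmetic does not overflow.
-/
theorem HExpr.compile_eval {b w : ℕ} (hr : Room Γ b w) {s : St} {S : WordRAM.State}
    (hs : Sim Γ b s S) (e : HExpr) (he : e.Ok Γ s) : e.compile.eval w S = e.eval Γ s := by
  have hw := hr.large
  induction e with
  | lit a =>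
    have := HExpr.eval_lt_bound hr hs _ he
    exact Nat.mod_eq_of_lt (by simp only [eval] at this; omega)
  | var x => exact hs.var x
  | arr a i h =>
    change S.mem _ = _
    rw [addr_eval hr hs.base he.1 (h he.2) (HExpr.eval_lt_bound hr hs _ he.2), hs.arr a he.1]
    rfl
  | inp i h =>
    change S.mem _ = _
    rw [h he.1, hs.inp _ he.2]
    rfl
  | bin o e₁ e₂ h₁ h₂ =>
    have hlt := HExpr.eval_lt_bound hr hs _ he
    have h12 : e₁.Ok Γ s ∧ e₂.Ok Γ s := by
      cases o <;> first | exact ⟨he.1, he.2.1⟩ | exact he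
    simp only [compile, WordRAM.Expr.eval, h₁ h12.1, h₂ h12.2]
    exact Nat.mod_eq_of_lt (by simp only [eval] at hlt; omega)

theorem Sim.setVar {b : ℕ} {s : St} {S : WordRAM.State} (hs : Sim Γ b s S) (x v : ℕ)
    (hv : v < Γ.I) : Sim Γ b (s.setVar x v) (S.setReg (2 * x) v) where
  base := by
    simp only [WordRAM.State.setReg, Function.update_apply]
    rw [if_neg (by omega)]; exact hs.base
  var y := by
    have := hs.var y
    simp only [WordRAM.State.setReg, Function.update_apply, St.setVar_var]
    split_ifs <;> omega
  inp := hs.inp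
  arr := hs.arr
  var_lt y := by
    have := hs.var_lt y
    simp only [St.setVar_var]; split_ifs <;> omega
  arr_lt := hs.arr_lt

theorem Sim.setArr {b w : ℕ} (hr : Room Γ b w) {s : St} {S : WordRAM.State} (hs : Sim Γ b s S)
    (a i v : ℕ) (ha : a < 16) (hv : v < Γ.I) :
    Sim Γ b (s.setArr a i v) (S.setMem (b + (i * 16 + a)) v) where
  base := hs.base
  var := hs.var
  inp j hj := by
    have := hr.len
    simp only [WordRAM.State.setMem, Function.update_apply]
    rw [if_neg (by omega)]; exact hs.inp j hj
  arr a' ha' j := by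
    have := hs.arr a' ha' j
    simp only [WordRAM.State.setMem, Function.update_apply, St.setArr_arr]
    split_ifs <;> omega
  var_lt := hs.var_lt
  arr_lt a' j := by
    have := hs.arr_lt a' j
    simp only [St.setArr_arr]; split_ifs <;> omega

/-- The distribution of the answer of a configuration after `t` more steps. -/
noncomputable def answerFrom (w t : ℕ) (c : WordRAM.Config) : PMF (Option Bool) :=
  (WordRAM.run w t c).map WordRAM.answer

theorem answerFrom_succ (w t : ℕ) (c : WordRAM.Config) :
    answerFrom w (t + 1) c = (WordRAM.step w c).bind (answerFrom w t) := by
  simp only [answerFrom, WordRAM.run, PMF.map_bind]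
  rfl

theorem answerFrom_halted (w t : ℕ) (S : WordRAM.State) :
    answerFrom w t ([], S) = PMF.pure (WordRAM.answer ([], S)) := by
  induction t with
  | zero => simp [answerFrom, WordRAM.run, PMF.pure_map]
  | succ t ih => rw [answerFrom_succ, WordRAM.step, PMF.pure_bind, ih]

/-- From the configuration `c`, the machine halts within `t` steps, answers "Yes" only if `yes`
holds, and fails to answer "Yes" with probability at most `p`. -/
def Valid (yes : Prop) (w t : ℕ) (c : WordRAM.Config) (p : ℝ) : Prop :=
  ∀ T ≥ t, (∀ a ∈ (answerFrom w T c).support, a ≠ none ∧ (a = some true → yes)) ∧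
    ENNReal.ofReal (1 - p) ≤ answerFrom w T c (some true)

theorem Valid.mono {yes : Prop} {w t t' : ℕ} {c : WordRAM.Config} {p p' : ℝ}
    (h : Valid yes w t c p) (ht : t ≤ t') (hp : p ≤ p') : Valid yes w t' c p' := fun T hT =>
  ⟨(h T (ht.trans hT)).1,
    (ENNReal.ofReal_le_ofReal (by linarith)).trans (h T (ht.trans hT)).2⟩

theorem Valid.step {yes : Prop} {w t : ℕ} {c c' : WordRAM.Config} {p : ℝ}
    (hc : WordRAM.step w c = PMF.pure c') (h : Valid yes w t c' p) :
    Valid yes w (t + 1) c p := by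
  intro T hT
  obtain ⟨T, rfl⟩ : ∃ T', T = T' + 1 := ⟨T - 1, by omega⟩
  rw [answerFrom_succ, hc, PMF.pure_bind]
  exact h T (by omega)

/-- A random draw fails with the average of the probabilities for the values drawn. -/
theorem Valid.rand {yes : Prop} {w t r : ℕ} {e : WordRAM.Expr} {K : List WordRAM.Cmd}
    {S : WordRAM.State} {p : ℝ} (g : ℕ → ℝ) (he : 0 < e.eval w S)
    (h : ∀ i < e.eval w S, Valid yes w t (K, S.setReg r i) (g i))
    (hg : ∑ i ∈ Finset.range (e.eval w S), g i ≤ e.eval w S * p) :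
    Valid yes w (t + 1) (.rand r e :: K, S) p := by
  intro T hT
  obtain ⟨T, rfl⟩ : ∃ T', T = T' + 1 := ⟨T - 1, by omega⟩
  set b := e.eval w S with hb
  have hstep : answerFrom w (T + 1) (.rand r e :: K, S) =
      (PMF.uniformOfFintype (Fin (b - 1 + 1))).bind
        (fun i => answerFrom w T (K, S.setReg r i)) := by
    rw [answerFrom_succ]
    simp only [WordRAM.step, WordRAM.uniformBelow, PMF.map_comp, PMF.bind_map]
    rfl
  have hb1 : b - 1 + 1 = b := by omega
  rw [hstep]
  constructor
  · intro a ha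
    rw [PMF.mem_support_bind_iff] at ha
    obtain ⟨i, -, hi⟩ := ha
    exact (h i (by omega) T (by omega)).1 a hi
  · rw [PMF.bind_apply, tsum_fintype]
    simp only [PMF.uniformOfFintype_apply, Fintype.card_fin, hb1]
    have h1 : ∀ i : Fin (b - 1 + 1), ENNReal.ofReal ((b : ℝ)⁻¹ * (1 - g i)) ≤
        (b : ℝ≥0∞)⁻¹ * answerFrom w T (K, S.setReg r i) (some true) := by
      intro i
      rw [ENNReal.ofReal_mul (by positivity), ENNReal.ofReal_inv_of_pos (by exact_mod_cast he),
        ENNReal.ofReal_natCast]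
      gcongr
      exact (h i (by omega) T (by omega)).2
    refine le_trans ?_ (Finset.sum_le_sum fun i _ => h1 i)
    have h2 : ∀ (s : Finset (Fin (b - 1 + 1))) (f : Fin (b - 1 + 1) → ℝ),
        ENNReal.ofReal (∑ i ∈ s, f i) ≤ ∑ i ∈ s, ENNReal.ofReal (f i) := by
      intro s f
      induction s using Finset.cons_induction with
      | empty => simp
      | cons a s ha ih =>
        rw [Finset.sum_cons, Finset.sum_cons]
        exact ENNReal.ofReal_add_le.trans (by gcongr)
    refine le_trans (ENNReal.ofReal_le_ofReal ?_) (h2 _ _)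
    rw [← Finset.mul_sum, Fin.sum_univ_eq_sum_range (fun i => 1 - g i), hb1,
      Finset.sum_sub_distrib]
    have hb0 : (0 : ℝ) < b := by exact_mod_cast he
    rw [le_inv_mul_iff₀ hb0]
    simp only [Finset.sum_const, Finset.card_range, nsmul_eq_mul, mul_one]
    linarith

/-- The translation is correct, in continuation form. -/
theorem Exec.sound {yes : Prop} {b w : ℕ} (hr : Room Γ b w) {c : HCmd} {s : St} {t : ℕ} {p : ℝ}
    {Q : St → ℝ → Prop} (h : Exec Γ c s t p Q) :
    ∀ (S : WordRAM.State) (K : List WordRAM.Cmd) (t₂ : ℕ), Sim Γ b s S →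
      (∀ s' p' S', Q s' p' → Sim Γ b s' S' → Valid yes w t₂ (K, S') p') →
      Valid yes w (t + t₂) (c.compile :: K, S) p := by
  induction h with
  | skip hQ =>
    intro S K t₂ hs hK
    rw [add_comm]
    exact Valid.step rfl (hK _ _ _ hQ hs)
  | assign he hQ =>
    intro S K t₂ hs hK
    rw [add_comm]
    refine Valid.step rfl (hK _ _ _ hQ ?_)
    rw [HExpr.compile_eval hr hs _ he]
    exact hs.setVar _ _ (HExpr.eval_lt_bound hr hs _ he)
  | store ha hi he hQ =>
    intro S K t₂ hs hK
    rw [add_comm]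
    refine Valid.step rfl (hK _ _ _ hQ ?_)
    rw [HExpr.compile_eval hr hs _ he, addr_eval hr hs.base ha (HExpr.compile_eval hr hs _ hi)
      (HExpr.eval_lt_bound hr hs _ hi)]
    exact hs.setArr hr _ _ _ ha (HExpr.eval_lt_bound hr hs _ he)
  | rand g he hpos hQ hg =>
    intro S K t₂ hs hK
    have hev := HExpr.compile_eval hr hs _ he
    have hlt := HExpr.eval_lt_bound hr hs _ he
    rw [add_comm]
    refine Valid.rand g (by rwa [hev]) ?_ (by rwa [hev])
    intro i hi
    rw [hev] at hi
    exact hK _ _ _ (hQ i hi) (hs.setVar _ _ (hi.trans hlt))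
  | @seq a b' s t t' p Q R _ _ ih₁ ih₂ =>
    intro S K t₂ hs hK
    refine Valid.mono (t := t + (t' + t₂) + 1) (Valid.step rfl ?_) (by omega) le_rfl
    exact ih₁ S _ _ hs fun s' p' S' hR hs' => ih₂ s' p' hR S' K t₂ hs' hK
  | @cond e a b' s t p Q he _ ih =>
    intro S K t₂ hs hK
    refine Valid.mono (t := t + t₂ + 1) (Valid.step rfl ?_) (by omega) le_rfl
    rw [HExpr.compile_eval hr hs _ he]
    have := ih S K t₂ hs hK
    split_ifs at this ⊢ <;> exact this
  | loop_done he h0 hQ =>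
    intro S K t₂ hs hK
    rw [add_comm]
    refine Valid.step rfl ?_
    rw [HExpr.compile_eval hr hs _ he, if_neg (by simpa using h0)]
    exact hK _ _ _ hQ hs
  | @loop_step e c s t t' p Q R he h0 _ _ ih₁ ih₂ =>
    intro S K t₂ hs hK
    refine Valid.mono (t := t + (t' + t₂) + 1) (Valid.step rfl ?_) (by omega) le_rfl
    rw [HExpr.compile_eval hr hs _ he, if_pos h0]
    exact ih₁ S _ _ hs fun s' p' S' hR hs' => ih₂ s' p' hR S' K t₂ hs' hK
  | conseq _ ht hp hQ ih =>
    intro S K t₂ hs hK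
    exact Valid.mono (ih S K t₂ hs fun s' p' S' h hs' => hK s' p' S' (hQ _ _ h) hs')
      (by omega) hp

/-- A program whose final states are correct decides the problem with one-sided error. -/
theorem decidesOneSided_of_exec {yes : Prop} {b w : ℕ} (hr : Room Γ b w) {c : HCmd} {t T : ℕ}
    {p : ℝ} {be : WordRAM.Expr}
    (hbase : be.eval w ⟨fun _ => 0, fun i => Γ.x.getD i 0⟩ = b)
    (h : Exec Γ c ⟨fun _ => 0, fun _ _ => 0⟩ t p fun s' p' =>
      (s'.var 0 ≠ 0 ∧ yes ∧ 0 ≤ p') ∨ (s'.var 0 = 0 ∧ 1 ≤ p'))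
    (hT : t + 2 ≤ T) (hp : yes → p ≤ 1 / 3) :
    WordRAM.DecidesOneSided (.seq (.assign 1 be) c.compile) w T Γ.x yes := by
  have hI := hr.small
  have hsim : Sim Γ b ⟨fun _ => 0, fun _ _ => 0⟩
      (WordRAM.State.setReg ⟨fun _ => 0, fun i => Γ.x.getD i 0⟩ 1 b) :=
    { base := by simp [WordRAM.State.setReg]
      var := by
        intro x
        simp only [WordRAM.State.setReg, Function.update_apply]
        rw [if_neg (by omega)]
      inp := fun i _ => rfl
      arr := by
        intro a _ i
        have := hr.len
        exact List.getD_eq_default _ _ (by omega)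
      var_lt := fun _ => by simp only; omega
      arr_lt := fun _ _ => by simp only; omega }
  have hv : Valid yes w (t + 0 + 1 + 1)
      (WordRAM.start (.seq (.assign 1 be) c.compile) Γ.x) p := by
    refine Valid.step rfl (Valid.step rfl ?_)
    rw [hbase]
    refine Exec.sound hr h _ [] 0 hsim ?_
    intro s' p' S' hQ hs' T' _
    rw [answerFrom_halted]
    have hv0 := hs'.var 0
    rcases hQ with ⟨h0, hy, hp'⟩ | ⟨h0, hp'⟩
    · have : WordRAM.answer ([], S') = some true := by
        simp only [WordRAM.answer, mul_zero] at hv0 ⊢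
        simp [hv0, h0]
      rw [this]
      refine ⟨fun a ha => ?_, ?_⟩
      · rw [PMF.mem_support_pure_iff] at ha
        exact ⟨by simp [ha], fun _ => hy⟩
      · rw [PMF.pure_apply_self]
        exact ENNReal.ofReal_le_one.2 (by linarith)
    · have : WordRAM.answer ([], S') = some false := by
        simp only [WordRAM.answer, mul_zero] at hv0 ⊢
        simp [hv0, h0]
      rw [this]
      refine ⟨fun a ha => ?_, ?_⟩
      · rw [PMF.mem_support_pure_iff] at ha
        simp [ha]
      · rw [ENNReal.ofReal_of_nonpos (by linarith)]
        exact zero_le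
  obtain ⟨hsupp, hprob⟩ := hv T (by omega)
  refine ⟨fun a ha => (hsupp a ha).1, fun hno => ?_, fun hy => ?_⟩
  · change answerFrom w T _ _ = 1
    rw [PMF.apply_eq_one_iff]
    refine Set.Subset.antisymm (fun a ha => ?_) ?_
    · obtain ⟨h1, h2⟩ := hsupp a ha
      match a with
      | none => exact absurd rfl h1
      | some true => exact absurd (h2 rfl) hno
      | some false => rfl
    · obtain ⟨a, ha⟩ := (answerFrom w T
        (WordRAM.start (.seq (.assign 1 be) c.compile) Γ.x)).support_nonempty
      obtain ⟨h1, h2⟩ := hsupp a ha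
      match a with
      | none => exact absurd rfl h1
      | some true => exact absurd (h2 rfl) hno
      | some false => simpa using ha
  · refine le_trans ?_ hprob
    have : (2 / 3 : ℝ≥0∞) = ENNReal.ofReal (2 / 3) := by
      rw [ENNReal.ofReal_div_of_pos (by norm_num)]; simp
    rw [this]
    exact ENNReal.ofReal_le_ofReal (by linarith [hp hy])

/-! ### Program logic -/

/-- The variables a command may change. -/
def HCmd.wv : HCmd → List ℕ
  | .skip => []
  | .assign x _ => [x]
  | .store _ _ _ => []
  | .rand x _ => [x]
  | .seq p q => p.wv ++ q.wv
  | .cond _ p q => p.wv ++ q.wv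
  | .loop _ p => p.wv

/-- The arrays a command may change. -/
def HCmd.wa : HCmd → List ℕ
  | .skip => []
  | .assign _ _ => []
  | .store a _ _ => [a]
  | .rand _ _ => []
  | .seq p q => p.wa ++ q.wa
  | .cond _ p q => p.wa ++ q.wa
  | .loop _ p => p.wa

/-- The states `s` and `s'` differ only in places that `c` may change. -/
structure Frame (c : HCmd) (s s' : St) : Prop where
  var : ∀ x ∉ c.wv, s'.var x = s.var x
  arr : ∀ a ∉ c.wa, s'.arr a = s.arr a

theorem Frame.refl (c : HCmd) (s : St) : Frame c s s := ⟨fun _ _ => rfl, fun _ _ => rfl⟩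

theorem Frame.trans {c : HCmd} {s s' s'' : St} (h : Frame c s s') (h' : Frame c s' s'') :
    Frame c s s'' :=
  ⟨fun x hx => (h'.var x hx).trans (h.var x hx), fun a ha => (h'.arr a ha).trans (h.arr a ha)⟩

theorem Frame.weaken {c c' : HCmd} {s s' : St} (h : Frame c s s') (hv : c.wv ⊆ c'.wv)
    (ha : c.wa ⊆ c'.wa) : Frame c' s s' :=
  ⟨fun x hx => h.var x fun h' => hx (hv h'), fun x hx => h.arr x fun h' => hx (ha h')⟩

theorem Frame.setVar {c : HCmd} {s s' : St} (h : Frame c s s') {x : ℕ} (hx : x ∈ c.wv) (v : ℕ) :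
    Frame c s (s'.setVar x v) :=
  ⟨fun y hy => by rw [St.setVar_var, if_neg (by rintro rfl; exact hy hx), h.var y hy], h.arr⟩

/-- An execution leaves alone everything the command does not write to. -/
theorem Exec.frame {c : HCmd} {s : St} {t : ℕ} {p : ℝ} {Q : St → ℝ → Prop}
    (h : Exec Γ c s t p Q) : Exec Γ c s t p fun s' p' => Frame c s s' ∧ Q s' p' := by
  induction h with
  | skip hQ => exact .skip ⟨.refl _ _, hQ⟩
  | assign he hQ => exact .assign he ⟨(Frame.refl _ _).setVar (by simp [HCmd.wv]) _, hQ⟩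
  | @store a i e s p Q ha hi he hQ =>
    refine .store ha hi he ⟨⟨fun _ _ => rfl, fun b hb => ?_⟩, hQ⟩
    have : b ≠ a := by simpa [HCmd.wa] using hb
    funext j
    simp [this]
  | rand g he hpos hQ hg =>
    exact .rand g he hpos (fun i hi => ⟨(Frame.refl _ _).setVar (by simp [HCmd.wv]) _, hQ i hi⟩) hg
  | @seq a b s t t' p Q R _ _ ih₁ ih₂ =>
    refine .seq _ ih₁ fun s' p' h => ?_
    refine .conseq (ih₂ s' p' h.2) le_rfl le_rfl fun s'' p'' h' => ⟨?_, h'.2⟩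
    exact (h.1.weaken (by simp [HCmd.wv]) (by simp [HCmd.wa])).trans
      (h'.1.weaken (by simp [HCmd.wv]) (by simp [HCmd.wa]))
  | cond he _ ih =>
    refine .cond he (.conseq ih le_rfl le_rfl fun s'' p'' h' => ⟨?_, h'.2⟩)
    refine h'.1.weaken ?_ ?_ <;> split_ifs <;> simp [HCmd.wv, HCmd.wa]
  | loop_done he h0 hQ => exact .loop_done he h0 ⟨.refl _ _, hQ⟩
  | loop_step R he h0 _ _ ih₁ ih₂ =>
    refine .loop_step _ he h0 ih₁ fun s' p' h => ?_
    refine .conseq (ih₂ s' p' h.2) le_rfl le_rfl fun s'' p'' h' => ⟨?_, h'.2⟩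
    exact (h.1.weaken (by simp [HCmd.wv]) (by simp [HCmd.wa])).trans h'.1
  | conseq _ ht hp hQ ih =>
    exact .conseq ih ht hp fun s' p' h => ⟨h.1, hQ _ _ h.2⟩

theorem Exec.seq' {a b : HCmd} {s : St} {t t' T : ℕ} {p : ℝ} {R Q : St → ℝ → Prop}
    (h : Exec Γ a s t p R)
    (h' : ∀ s' p', Frame a s s' → R s' p' → Exec Γ b s' t' p' Q) (hT : t + t' + 1 ≤ T) :
    Exec Γ (a ;; b) s T p Q :=
  .conseq (.seq _ h.frame fun s' p' h => h' s' p' h.1 h.2) hT le_rfl fun _ _ h => h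

/-- Execution of a command that draws nothing: it ends within `t` steps in a state with `R`. -/
def Det (Γ : Env) (c : HCmd) (s : St) (t : ℕ) (R : St → Prop) : Prop :=
  ∀ p, Exec Γ c s t p fun s' p' => p' = p ∧ R s'

theorem Det.conseq {c : HCmd} {s : St} {t t' : ℕ} {R R' : St → Prop} (h : Det Γ c s t R)
    (ht : t ≤ t') (hR : ∀ s', Frame c s s' → R s' → R' s') : Det Γ c s t' R' := fun p =>
  .conseq (h p).frame ht le_rfl fun s' _ h => ⟨h.2.1, hR s' h.1 h.2.2⟩

theorem Det.skip {s : St} {t : ℕ} {R : St → Prop} (h : R s) (ht : 1 ≤ t) :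
    Det Γ .skip s t R := fun p =>
  .conseq (.skip (Q := fun s' p' => p' = p ∧ R s') ⟨rfl, h⟩) ht le_rfl fun _ _ h => h

theorem Det.seq {a b : HCmd} {s : St} {t t' T : ℕ} {R Q : St → Prop} (h : Det Γ a s t R)
    (h' : ∀ s', Frame a s s' → R s' → Det Γ b s' t' Q) (hT : t + t' + 1 ≤ T) :
    Det Γ (a ;; b) s T Q := fun p =>
  Exec.seq' (h p) (fun s' p' hf hR => by rw [hR.1]; exact h' s' hf hR.2 p) hT

theorem Det.assign {x : ℕ} {e : HExpr} {s : St} {t : ℕ} {R : St → Prop} (he : e.Ok Γ s)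
    (h : R (s.setVar x (e.eval Γ s))) (ht : 1 ≤ t) : Det Γ (.assign x e) s t R := fun p =>
  .conseq (.assign (Q := fun s' p' => p' = p ∧ R s') he ⟨rfl, h⟩) ht le_rfl fun _ _ h => h

theorem Det.store {a : ℕ} {i e : HExpr} {s : St} {t : ℕ} {R : St → Prop} (ha : a < 16)
    (hi : i.Ok Γ s) (he : e.Ok Γ s) (h : R (s.setArr a (i.eval Γ s) (e.eval Γ s)))
    (ht : 1 ≤ t) : Det Γ (.store a i e) s t R := fun p =>
  .conseq (.store (Q := fun s' p' => p' = p ∧ R s') ha hi he ⟨rfl, h⟩) ht le_rfl fun _ _ h => h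

theorem Det.cond {e : HExpr} {a b : HCmd} {s : St} {t T : ℕ} {R : St → Prop} (he : e.Ok Γ s)
    (ha : e.eval Γ s ≠ 0 → Det Γ a s t R) (hb : e.eval Γ s = 0 → Det Γ b s t R)
    (hT : t + 1 ≤ T) : Det Γ (.cond e a b) s T R := fun p =>
  .conseq (.cond he (Q := fun s' p' => p' = p ∧ R s') (by
    split_ifs with h
    · exact ha h p
    · exact hb (not_not.1 h) p)) hT le_rfl fun _ _ h => h

/-- Weakest preconditions for commands without loops and random draws. -/
def HCmd.wp (Γ : Env) : HCmd → St → (St → Prop) → Prop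
  | .skip, s, R => R s
  | .assign x e, s, R => e.Ok Γ s ∧ R (s.setVar x (e.eval Γ s))
  | .store a i e, s, R =>
      a < 16 ∧ i.Ok Γ s ∧ e.Ok Γ s ∧ R (s.setArr a (i.eval Γ s) (e.eval Γ s))
  | .rand _ _, _, _ => False
  | .seq p q, s, R => p.wp Γ s fun s' => q.wp Γ s' R
  | .cond e p q, s, R =>
      e.Ok Γ s ∧ (e.eval Γ s ≠ 0 → p.wp Γ s R) ∧ (e.eval Γ s = 0 → q.wp Γ s R)
  | .loop _ _, _, _ => False

/-- The running time of a command without loops. -/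
def HCmd.cost : HCmd → ℕ
  | .seq p q => p.cost + q.cost + 1
  | .cond _ p q => p.cost + q.cost + 1
  | _ => 1

/-- Commands without loops take at most `c.cost` steps. -/
theorem Det.of_wp {c : HCmd} {s : St} {t : ℕ} {R : St → Prop} (h : c.wp Γ s R)
    (ht : c.cost ≤ t) : Det Γ c s t R := by
  induction c generalizing s t R with
  | skip => exact .skip h ht
  | assign x e => exact .assign h.1 h.2 ht
  | store a i e => exact .store h.1 h.2.1 h.2.2.1 h.2.2.2 ht
  | rand => exact h.elim
  | seq p q ihp ihq => exact .seq (ihp h le_rfl) (fun s' _ h' => ihq h' le_rfl) ht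
  | cond e p q ihp ihq =>
    simp only [HCmd.cost] at ht
    exact .cond (t := p.cost + q.cost) h.1 (fun h' => ihp (h.2.1 h') (by omega))
      (fun h' => ihq (h.2.2 h') (by omega)) ht
  | loop => exact h.elim

/-- Execution of a command without loops and random draws, followed by another one. -/
theorem Det.wp_seq {a b : HCmd} {s : St} {t T : ℕ} {Q : St → Prop}
    (h : a.wp Γ s fun s' => Det Γ b s' t Q) (hT : a.cost + t + 1 ≤ T) : Det Γ (a ;; b) s T Q :=
  .seq (.of_wp h le_rfl) (fun _ _ h => h) hT

theorem Exec.wp_seq {a b : HCmd} {s : St} {t T : ℕ} {p : ℝ} {Q : St → ℝ → Prop}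
    (h : a.wp Γ s fun s' => Exec Γ b s' t p Q) (hT : a.cost + t + 1 ≤ T) :
    Exec Γ (a ;; b) s T p Q :=
  Exec.seq' (Det.of_wp h le_rfl p) (fun s' p' _ h => by rw [h.1]; exact h.2) hT

/-- `i` runs from `0` to `y - 1`. -/
def HCmd.for (i y : ℕ) (c : HCmd) : HCmd :=
  .assign i (.lit 0) ;; .loop ((HExpr.var i).lt (.var y)) (c ;; .assign i (.var i + .lit 1))

/-- The rule for `for`-loops. The invariant relates the loop counter `j`, a bound `r` for the time
that the remaining passes take, the state, and the bound for the probability of failure. -/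
theorem Exec.for_of_budget {i y : ℕ} {c : HCmd} {s : St} {n : ℕ} {p : ℝ} {Q : St → ℝ → Prop}
    (Inv : ℕ → ℕ → St → ℝ → Prop) {t r₀ : ℕ} (hn : s.var y = n) (hI : n < Γ.I)
    (hy : y ∉ (HCmd.for i y c).wv) (hi : i ∉ c.wv)
    (h0 : Inv 0 r₀ (s.setVar i 0) p)
    (hc : ∀ j < n, ∀ r s' p', Frame (HCmd.for i y c) s s' → s'.var i = j → Inv j r s' p' →
      ∃ t' r', t' + r' + 4 ≤ r ∧
        Exec Γ c s' t' p' fun s'' p'' => Inv (j + 1) r' (s''.setVar i (j + 1)) p'')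
    (hQ : ∀ r s' p', Inv n r s' p' → Q s' p') (ht : r₀ + 4 ≤ t) :
    Exec Γ (HCmd.for i y c) s t p Q := by
  have hwi : i ∈ (HCmd.for i y c).wv := by simp [HCmd.for, HCmd.wv]
  have hwc : c.wv ⊆ (HCmd.for i y c).wv := by
    intro x hx; simp [HCmd.for, HCmd.wv, hx]
  have hwa : c.wa ⊆ (HCmd.for i y c).wa := by
    intro x hx; simp [HCmd.for, HCmd.wa, hx]
  have key : ∀ m j, j + m = n → ∀ r s' p', Frame (HCmd.for i y c) s s' → s'.var i = j →
      Inv j r s' p' →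
      Exec Γ (.loop ((HExpr.var i).lt (.var y)) (c ;; .assign i (.var i + .lit 1))) s'
        (r + 1) p' Q := by
    intro m
    induction m with
    | zero =>
      rintro j rfl r s' p' hf hj hInv
      rw [add_zero] at *
      refine .conseq (.loop_done (by simp) ?_ (hQ r s' p' hInv)) (by omega) le_rfl
        fun _ _ h => h
      simp [hf.var y hy, hn, hj]
    | succ m ih =>
      intro j hjr r s' p' hf hj hInv
      have hlt : j < n := by omega
      obtain ⟨t', r', hr, hex⟩ := hc j hlt r s' p' hf hj hInv
      refine .conseq (t := t' + 1 + 1 + (r' + 1) + 1) ?_ (by omega) le_rfl fun _ _ h => h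
      refine .loop_step (fun s'' p'' => Frame (HCmd.for i y c) s s'' ∧ s''.var i = j + 1 ∧
        Inv (j + 1) r' s'' p'') (by simp) ?_ ?_
        fun s'' p'' h => ih (j + 1) (by omega) r' s'' p'' h.1 h.2.1 h.2.2
      · simp [hf.var y hy, hn, hj, hlt]
      · refine .seq _ hex.frame fun s'' p'' h => ?_
        have hij : s''.var i = j := by rw [h.1.var i hi, hj]
        refine .assign ?_ ?_
        · simp [hij]; omega
        · simp only [eval_add, eval_var, eval_lit, hij]
          exact ⟨(hf.trans (h.1.weaken hwc hwa)).setVar hwi _, by simp, h.2⟩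
  refine .conseq (t := 1 + (r₀ + 1) + 1)
    (.seq (fun s' p' => s' = s.setVar i 0 ∧ p' = p) (.assign (by simp) (by simp)) ?_) (by omega)
    le_rfl fun _ _ h => h
  rintro _ _ ⟨rfl, rfl⟩
  exact key n 0 (by omega) _ _ _ ((Frame.refl _ _).setVar hwi _) (by simp) h0

/-- A counting loop with an invariant, where the `j`-th repetition takes at most `T j` steps. -/
theorem Exec.for {i y : ℕ} {c : HCmd} {s : St} {n : ℕ} {p : ℝ} {Q : St → ℝ → Prop} (T : ℕ → ℕ)
    (Inv : ℕ → St → ℝ → Prop) {t : ℕ} (hn : s.var y = n) (hI : n < Γ.I)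
    (hy : y ∉ (HCmd.for i y c).wv) (hi : i ∉ c.wv)
    (h0 : Inv 0 (s.setVar i 0) p)
    (hc : ∀ j < n, ∀ s' p', Frame (HCmd.for i y c) s s' → s'.var i = j → Inv j s' p' →
      Exec Γ c s' (T j) p' fun s'' p'' => Inv (j + 1) (s''.setVar i (j + 1)) p'')
    (hQ : ∀ s' p', Inv n s' p' → Q s' p')
    (ht : ∑ j ∈ Finset.range n, (T j + 4) + 4 ≤ t) :
    Exec Γ (HCmd.for i y c) s t p Q := by
  refine Exec.for_of_budget (fun j r s' p' => r = ∑ x ∈ Finset.Ico j n, (T x + 4) ∧ Inv j s' p')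
    hn hI hy hi ⟨rfl, h0⟩ ?_ (fun r s' p' h => hQ s' p' h.2) (by rwa [← Finset.range_eq_Ico])
  rintro j hj r s' p' hf hij ⟨rfl, hInv⟩
  refine ⟨T j, ∑ x ∈ Finset.Ico (j + 1) n, (T x + 4), ?_, ?_⟩
  · rw [Finset.sum_eq_sum_Ico_succ_bot hj]; omega
  · exact .conseq (hc j hj s' p' hf hij hInv) le_rfl le_rfl fun _ _ h => ⟨rfl, h⟩

theorem Det.for {i y : ℕ} {c : HCmd} {s : St} {n : ℕ} {Q : St → Prop} (T : ℕ → ℕ)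
    (Inv : ℕ → St → Prop) {t : ℕ} (hn : s.var y = n) (hI : n < Γ.I)
    (hy : y ∉ (HCmd.for i y c).wv) (hi : i ∉ c.wv)
    (h0 : Inv 0 (s.setVar i 0))
    (hc : ∀ j < n, ∀ s', Frame (HCmd.for i y c) s s' → s'.var i = j → Inv j s' →
      Det Γ c s' (T j) fun s'' => Inv (j + 1) (s''.setVar i (j + 1)))
    (hQ : ∀ s', Inv n s' → Q s')
    (ht : ∑ j ∈ Finset.range n, (T j + 4) + 4 ≤ t) :
    Det Γ (HCmd.for i y c) s t Q := fun p =>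
  Exec.for T (fun j s' p' => p' = p ∧ Inv j s') hn hI hy hi ⟨rfl, h0⟩
    (fun j hj s' p' hf hij h => by rw [h.1]; exact hc j hj s' hf hij h.2 p)
    (fun s' p' h => ⟨h.1, hQ s' h.2⟩) ht

/-- A counting loop where the time is accounted for by a budget `r` that is part of the invariant,
and the time of each repetition is taken from the budget. -/
theorem Det.for_of_budget {i y : ℕ} {c : HCmd} {s : St} {n : ℕ} {Q : St → Prop}
    (Inv : ℕ → ℕ → St → Prop) {t r₀ : ℕ} (hn : s.var y = n) (hI : n < Γ.I)
    (hy : y ∉ (HCmd.for i y c).wv) (hi : i ∉ c.wv) (h0 : Inv 0 r₀ (s.setVar i 0))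
    (hc : ∀ j < n, ∀ r s', Frame (HCmd.for i y c) s s' → s'.var i = j → Inv j r s' →
      ∃ t' r', t' + r' + 4 ≤ r ∧
        Det Γ c s' t' fun s'' => Inv (j + 1) r' (s''.setVar i (j + 1)))
    (hQ : ∀ r s', Inv n r s' → Q s') (ht : r₀ + 4 ≤ t) :
    Det Γ (HCmd.for i y c) s t Q := fun p =>
  Exec.for_of_budget (fun j r s' p' => p' = p ∧ Inv j r s') hn hI hy hi ⟨rfl, h0⟩
    (fun j hj r s' p' hf hij h => by
      obtain ⟨t', r', hr, hd⟩ := hc j hj r s' hf hij h.2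
      rw [h.1]
      exact ⟨t', r', hr, hd p⟩)
    (fun r s' p' h => ⟨h.1, hQ r s' h.2⟩) ht

/-- `h` counts the `x` below `y` for which `c` leaves a nonzero number in `f`. -/
def HCmd.count (h x y f : ℕ) (c : HCmd) : HCmd :=
  .assign h (.lit 0) ;; .for x y (c ;; .cond (.var f) (.assign h (.var h + .lit 1)) .skip)

/-- The loop leaves in `h` the number of those `j < m` for which the body leaves a nonzero number in
`f`. -/
theorem Det.count {h x y f : ℕ} {c : HCmd} {s : St} {m : ℕ} (T : ℕ → ℕ) (P : ℕ → Prop)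
    [DecidablePred P] {t : ℕ} (hm : s.var y = m) (hI : m < Γ.I)
    (hy : y ∉ (HCmd.count h x y f c).wv) (hx : x ∉ c.wv) (hh : h ∉ c.wv) (hhx : h ≠ x)
    (hc : ∀ j < m, ∀ s', Frame (HCmd.count h x y f c) s s' → s'.var x = j →
      Det Γ c s' (T j) fun s'' => s''.var f ≠ 0 ↔ P j)
    (ht : ∑ j ∈ Finset.range m, (T j + 10) + 10 ≤ t) :
    Det Γ (HCmd.count h x y f c) s t fun s' =>
      s'.var h = ((Finset.range m).filter P).card := by
  have hwf : (HCmd.for x y (c ;; .cond (.var f) (.assign h (.var h + .lit 1)) .skip)).wv ⊆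
      (HCmd.count h x y f c).wv := by intro z hz; simp [HCmd.count, HCmd.wv, hz]
  have hwa : (HCmd.for x y (c ;; .cond (.var f) (.assign h (.var h + .lit 1)) .skip)).wa ⊆
      (HCmd.count h x y f c).wa := by intro z hz; simp [HCmd.count, HCmd.wa, hz]
  have hwh : h ∈ (HCmd.count h x y f c).wv := by simp [HCmd.count, HCmd.wv]
  have hyh : y ≠ h := by rintro rfl; exact hy hwh
  refine Det.wp_seq (t := ∑ j ∈ Finset.range m, (T j + 10) + 4) ?_ (by simp only [HCmd.cost]; omega)
  simp only [HCmd.wp, ok_lit, eval_lit, Nat.ofNat_pos, true_and]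
  refine Det.for (n := m) (fun j => T j + 5)
    (fun j s' => s'.var h = ((Finset.range j).filter P).card) ?_ hI (fun h' => hy (hwf h')) ?_ ?_ ?_
    (fun _ h => h) ?_
  · simp [hyh, hm]
  · simp [HCmd.wv, hx, hhx.symm]
  · simp [hhx]
  · intro j hj s' hf hij hInv
    have hf' : Frame (HCmd.count h x y f c) s s' :=
      ((Frame.refl _ s).setVar hwh 0).trans (hf.weaken hwf hwa)
    refine Det.seq (hc j hj s' hf' hij) (fun s'' hf'' hP => ?_) (t' := 4) (by omega)
    have hh' : s''.var h = ((Finset.range j).filter P).card := by rw [hf''.var h hh, hInv]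
    have hle : ((Finset.range j).filter P).card ≤ j :=
      (Finset.card_filter_le _ _).trans (by simp)
    refine Det.of_wp ?_ (by simp [HCmd.cost])
    simp only [HCmd.wp, ok_var, eval_var, true_and, ok_add, ok_lit, eval_add, eval_lit,
      St.setVar_var, if_true, if_neg hhx, hh', Finset.range_add_one, Finset.filter_insert]
    refine ⟨fun h1 => ⟨⟨by omega, by omega⟩, ?_⟩, fun h1 => ?_⟩
    · rw [if_pos (hP.1 h1), Finset.card_insert_of_notMem (by simp)]
    · rw [if_neg (fun h2 => hP.2 h2 h1)]
  · have : ∑ j ∈ Finset.range m, (T j + 5 + 4) ≤ ∑ j ∈ Finset.range m, (T j + 10) :=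
      Finset.sum_le_sum fun _ _ => by omega
    omega

/-- The number counted by `HCmd.count` tells whether there is an `x` of the kind in question. -/
theorem Det.exists {h x y f : ℕ} {c : HCmd} {s : St} {m : ℕ} (T : ℕ → ℕ) (P : ℕ → Prop)
    {t : ℕ} (hm : s.var y = m) (hI : m < Γ.I)
    (hy : y ∉ (HCmd.count h x y f c).wv) (hx : x ∉ c.wv) (hh : h ∉ c.wv) (hhx : h ≠ x)
    (hc : ∀ j < m, ∀ s', Frame (HCmd.count h x y f c) s s' → s'.var x = j →
      Det Γ c s' (T j) fun s'' => s''.var f ≠ 0 ↔ P j)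
    (ht : ∑ j ∈ Finset.range m, (T j + 10) + 10 ≤ t) :
    Det Γ (HCmd.count h x y f c) s t fun s' => s'.var h ≠ 0 ↔ ∃ j < m, P j := by
  classical
  refine (Det.count T P hm hI hy hx hh hhx hc ht).conseq le_rfl fun s' _ hs' => ?_
  rw [hs', Finset.card_ne_zero]
  simp [Finset.Nonempty]

/-! ### Graphs in memory -/

/-- The data the randomized search works on: a graph on `{0, …, n - 1}` given by neighbor lists,
where the list of `v` (preceded by its length) starts at the position `hd v` of the input; the
parameters `k` and `d`; and `l` bicliques, where `side j v` is `1` or `2` if `v` is on the first or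
second side of the `j`-th biclique, and `0` otherwise. -/
structure Inst where
  n : ℕ
  k : ℕ
  d : ℕ
  l : ℕ
  nbr : ℕ → List ℕ
  side : ℕ → ℕ → ℕ
  hd : ℕ → ℕ

/-- The neighbor lists are found in the input, and describe a simple graph. -/
structure Inst.Graph (X : Inst) (Γ : Env) : Prop where
  len : ∀ v < X.n, X.hd v + (X.nbr v).length < Γ.x.length
  deg : ∀ v < X.n, Γ.x.getD (X.hd v) 0 = (X.nbr v).length
  get : ∀ v < X.n, ∀ t (h : t < (X.nbr v).length), Γ.x.getD (X.hd v + t + 1) 0 = (X.nbr v)[t]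
  nodup : ∀ v < X.n, (X.nbr v).Nodup
  lt : ∀ v < X.n, ∀ u ∈ X.nbr v, u < X.n
  symm : ∀ v < X.n, ∀ u ∈ X.nbr v, v ∈ X.nbr u
  irrefl : ∀ v < X.n, v ∉ X.nbr v
  len_lt : Γ.x.length + 16 < Γ.I
  n_lt : X.n + 16 < Γ.I

/-- The numbers occurring in the search are below the bound. -/
structure Inst.Wf (X : Inst) (Γ : Env) : Prop extends X.Graph Γ where
  two_le : 2 ≤ X.k
  k_le : X.k ≤ X.n
  side_le : ∀ j v, X.side j v ≤ 2
  l_lt : X.l * X.n + X.l + X.n + 16 < Γ.I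
  B_lt : X.k * (X.d + 1) + X.d + 16 < Γ.I
  E_lt : X.k * (X.k + 1) + X.l * X.k + X.l + 16 < Γ.I

/-- The edge `uv` belongs to one of the bicliques. -/
def Inst.Cut (X : Inst) (u v : ℕ) : Prop := ∃ j < X.l, X.side j u * X.side j v = 2

theorem Inst.Cut.symm {X : Inst} {u v : ℕ} (h : X.Cut u v) : X.Cut v u := by
  obtain ⟨j, hj, h⟩ := h
  exact ⟨j, hj, by rw [mul_comm]; exact h⟩

/-- Array `0` holds the positions of the neighbor lists. -/
structure Inst.HoldsGraph (X : Inst) (s : St) : Prop where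
  n : s.var 1 = X.n
  k : s.var 2 = X.k
  hd : ∀ v < X.n, s.arr 0 v = X.hd v

/-- Variables `1` to `5` hold the parameters, array `0` the positions of the neighbor lists, and
array `1` the bicliques. -/
structure Inst.Holds (X : Inst) (s : St) : Prop extends X.HoldsGraph s where
  d : s.var 3 = X.d
  l : s.var 4 = X.l
  B : s.var 5 = X.k * (X.d + 1)
  side : ∀ j < X.l, ∀ v < X.n, s.arr 1 (j * X.n + v) = X.side j v

theorem Inst.HoldsGraph.frame {X : Inst} {c : HCmd} {s s' : St} (h : X.HoldsGraph s)
    (hf : Frame c s s') (hv : ∀ x ∈ [1, 2], x ∉ c.wv) (ha : ∀ a ∈ [0], a ∉ c.wa) :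
    X.HoldsGraph s' where
  n := by rw [hf.var _ (hv _ (by simp)), h.n]
  k := by rw [hf.var _ (hv _ (by simp)), h.k]
  hd v hv := by rw [hf.arr _ (ha _ (by simp)), h.hd v hv]

theorem Inst.Holds.frame {X : Inst} {c : HCmd} {s s' : St} (h : X.Holds s) (hf : Frame c s s')
    (hv : ∀ x ∈ [1, 2, 3, 4, 5], x ∉ c.wv) (ha : ∀ a ∈ [0, 1], a ∉ c.wa) : X.Holds s' where
  toHoldsGraph := h.toHoldsGraph.frame hf (fun x hx => hv x (by simp at hx ⊢; omega))
    (fun x hx => ha x (by simp at hx ⊢; omega))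
  d := by rw [hf.var _ (hv _ (by simp)), h.d]
  l := by rw [hf.var _ (hv _ (by simp)), h.l]
  B := by rw [hf.var _ (hv _ (by simp)), h.B]
  side j hj v hv := by rw [hf.arr _ (ha _ (by simp)), h.side j hj v hv]

/-- `h` counts the neighbors `u` (in variable `9`) of the vertex in variable `v` for which `c`
leaves a nonzero number in `f`. -/
def nbrCount (h f v : ℕ) (c : HCmd) : HCmd :=
  .assign 8 (.inp (.arr 0 (.var v))) ;;
  .count h 10 8 f (.assign 9 (.inp (.arr 0 (.var v) + .var 10 + .lit 1)) ;; c)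

theorem card_filter_range_getElem {α : Type*} (l : List α) (P : α → Prop) [DecidablePred P]
    (Q : ℕ → Prop) [DecidablePred Q] (hQ : ∀ t (h : t < l.length), Q t ↔ P l[t]) :
    ((Finset.range l.length).filter Q).card = l.countP P := by
  induction l using List.reverseRecOn with
  | nil => simp
  | append_singleton l a ih =>
    have hl := hQ l.length (by simp)
    rw [List.getElem_concat_length rfl] at hl
    rw [List.countP_append, ← ih fun t h => by
        rw [hQ t (by simp; omega), List.getElem_append_left h], List.length_append,
      List.length_singleton, Finset.range_add_one, Finset.filter_insert]
    by_cases ha : P a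
    · rw [if_pos (hl.2 ha), Finset.card_insert_of_notMem (by simp), List.countP_singleton,
        if_pos (by simpa using ha)]
    · rw [if_neg (fun h => ha (hl.1 h)), List.countP_singleton, if_neg (by simpa using ha),
        add_zero]

theorem det_nbrCount {X : Inst} (hX : X.Graph Γ) {h f v v₀ : ℕ} {c : HCmd} {s : St}
    (T : ℕ) (P : ℕ → Prop) [DecidablePred P] {t : ℕ} (hs : ∀ v < X.n, s.arr 0 v = X.hd v)
    (hv : s.var v = v₀) (hv₀ : v₀ < X.n)
    (h8 : 8 ∉ (h :: 9 :: 10 :: c.wv)) (h10 : 10 ∉ c.wv) (hh : h ∉ (9 :: 10 :: c.wv))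
    (hv' : v ∉ (h :: 8 :: 9 :: 10 :: c.wv)) (ha : 0 ∉ c.wa)
    (hc : ∀ u ∈ X.nbr v₀, ∀ s', Frame (nbrCount h f v c) s s' → s'.var 9 = u →
      Det Γ c s' T fun s'' => s''.var f ≠ 0 ↔ P u)
    (ht : (T + 12) * (X.nbr v₀).length + 12 ≤ t) :
    Det Γ (nbrCount h f v c) s t fun s' => s'.var h = (X.nbr v₀).countP P := by
  classical
  have hlen := hX.len v₀ hv₀
  have hI := hX.len_lt
  simp only [List.mem_cons, not_or] at h8 hh hv'
  refine Det.wp_seq (t := (T + 12) * (X.nbr v₀).length + 10) ?_ (by simp only [HCmd.cost]; omega)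
  simp only [HCmd.wp, ok_inp, ok_arr, ok_var, eval_var, eval_arr, eval_inp, hv, hs v₀ hv₀,
    hX.deg v₀ hv₀]
  refine ⟨⟨⟨by omega, trivial⟩, by omega⟩, ?_⟩
  refine (Det.count (m := (X.nbr v₀).length) (fun _ => T + 2)
    (fun t => ∃ h : t < (X.nbr v₀).length, P ((X.nbr v₀)[t]'h)) (by simp) (by omega) ?_ ?_ ?_ ?_ ?_
    ?_).conseq le_rfl fun s' _ hs' => ?_
  · simp [HCmd.count, HCmd.for, HCmd.wv, h8.2.2]; tauto
  · simp [HCmd.wv, h10]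
  · simp [HCmd.wv, hh]
  · exact hh.2.1
  · intro j hj s' hf hj'
    have hf' : Frame (nbrCount h f v c) s s' :=
      ((Frame.refl _ s).setVar (by simp [nbrCount, HCmd.wv]) _).trans (hf.weaken
        (fun z hz => by simp only [nbrCount, HCmd.wv, List.mem_append]; exact .inr hz)
        (fun z hz => by simp only [nbrCount, HCmd.wa, List.mem_append]; exact .inr hz))
    have h0 : s'.arr 0 v₀ = X.hd v₀ := by
      rw [hf'.arr 0 (by simp [nbrCount, HCmd.count, HCmd.for, HCmd.wa, ha]), hs v₀ hv₀]
    have hvv : s'.var v = v₀ := by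
      rw [hf'.var v (by
        simp [nbrCount, HCmd.count, HCmd.for, HCmd.wv]; tauto), hv]
    refine Det.wp_seq (t := T) ?_ (by simp only [HCmd.cost]; omega)
    simp only [HCmd.wp, ok_inp, ok_arr, ok_var, eval_var, eval_arr, eval_inp, hvv, ok_add, ok_lit,
      eval_add, eval_lit, hj', h0, hX.get v₀ hv₀ j hj, hj, exists_true_left]
    refine ⟨⟨⟨⟨⟨by omega, trivial⟩, trivial, by omega⟩, by omega, by omega⟩, by omega⟩, ?_⟩
    refine hc _ (List.getElem_mem _) _ ?_ (by simp)
    exact hf'.setVar (by simp [nbrCount, HCmd.count, HCmd.for, HCmd.wv]) _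
  · simp only [Finset.sum_const, Finset.card_range, smul_eq_mul]
    nlinarith
  · rw [hs', card_filter_range_getElem _ P]
    exact fun t h => ⟨fun h' => h'.2, fun h' => ⟨h, h'⟩⟩

/-- The number counted by `nbrCount` tells whether there is a neighbor of the kind in question. -/
theorem det_nbrExists {X : Inst} (hX : X.Graph Γ) {h f v v₀ : ℕ} {c : HCmd} {s : St}
    (T : ℕ) (P : ℕ → Prop) {t : ℕ} (hs : ∀ v < X.n, s.arr 0 v = X.hd v)
    (hv : s.var v = v₀) (hv₀ : v₀ < X.n)
    (h8 : 8 ∉ (h :: 9 :: 10 :: c.wv)) (h10 : 10 ∉ c.wv) (hh : h ∉ (9 :: 10 :: c.wv))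
    (hv' : v ∉ (h :: 8 :: 9 :: 10 :: c.wv)) (ha : 0 ∉ c.wa)
    (hc : ∀ u ∈ X.nbr v₀, ∀ s', Frame (nbrCount h f v c) s s' → s'.var 9 = u →
      Det Γ c s' T fun s'' => s''.var f ≠ 0 ↔ P u)
    (ht : (T + 12) * (X.nbr v₀).length + 12 ≤ t) :
    Det Γ (nbrCount h f v c) s t fun s' => s'.var h ≠ 0 ↔ ∃ u ∈ X.nbr v₀, P u := by
  classical
  refine (det_nbrCount hX T P hs hv hv₀ h8 h10 hh hv' ha hc ht).conseq le_rfl fun s' _ hs' => ?_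
  rw [hs', ← Nat.pos_iff_ne_zero, List.countP_pos_iff]
  simp

/-- Variable `11` tells whether the edge between the vertices in the variables `15` and `9` belongs
to a biclique. -/
def isCut : HCmd :=
  .count 11 12 4 13 (.assign 13
    ((HExpr.arr 1 (.var 12 * .var 1 + .var 15) * .arr 1 (.var 12 * .var 1 + .var 9)).eq (.lit 2)))

theorem idx_lt {l n j v : ℕ} (hj : j < l) (hv : v < n) : j * n + v < l * n := by
  calc j * n + v < j * n + n := by omega
    _ = (j + 1) * n := by ring
    _ ≤ l * n := Nat.mul_le_mul_right _ hj

theorem idx_inj {n j v j' v' : ℕ} (hv : v < n) (hv' : v' < n) :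
    j * n + v = j' * n + v' ↔ j = j' ∧ v = v' := by
  constructor
  · intro h
    have h1 : (j * n + v) / n = (j' * n + v') / n := by rw [h]
    rw [Nat.mul_comm j, Nat.mul_comm j', Nat.mul_add_div (by omega), Nat.mul_add_div (by omega),
      Nat.div_eq_of_lt hv, Nat.div_eq_of_lt hv', add_zero, add_zero] at h1
    subst h1
    omega
  · rintro ⟨rfl, rfl⟩; rfl

theorem det_isCut {X : Inst} (hX : X.Wf Γ) {v₀ u₀ : ℕ} {s : St} {t : ℕ} (hs : X.Holds s)
    (hv : s.var 15 = v₀) (hv₀ : v₀ < X.n) (hu : s.var 9 = u₀) (hu₀ : u₀ < X.n)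
    (ht : 11 * X.l + 10 ≤ t) :
    Det Γ isCut s t fun s' => s'.var 11 ≠ 0 ↔ X.Cut v₀ u₀ := by
  have hl := hX.l_lt
  refine Det.exists (m := X.l) (fun _ => 1) (fun j => X.side j v₀ * X.side j u₀ = 2) hs.l
    (by omega) (by decide) (by decide) (by decide) (by decide) ?_ ?_
  · intro j hj s' hf hj'
    have hH := hs.frame hf (by decide) (by decide)
    have h9 := hf.var 9 (by decide)
    have hvv := hf.var 15 (by decide)
    have hi1 := idx_lt hj hv₀
    have hi2 := idx_lt hj hu₀
    have hm : X.side j v₀ * X.side j u₀ ≤ 2 * 2 :=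
      Nat.mul_le_mul (hX.side_le _ _) (hX.side_le _ _)
    refine Det.of_wp ?_ le_rfl
    simp only [HCmd.wp, ok_eq, ok_mul, ok_arr, ok_add, ok_var, ok_lit, eval_add, eval_mul, eval_var,
      eval_arr, hj', hH.n, hvv, hv, h9, hu, hH.side j hj _ hv₀, hH.side j hj _ hu₀, St.setVar_var,
      if_true, eval_eq, eval_lit]
    refine ⟨⟨⟨⟨by omega, ⟨trivial, trivial, by omega⟩, trivial, by omega⟩,
      ⟨by omega, ⟨trivial, trivial, by omega⟩, trivial, by omega⟩, by omega⟩, by omega⟩, by simp⟩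
  · simp only [Finset.sum_const, Finset.card_range, smul_eq_mul]
    omega

/-! ### Removing vertices of small degree -/

/-- The first `τ` entries of `q` are distinct numbers below `m`, and `pos` tells their positions:
it is `i + 1` for the entry at position `i`, and `0` for the numbers that are not in the queue. -/
structure IsQueue (m τ : ℕ) (q pos : ℕ → ℕ) : Prop where
  lt : ∀ i < τ, q i < m
  pos_q : ∀ i < τ, pos (q i) = i + 1
  q_pos : ∀ v < m, pos v ≠ 0 → pos v ≤ τ ∧ q (pos v - 1) = v

section queue
variable {m τ : ℕ} {q pos : ℕ → ℕ}

theorem IsQueue.mono (h : IsQueue m τ q pos) (h0 : pos m = 0) : IsQueue (m + 1) τ q pos where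
  lt i hi := (h.lt i hi).trans (by omega)
  pos_q := h.pos_q
  q_pos v hv hp := by
    rcases Nat.lt_succ_iff_lt_or_eq.1 hv with hv | rfl
    · exact h.q_pos v hv hp
    · exact absurd h0 hp

/-- A new entry `v` is appended to the queue. -/
theorem IsQueue.push (h : IsQueue m τ q pos) {v : ℕ} (hv : v < m) (h0 : pos v = 0) :
    IsQueue m (τ + 1) (Function.update q τ v) (Function.update pos v (τ + 1)) where
  lt i hi := by
    rcases Nat.lt_succ_iff_lt_or_eq.1 hi with hi | rfl
    · rw [Function.update_of_ne (by omega)]; exact h.lt i hi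
    · rwa [Function.update_self]
  pos_q i hi := by
    rcases Nat.lt_succ_iff_lt_or_eq.1 hi with hi | rfl
    · have := h.pos_q i hi
      rw [Function.update_of_ne (a := i) (by omega), Function.update_of_ne, this]
      intro h'; rw [h', h0] at this; omega
    · simp
  q_pos w hw hp := by
    by_cases hwv : w = v
    · subst hwv; simp
    · rw [Function.update_of_ne hwv] at hp ⊢
      have := h.q_pos w hw hp
      rw [Function.update_of_ne (by omega)]
      exact ⟨by omega, this.2⟩

theorem IsQueue.injOn (h : IsQueue m τ q pos) : Set.InjOn q (Finset.range τ) := by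
  intro i hi j hj hij
  have hi := h.pos_q i (by simpa using hi)
  have hj := h.pos_q j (by simpa using hj)
  rw [hij] at hi; omega

theorem IsQueue.card_le (h : IsQueue m τ q pos) : τ ≤ m := by
  have := Finset.card_le_card_of_injOn (s := Finset.range τ) (t := Finset.range m) q
    (fun i hi => by simpa using h.lt i (by simpa using hi)) h.injOn
  simpa using this

theorem IsQueue.lt_of_unqueued (h : IsQueue m τ q pos) {v : ℕ} (hv : v < m) (h0 : pos v = 0) :
    τ < m :=
  (h.push hv h0).card_le

theorem IsQueue.pos_ne_zero (h : IsQueue m τ q pos) (hτ : τ = m) {v : ℕ} (hv : v < m) :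
    pos v ≠ 0 := fun h0 => absurd (h.lt_of_unqueued hv h0) (by omega)

theorem IsQueue.eq_of_pos (h : IsQueue m τ q pos) {v i : ℕ} (hv : v < m) (hp : pos v = i + 1) :
    q i = v := by
  have := (h.q_pos v hv (by omega)).2
  rwa [hp, Nat.add_sub_cancel] at this
end queue

/-- The invariant of the removal process. Of the queue `q` of length `τ`, the first `h` entries
have been removed. For a vertex `v` not in the queue, `dg v` is the number of neighbors that have
not been removed, plus a correction `extra v` while the removal of a vertex is under way. -/
structure PeelInv (n d : ℕ) (N : ℕ → Finset ℕ) (τ h : ℕ) (q pos dg extra : ℕ → ℕ) : Prop where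
  queue : IsQueue n τ q pos
  le : h ≤ τ
  out : ∀ v < n, pos v = 0 →
    dg v = ((N v).filter fun u => pos u = 0 ∨ h < pos u).card + extra v ∧ d < dg v
  queued : ∀ v < n, pos v ≠ 0 → ((N v).filter fun u => pos u = 0 ∨ pos v < pos u).card ≤ d

section peel
variable {n d τ h : ℕ} {N : ℕ → Finset ℕ} {q pos dg extra : ℕ → ℕ}

theorem PeelInv.congr_extra (H : PeelInv n d N τ h q pos dg extra) {extra' : ℕ → ℕ}
    (he : ∀ v < n, pos v = 0 → extra v = extra' v) : PeelInv n d N τ h q pos dg extra' where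
  queue := H.queue
  le := H.le
  out v hv h0 := by rw [← he v hv h0]; exact H.out v hv h0
  queued := H.queued

/-- The degree of a neighbor of the removed vertex is adjusted and stays above `d`. -/
theorem PeelInv.decrement (H : PeelInv n d N τ h q pos dg extra) {u : ℕ}
    (he : extra u = 1) (hd : d < dg u - 1) :
    PeelInv n d N τ h q pos (Function.update dg u (dg u - 1)) (Function.update extra u 0) where
  queue := H.queue
  le := H.le
  out v hv h0 := by
    have := H.out v hv h0
    by_cases hvu : v = u
    · subst hvu; simp only [Function.update_self]; omega
    · simpa only [Function.update_of_ne hvu] using this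
  queued := H.queued

/-- A neighbor whose degree drops to `d` enters the queue. -/
theorem PeelInv.decrement_push (H : PeelInv n d N τ h q pos dg extra) {u : ℕ} (hu : u < n)
    (h0 : pos u = 0) (he : extra u = 1) (hd : dg u - 1 ≤ d) :
    PeelInv n d N (τ + 1) h (Function.update q τ u) (Function.update pos u (τ + 1))
      (Function.update dg u (dg u - 1)) (Function.update extra u 0) where
  queue := H.queue.push hu h0
  le := H.le.trans (by omega)
  out v hv h0' := by
    have hvu : v ≠ u := by rintro rfl; simp at h0'
    rw [Function.update_of_ne hvu] at h0'
    rw [Function.update_of_ne hvu, Function.update_of_ne hvu]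
    convert H.out v hv h0' using 4
    refine Finset.filter_congr fun x _ => ?_
    by_cases hx : x = u
    · subst hx; have := H.le; simp [h0]; omega
    · rw [Function.update_of_ne hx]
  queued v hv hp := by
    by_cases hvu : v = u
    · subst hvu
      have hout := H.out v hv h0
      refine le_trans (Finset.card_le_card ?_) (show
        ((N v).filter fun u => pos u = 0 ∨ h < pos u).card ≤ d by omega)
      refine Finset.monotone_filter_right _ fun x hx => ?_
      by_cases hxv : x = v
      · subst hxv; exact fun _ => .inl h0
      · rw [Function.update_of_ne hxv, Function.update_self]
        have := H.le
        exact fun h' => h'.imp id (by omega)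
    · rw [Function.update_of_ne hvu] at hp ⊢
      convert H.queued v hv hp using 2
      refine Finset.filter_congr fun x _ => ?_
      by_cases hx : x = u
      · subst hx; have := (H.queue.q_pos v hv hp).1; simp [h0]; omega
      · rw [Function.update_of_ne hx]

/-- The head of the queue is removed; the degrees of its neighbors still have to be adjusted. -/
theorem PeelInv.pop (H : PeelInv n d N τ h q pos dg fun _ => 0) (hN : ∀ v < n, ∀ u ∈ N v, u < n)
    (hh : h < τ) {v : ℕ} (hv : q h = v) (hsymm : ∀ u < n, u ∈ N v ↔ v ∈ N u) :
    PeelInv n d N τ (h + 1) q pos dg fun u => if u ∈ N v then 1 else 0 where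
  queue := H.queue
  le := hh
  out u hu h0 := by
    obtain ⟨h1, h2⟩ := H.out u hu h0
    refine ⟨?_, h2⟩
    have hpv : pos v = h + 1 := by rw [← hv]; exact H.queue.pos_q h hh
    rw [h1, add_zero]
    by_cases huv : u ∈ N v
    · rw [if_pos huv, ← Finset.card_insert_of_notMem (a := v)]
      · congr 1
        ext x
        simp only [Finset.mem_filter, Finset.mem_insert]
        constructor
        · rintro ⟨hx, hx'⟩
          by_cases hxh : pos x = h + 1
          · left; rw [← hv, H.queue.eq_of_pos (hN u hu x hx) hxh]
          · right; exact ⟨hx, by omega⟩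
        · rintro (rfl | ⟨hx, hx'⟩)
          · exact ⟨(hsymm u hu).1 huv, by omega⟩
          · exact ⟨hx, by omega⟩
      · simp only [Finset.mem_filter]; omega
    · rw [if_neg huv, add_zero]
      congr 1
      refine Finset.filter_congr fun x hx => ?_
      have : pos x ≠ h + 1 := fun hxh => by
        rw [← H.queue.eq_of_pos (hN u hu x hx) hxh, hv] at hx
        exact huv ((hsymm u hu).2 hx)
      omega
  queued := H.queued

/-- When all vertices of the queue have been removed, either all vertices have been, and then each
has at most `d` neighbors behind it; or the remaining ones have degree more than `d`. -/
theorem PeelInv.result (H : PeelInv n d N τ h q pos dg fun _ => 0)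
    (hN : ∀ v < n, ∀ u ∈ N v, u < n) (hirr : ∀ v < n, v ∉ N v) (hh : h = τ) :
    (τ = n → ∀ v < n, ((N v).filter fun u => pos v ≤ pos u).card ≤ d) ∧
    (τ ≠ n → ∃ U : Finset ℕ, U.Nonempty ∧ (∀ v ∈ U, v < n) ∧
      ∀ v ∈ U, d < ((N v).filter fun u => u ∈ U).card) := by
  constructor
  · intro hτ v hv
    have hpv := H.queue.pos_ne_zero hτ hv
    refine le_trans (Finset.card_le_card ?_) (H.queued v hv hpv)
    intro u hu
    rw [Finset.mem_filter] at hu ⊢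
    refine ⟨hu.1, .inr (lt_of_le_of_ne hu.2 fun he => ?_)⟩
    have hun := hN v hv u hu.1
    have h1 := (H.queue.q_pos v hv hpv).2
    rw [he, (H.queue.q_pos u hun (by omega)).2] at h1
    subst h1
    exact hirr _ hv hu.1
  · intro hτ
    refine ⟨(Finset.range n).filter fun v => pos v = 0, ?_, fun v hv => by simp at hv; exact hv.1,
      fun v hv => ?_⟩
    · by_contra hne
      rw [Finset.not_nonempty_iff_eq_empty, Finset.filter_eq_empty_iff] at hne
      have hle := Finset.card_le_card_of_injOn (s := Finset.range n) (t := Finset.range τ)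
        (fun v => pos v - 1) (fun v hv => by
          have hv' := Finset.mem_range.1 hv
          have := H.queue.q_pos v hv' (hne hv)
          have := hne hv
          simp only [Finset.coe_range, Set.mem_Iio]; omega) (fun v hv w hw hvw => by
          have hv1 := H.queue.q_pos v (by simpa using hv) (hne (by simpa using hv))
          have hw1 := H.queue.q_pos w (by simpa using hw) (hne (by simpa using hw))
          simp only at hvw
          rw [← hv1.2, ← hw1.2, hvw])
      have := H.queue.card_le
      simp at hle
      omega
    · simp only [Finset.mem_filter, Finset.mem_range] at hv
      obtain ⟨h1, h2⟩ := H.out v hv.1 hv.2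
      rw [h1, add_zero] at h2
      refine lt_of_lt_of_le h2 (Finset.card_le_card ?_)
      intro u hu
      simp only [Finset.mem_filter, Finset.mem_range] at hu ⊢
      refine ⟨hu.1, hN v hv.1 u hu.1, ?_⟩
      rcases hu.2 with h' | h'
      · exact h'
      · by_contra hne
        have := (H.queue.q_pos u (hN v hv.1 u hu.1) hne).1
        omega
end peel

open Classical in
/-- The neighbors of `v` along edges that belong to no biclique. -/
noncomputable def Inst.keep (X : Inst) (v : ℕ) : Finset ℕ :=
  (X.nbr v).toFinset.filter fun u => ¬ X.Cut v u

/-- The number of vertices plus twice the number of edges. -/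
def Inst.size (X : Inst) : ℕ := ∑ v ∈ Finset.range X.n, ((X.nbr v).length + 1)

/-- The vertex in variable `v` enters the queue (array `4`, of the length in variable `14`); its
position is recorded in array `3`. -/
def push (v : ℕ) : HCmd :=
  .store 4 (.var 14) (.var v) ;; .assign 14 (.var 14 + .lit 1) ;; .store 3 (.var v) (.var 14)

/-- Computes the degrees outside the bicliques (in array `2`), and fills the queue with the vertices
of degree at most `d`. -/
def peelInit : HCmd :=
  .assign 14 (.lit 0) ;; .for 15 1
    (nbrCount 16 17 15 (isCut ;; .assign 17 ((HExpr.var 11).eq (.lit 0))) ;;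
      .store 2 (.var 15) (.var 16) ;;
      .cond ((HExpr.var 16).lt (.var 3 + .lit 1)) (push 15) (.store 3 (.var 15) (.lit 0)))

/-- Removes the vertices of the queue one by one. A vertex enters the queue when its degree drops
to `d`. -/
def peelMain : HCmd :=
  .for 18 1 (.cond ((HExpr.var 18).lt (.var 14))
    (.assign 15 (.arr 4 (.var 18)) ;; .assign 8 (.inp (.arr 0 (.var 15))) ;;
      .for 10 8 (.assign 9 (.inp (.arr 0 (.var 15) + .var 10 + .lit 1)) ;; isCut ;;
        .cond (.var 11) .skip (.cond (.arr 3 (.var 9)) .skip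
          (.store 2 (.var 9) (.arr 2 (.var 9) - .lit 1) ;;
            .cond ((HExpr.arr 2 (.var 9)).lt (.var 3 + .lit 1)) (push 9) .skip))))
    .skip)

theorem IsQueue.congr {m τ : ℕ} {q pos pos' : ℕ → ℕ} (h : IsQueue m τ q pos)
    (hp : ∀ v < m, pos' v = pos v) : IsQueue m τ q pos' where
  lt := h.lt
  pos_q i hi := by rw [hp _ (h.lt i hi)]; exact h.pos_q i hi
  q_pos v hv hv' := by rw [hp v hv] at hv' ⊢; exact h.q_pos v hv hv'

theorem IsQueue.extend {m τ : ℕ} {q pos : ℕ → ℕ} (h : IsQueue m τ q pos) :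
    IsQueue (m + 1) τ q (Function.update pos m 0) :=
  (h.congr (fun v hv => by rw [Function.update_of_ne (by omega)])).mono (by simp)

theorem IsQueue.extend_push {m τ : ℕ} {q pos : ℕ → ℕ} (h : IsQueue m τ q pos) :
    IsQueue (m + 1) (τ + 1) (Function.update q τ m) (Function.update pos m (τ + 1)) := by
  have := h.extend.push (v := m) (by omega) (by simp)
  rwa [Function.update_idem] at this

theorem Inst.card_keep {X : Inst} (hX : X.Graph Γ) {v : ℕ} (hv : v < X.n) (P : ℕ → Prop)
    [DecidablePred P] (hP : ∀ u, P u ↔ ¬ X.Cut v u) :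
    (X.nbr v).countP P = (X.keep v).card := by
  classical
  rw [List.countP_eq_length_filter, ← List.toFinset_card_of_nodup ((hX.nodup v hv).filter _)]
  congr 1
  ext u
  simp [keep, hP]

/-- After the initialization, no vertex has been removed, and those of degree at most `d` are
queued. -/
theorem det_peelInit {X : Inst} (hX : X.Wf Γ) {s : St} (hs : X.Holds s) {t : ℕ}
    (ht : 44 * (X.l + 1) * X.size + 6 ≤ t) :
    Det Γ peelInit s t fun s' => PeelInv X.n X.d X.keep (s'.var 14) 0 (s'.arr 4) (s'.arr 3)
      (s'.arr 2) fun _ => 0 := by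
  classical
  have hn := hX.n_lt
  have hB := hX.B_lt
  refine Det.wp_seq (t := 44 * (X.l + 1) * X.size + 4) ?_ (by simp only [HCmd.cost]; omega)
  simp only [HCmd.wp, ok_lit, eval_lit, Nat.ofNat_pos, true_and]
  refine Det.for (n := X.n) (fun v => 40 * (X.l + 1) * ((X.nbr v).length + 1))
    (fun j s' => IsQueue j (s'.var 14) (s'.arr 4) (s'.arr 3) ∧
      ∀ v < j, s'.arr 2 v = (X.keep v).card ∧ (s'.arr 3 v = 0 ↔ X.d < s'.arr 2 v))
    (by simp [hs.n]) (by omega) (by decide) (by decide) ?_ ?_ ?_ ?_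
  · refine ⟨⟨?_, ?_, ?_⟩, ?_⟩ <;> simp
  · intro j hj s' hf hj' ⟨hq, hdg⟩
    have hf0 : Frame peelInit s s' := ((Frame.refl _ s).setVar (by decide) 0).trans
      (hf.weaken (by decide) (by decide))
    have hs' := hs.frame hf0 (by decide) (by decide)
    refine Det.seq (t := (11 * X.l + 24) * (X.nbr j).length + 12) (t' := 9)
      (det_nbrCount hX.toGraph (11 * X.l + 12) (fun u => ¬ X.Cut j u) hs'.hd hj' hj (by decide)
        (by decide) (by decide) (by decide) (by decide) ?_ (by linarith)) ?_ ?_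
    · intro u hu s'' hf' hu'
      have hun := hX.lt j hj u hu
      refine Det.seq (t' := 1) (det_isCut hX (hs'.frame hf' (by decide) (by decide))
        (by rw [hf'.var 15 (by decide), hj']) hj hu' hun le_rfl) (fun s₃ hf₃ hc => ?_) (by omega)
      refine Det.of_wp ?_ le_rfl
      by_cases h : s₃.var 11 = 0 <;> simp [HCmd.wp, h, ← hc]
    · intro s'' hf' hc
      have h15 : s''.var 15 = j := by rw [hf'.var 15 (by decide), hj']
      have h14 : s''.var 14 = s'.var 14 := hf'.var 14 (by decide)
      have h3 : s''.var 3 = X.d := by rw [hf'.var 3 (by decide), hs'.d]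
      have ha4 : s''.arr 4 = s'.arr 4 := hf'.arr 4 (by decide)
      have ha3 : s''.arr 3 = s'.arr 3 := hf'.arr 3 (by decide)
      have ha2 : s''.arr 2 = s'.arr 2 := hf'.arr 2 (by decide)
      rw [Inst.card_keep hX.toGraph hj (fun u => ¬ X.Cut j u) fun _ => Iff.rfl] at hc
      have hcard := hq.card_le
      refine Det.of_wp ?_ le_rfl
      simp only [HCmd.wp, push, ok_var, ok_lt, ok_add, ok_lit, eval_var, eval_lt, eval_add,
        eval_lit, h15, hc, St.setArr_var, h3, St.setVar_var, h14, St.setVar_arr, ha4, ha3, ha2,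
        St.setArr_arr_eq, true_and, ne_eq, ite_eq_right_iff, one_ne_zero, imp_false, not_not,
        Nat.reduceEqDiff, ↓reduceIte]
      refine ⟨by omega, ⟨by omega, by omega⟩, fun hlt => ⟨by omega, ⟨by omega, by omega⟩, by omega,
        hq.extend_push, fun v hv => ?_⟩, fun hlt => ⟨by omega, by omega, hq.extend, fun v hv => ?_⟩⟩
      · by_cases hvj : v = j
        · subst hvj; simp; omega
        · simpa [Function.update_of_ne hvj] using hdg v (by omega)
      · by_cases hvj : v = j
        · subst hvj; simp; omega
        · simpa [Function.update_of_ne hvj] using hdg v (by omega)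
    · nlinarith
  · rintro s' ⟨hq, hdg⟩
    refine ⟨hq, Nat.zero_le _, fun v hv h0 => ?_, fun v hv h0 => ?_⟩
    · obtain ⟨h1, h2⟩ := hdg v hv
      refine ⟨?_, h2.1 h0⟩
      rw [h1, Finset.filter_true_of_mem (fun u _ => by omega), add_zero]
    · obtain ⟨h1, h2⟩ := hdg v hv
      refine (Finset.card_filter_le _ _).trans ?_
      have : ¬ X.d < (X.keep v).card := fun h => h0 (h2.2 (h1 ▸ h))
      omega
  · rw [Inst.size, Finset.mul_sum, add_le_add_iff_right]
    refine Finset.sum_le_sum fun v _ => ?_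
    nlinarith

theorem Inst.mem_keep {X : Inst} {v u : ℕ} : u ∈ X.keep v ↔ u ∈ X.nbr v ∧ ¬ X.Cut v u := by
  classical
  simp [keep]

theorem Inst.keep_symm {X : Inst} (hX : X.Graph Γ) {v u : ℕ} (hv : v < X.n) (hu : u < X.n) :
    u ∈ X.keep v ↔ v ∈ X.keep u := by
  rw [Inst.mem_keep, Inst.mem_keep]
  exact ⟨fun h => ⟨hX.symm v hv u h.1, fun h' => h.2 h'.symm⟩,
    fun h => ⟨hX.symm u hu v h.1, fun h' => h.2 h'.symm⟩⟩

theorem mem_drop_iff_of_nodup {l : List ℕ} (hl : l.Nodup) {t : ℕ} (ht : t < l.length) (w : ℕ) :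
    w ∈ l.drop (t + 1) ↔ w ∈ l.drop t ∧ w ≠ l[t] := by
  have h := List.drop_eq_getElem_cons ht
  have hnd : (l.drop t).Nodup := hl.sublist (List.drop_sublist _ _)
  rw [h] at hnd ⊢
  rw [List.nodup_cons] at hnd
  simp only [List.mem_cons]
  constructor
  · intro hw
    exact ⟨.inr hw, fun h' => hnd.1 (h' ▸ hw)⟩
  · rintro ⟨rfl | hw, hw'⟩
    · exact absurd rfl hw'
    · exact hw

open Classical in
/-- Handling one neighbor `u` of the vertex that is being removed. -/
theorem det_peelStep {X : Inst} (hX : X.Wf Γ) {s : St} (hs : X.Holds s) {v t h : ℕ}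
    (hv : v < X.n) (ht : t < (X.nbr v).length) (h10 : s.var 10 = t) (h15 : s.var 15 = v)
    (H : PeelInv X.n X.d X.keep (s.var 14) (h + 1) (s.arr 4) (s.arr 3) (s.arr 2)
      fun u => if u ∈ (X.nbr v).drop t ∧ ¬ X.Cut v u then 1 else 0) :
    Det Γ (.assign 9 (.inp (.arr 0 (.var 15) + .var 10 + .lit 1)) ;; isCut ;;
        .cond (.var 11) .skip (.cond (.arr 3 (.var 9)) .skip
          (.store 2 (.var 9) (.arr 2 (.var 9) - .lit 1) ;;
            .cond ((HExpr.arr 2 (.var 9)).lt (.var 3 + .lit 1)) (push 9) .skip)))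
      s (11 * X.l + 26) fun s' => PeelInv X.n X.d X.keep (s'.var 14) (h + 1) (s'.arr 4) (s'.arr 3)
        (s'.arr 2) (fun u => if u ∈ (X.nbr v).drop (t + 1) ∧ ¬ X.Cut v u then 1 else 0) ∧
        ∀ w < X.n, (s'.arr 3 w = 0 ∨ h + 1 < s'.arr 3 w) ↔ (s.arr 3 w = 0 ∨ h + 1 < s.arr 3 w) := by
  have hlen := hX.len v hv
  have hI := hX.len_lt
  have hn := hX.n_lt
  have hB := hX.B_lt
  have hu := hX.lt v hv _ (List.getElem_mem ht)
  have hmem : (X.nbr v)[t] ∈ (X.nbr v).drop t := by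
    rw [List.drop_eq_getElem_cons ht]; exact List.mem_cons_self
  have hdrop := mem_drop_iff_of_nodup (hX.nodup v hv) ht
  have hget := hX.get v hv t ht
  generalize (X.nbr v)[t] = u at hu hmem hdrop hget
  refine Det.wp_seq (t := 11 * X.l + 24) ?_ (by simp only [HCmd.cost]; omega)
  simp only [HCmd.wp, ok_inp, ok_arr, ok_var, ok_add, ok_lit, eval_var, eval_arr, eval_inp, eval_add,
    eval_lit, h10, h15, hs.hd v hv, hget]
  refine ⟨⟨⟨⟨⟨by omega, trivial⟩, trivial, by omega⟩, by omega, by omega⟩, by omega⟩, ?_⟩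
  have hs1 : X.Holds (s.setVar 9 u) := hs.frame (c := .assign 9 (.lit 0))
    ((Frame.refl _ s).setVar (by decide) _) (by decide) (by decide)
  refine Det.seq (t' := 13) (det_isCut hX hs1 (v₀ := v) (u₀ := u) (by simp [h15]) hv (by simp) hu
    le_rfl) (fun s₂ hf hc => ?_) (by omega)
  have e9 : s₂.var 9 = u := by rw [hf.var 9 (by decide)]; simp
  have e14 : s₂.var 14 = s.var 14 := by rw [hf.var 14 (by decide)]; simp
  have e3 : s₂.var 3 = X.d := by rw [hf.var 3 (by decide), hs1.d]
  have a4 : s₂.arr 4 = s.arr 4 := hf.arr 4 (by decide)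
  have a3 : s₂.arr 3 = s.arr 3 := hf.arr 3 (by decide)
  have a2 : s₂.arr 2 = s.arr 2 := hf.arr 2 (by decide)
  refine Det.of_wp ?_ (by simp [HCmd.cost, push])
  simp only [HCmd.wp, push, ok_var, ok_lt, ok_add, ok_sub, ok_arr, ok_lit, eval_var, eval_lt,
    eval_add, eval_sub, eval_arr, eval_lit, St.setArr_var, St.setVar_var, St.setVar_arr,
    St.setArr_arr_eq, true_and, ne_eq, ite_eq_right_iff, one_ne_zero, imp_false, not_not,
    Nat.reduceEqDiff, ↓reduceIte, e9, e14, e3, a4, a3, a2, Function.update_self]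
  refine ⟨fun hcut => ⟨H.congr_extra fun w hw h0 => ?_, fun _ _ => trivial⟩, fun hcut => ⟨⟨by omega, trivial⟩,
    fun hp => ⟨H.congr_extra fun w hw h0 => ?_, fun _ _ => trivial⟩, fun hp => ?_⟩⟩
  · have hcut := hc.1 hcut
    simp only [hdrop]
    by_cases hwu : w = u
    · subst hwu; simp [hcut]
    · simp [hwu]
  · simp only [hdrop]
    have hwu : w ≠ u := by rintro rfl; exact hp h0
    simp [hwu]
  · have hcut : ¬ X.Cut v u := fun h' => hc.2 h' hcut
    have hle := H.queue.lt_of_unqueued hu hp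
    have hex : (Function.update (fun u => if u ∈ (X.nbr v).drop t ∧ ¬ X.Cut v u then 1 else 0) u 0)
        = fun u => if u ∈ (X.nbr v).drop (t + 1) ∧ ¬ X.Cut v u then 1 else 0 := by
      funext w
      simp only [hdrop, Function.update_apply]
      by_cases hwu : w = u <;> simp [hwu]
    refine ⟨by omega, ⟨⟨by omega, trivial⟩, by omega⟩, ⟨⟨by omega, trivial⟩, by omega, by omega⟩, fun hlt => ⟨by omega,
      ⟨by omega, by omega⟩, by omega, ?_, ?_⟩, fun hlt => ⟨?_, fun _ _ => trivial⟩⟩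
    · rw [← hex]
      exact H.decrement_push hu hp (by simp [hmem, hcut]) (by omega)
    · intro w hw
      have := H.le
      simp only [Function.update_apply]
      split_ifs with hwu
      · subst hwu; simp only [hp, true_or, iff_true]; omega
      · exact Iff.rfl
    · rw [← hex]
      exact H.decrement (by simp [hmem, hcut]) (by omega)

open Classical in
/-- The removal process runs in linear time (up to the factor `l + 1` for recognizing deleted
edges): the removal of a vertex is paid for by its own neighbor list, and the budget consists of the
lists of the vertices that have not been removed. -/
theorem det_peelMain {X : Inst} (hX : X.Wf Γ) {s : St} (hs : X.Holds s) {t : ℕ}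
    (H₀ : PeelInv X.n X.d X.keep (s.var 14) 0 (s.arr 4) (s.arr 3) (s.arr 2) fun _ => 0)
    (ht : 50 * (X.l + 1) * X.size + 20 * X.n + 4 ≤ t) :
    Det Γ peelMain s t fun s' => PeelInv X.n X.d X.keep (s'.var 14) (s'.var 14) (s'.arr 4)
      (s'.arr 3) (s'.arr 2) fun _ => 0 := by
  have hn := hX.n_lt
  have hI := hX.len_lt
  refine Det.for_of_budget (n := X.n) (r₀ := 50 * (X.l + 1) * X.size + 20 * X.n)
    (fun h r s' => r = 50 * (X.l + 1) * (∑ v ∈ (Finset.range X.n).filter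
        (fun v => s'.arr 3 v = 0 ∨ h < s'.arr 3 v), ((X.nbr v).length + 1)) + 20 * (X.n - h) ∧
      PeelInv X.n X.d X.keep (s'.var 14) (min h (s'.var 14)) (s'.arr 4) (s'.arr 3) (s'.arr 2)
        fun _ => 0) hs.n (by omega) (by decide) (by decide) ⟨?_, ?_⟩ ?_ ?_ ht
  · rw [Finset.filter_true_of_mem (fun v _ => by omega)]; simp [Inst.size]
  · simpa using H₀
  · rintro h hh r s' hf h18 ⟨hr, H⟩
    have hs' := hs.frame hf (by decide) (by decide)
    by_cases hlt : h < s'.var 14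
    · rw [min_eq_left hlt.le] at H
      set v := s'.arr 4 h with hv
      have hvn : v < X.n := H.queue.lt h hlt
      have hpv : s'.arr 3 v = h + 1 := H.queue.pos_q h hlt
      have hdeg := hX.deg v hvn
      have hlen := hX.len v hvn
      refine ⟨(11 * X.l + 30) * (X.nbr v).length + 9, 50 * (X.l + 1) * (∑ v ∈ (Finset.range X.n).filter
        (fun v => s'.arr 3 v = 0 ∨ h + 1 < s'.arr 3 v), ((X.nbr v).length + 1)) +
          20 * (X.n - (h + 1)), ?_, ?_⟩
      · have : (Finset.range X.n).filter (fun v => s'.arr 3 v = 0 ∨ h < s'.arr 3 v) =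
            insert v ((Finset.range X.n).filter
              (fun v => s'.arr 3 v = 0 ∨ h + 1 < s'.arr 3 v)) := by
          ext w
          simp only [Finset.mem_filter, Finset.mem_range, Finset.mem_insert]
          constructor
          · rintro ⟨hw, hw'⟩
            by_cases hwh : s'.arr 3 w = h + 1
            · left; rw [hv, H.queue.eq_of_pos hw hwh]
            · right; exact ⟨hw, by omega⟩
          · rintro (rfl | ⟨hw, hw'⟩)
            · exact ⟨hvn, by omega⟩
            · exact ⟨hw, by omega⟩
        rw [hr, this, Finset.sum_insert (by simp; omega)]
        have : 20 * (X.n - h) = 20 * (X.n - (h + 1)) + 20 := by omega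
        rw [this]
        nlinarith
      · refine Det.cond (t := (11 * X.l + 30) * (X.nbr v).length + 8) (by simp) (fun _ => ?_)
          (fun h' => by simp [h18, hlt] at h') le_rfl
        refine Det.wp_seq (t := (11 * X.l + 30) * (X.nbr v).length + 6) ?_
          (by simp only [HCmd.cost]; omega)
        simp only [HCmd.wp, ok_arr, ok_var, eval_arr, eval_var, h18, ← hv]
        refine ⟨⟨by omega, trivial⟩, ?_⟩
        refine Det.wp_seq (t := (11 * X.l + 30) * (X.nbr v).length + 4) ?_
          (by simp only [HCmd.cost]; omega)
        simp only [HCmd.wp, ok_arr, ok_var, ok_inp, eval_arr, eval_var, eval_inp, St.setVar_var,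
          ↓reduceIte, St.setVar_arr, hs'.hd v hvn, hdeg]
        refine ⟨⟨⟨by omega, trivial⟩, by omega⟩, ?_⟩
        refine Det.for (n := (X.nbr v).length) (fun _ => 11 * X.l + 26)
          (fun t s'' => PeelInv X.n X.d X.keep (s''.var 14) (h + 1) (s''.arr 4) (s''.arr 3)
            (s''.arr 2) (fun u => if u ∈ (X.nbr v).drop t ∧ ¬ X.Cut v u then 1 else 0) ∧
            ∀ w < X.n, (s''.arr 3 w = 0 ∨ h + 1 < s''.arr 3 w) ↔
              (s'.arr 3 w = 0 ∨ h + 1 < s'.arr 3 w)) (by simp) (by omega) (by decide) (by decide)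
          ⟨?_, fun _ _ => Iff.rfl⟩ ?_ ?_ ?_
        · simp only [St.setVar_arr, St.setVar_var, Nat.reduceEqDiff, ↓reduceIte]
          refine (H.pop (fun w hw u hu => hX.lt w hw u (Inst.mem_keep.1 hu).1) hlt hv.symm
            (fun u hu => Inst.keep_symm hX.toGraph hvn hu)).congr_extra fun w _ _ => ?_
          simp [Inst.mem_keep]
        · rintro t' ht' s'' hf' h10 ⟨H', hpos⟩
          have h15 : s''.var 15 = v := by rw [hf'.var 15 (by decide)]; simp
          have hf0 : Frame peelMain s' s'' := by
            refine Frame.trans ?_ (hf'.weaken (by decide) (by decide))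
            exact ((Frame.refl _ s').setVar (by decide) _).setVar (by decide) _
          refine (det_peelStep hX (hs'.frame hf0 (by decide) (by decide)) hvn ht' h10 h15
            H').conseq le_rfl fun s₃ _ h₃ => ⟨h₃.1, fun w hw => (h₃.2 w hw).trans (hpos w hw)⟩
        · rintro s₃ ⟨H₃, hpos⟩
          refine ⟨?_, ?_⟩
          · congr 2
            refine Finset.sum_congr (Finset.filter_congr fun w hw => ?_) fun _ _ => rfl
            exact (hpos w (by simpa using hw)).symm
          · have := H₃.le
            rw [if_neg (by decide), min_eq_left this]
            exact H₃.congr_extra fun w _ _ => by simp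
        · simp only [Finset.sum_const, Finset.card_range, smul_eq_mul]
          nlinarith
    · refine ⟨2, 50 * (X.l + 1) * (∑ v ∈ (Finset.range X.n).filter
        (fun v => s'.arr 3 v = 0 ∨ h + 1 < s'.arr 3 v), ((X.nbr v).length + 1)) +
          20 * (X.n - (h + 1)), ?_, ?_⟩
      · rw [hr]
        have : ∑ v ∈ (Finset.range X.n).filter
            (fun v => s'.arr 3 v = 0 ∨ h + 1 < s'.arr 3 v), ((X.nbr v).length + 1) ≤
            ∑ v ∈ (Finset.range X.n).filter
              (fun v => s'.arr 3 v = 0 ∨ h < s'.arr 3 v), ((X.nbr v).length + 1) :=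
          Finset.sum_le_sum_of_subset (Finset.monotone_filter_right _ fun w _ h' =>
            h'.imp id (by omega))
        have h20 : 20 * (X.n - h) = 20 * (X.n - (h + 1)) + 20 := by omega
        rw [h20]
        have := Nat.mul_le_mul_left (50 * (X.l + 1)) this
        omega
      · refine Det.cond (t := 1) (by simp) (fun h' => by simp [h18, hlt] at h') (fun _ => ?_) le_rfl
        refine Det.skip ?_ le_rfl
        rw [min_eq_right (by omega)] at H
        simp only [St.setVar_var, St.setVar_arr]
        rw [if_neg (by decide), min_eq_right (by omega)]
        exact ⟨rfl, H⟩
  · rintro r s' ⟨-, H⟩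
    rwa [min_eq_right H.queue.card_le] at H

/-- The outcome of the removal process: an order of the vertices (in array `3`) such that each has
at most `d` neighbors behind it, if `14` holds `n`; otherwise, a set of vertices that all have
degree more than `d` inside the set. -/
theorem det_peel {X : Inst} (hX : X.Wf Γ) {s : St} (hs : X.Holds s) {t : ℕ}
    (ht : 94 * (X.l + 1) * X.size + 20 * X.n + 11 ≤ t) :
    Det Γ (peelInit ;; peelMain) s t fun s' =>
      s'.var 14 ≤ X.n ∧ (∀ v < X.n, s'.arr 3 v ≤ X.n) ∧
      (s'.var 14 = X.n → ∀ v < X.n, ((X.keep v).filter fun u => s'.arr 3 v ≤ s'.arr 3 u).card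
        ≤ X.d) ∧
      (s'.var 14 ≠ X.n → ∃ U : Finset ℕ, U.Nonempty ∧ (∀ v ∈ U, v < X.n) ∧
        ∀ v ∈ U, X.d < ((X.keep v).filter fun u => u ∈ U).card) := by
  refine Det.seq (det_peelInit hX hs le_rfl) (fun s' hf H => ?_)
    (t' := 50 * (X.l + 1) * X.size + 20 * X.n + 4) (by nlinarith)
  refine (det_peelMain hX (hs.frame hf (by decide) (by decide)) H le_rfl).conseq le_rfl
    fun s'' _ H' => ⟨H'.queue.card_le, fun v hv => ?_, ?_⟩
  · by_cases h0 : s''.arr 3 v = 0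
    · omega
    · exact (H'.queue.q_pos v hv h0).1.trans H'.queue.card_le
  · exact H'.result (fun w hw u hu => hX.lt w hw u (Inst.mem_keep.1 hu).1)
      (fun v hv h => hX.irrefl v hv (Inst.mem_keep.1 h).1) rfl

/-! ### One round of the randomized search -/

/-- Every vertex draws a number below `B`; the numbers below `k` are colors. -/
def draw : HCmd := .for 15 1 (.rand 9 (.var 5) ;; .store 5 (.var 15) (.var 9))

/-- For each biclique and each color except the last, one side of the biclique loses that color.
Variable `20` holds `k - 1`. -/
def breakBicliques : HCmd :=
  .assign 20 (.var 2 - .lit 1) ;; .for 12 4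
    (.for 21 20 (.rand 9 (.lit 2) ;; .store 6 (.var 21) (.var 9 + .lit 1)) ;;
      .for 15 1 (.assign 22 (.arr 5 (.var 15)) ;;
        .cond ((HExpr.var 22).lt (.var 20))
          (.cond ((HExpr.arr 6 (.var 22)).eq (.arr 1 (.var 12 * .var 1 + .var 15)))
            (.store 5 (.var 15) (.var 5)) .skip) .skip))

/-- A vertex loses its color, unless this is the last one, if a neighbor that is not before it in
the order has the same color. -/
def resolve : HCmd :=
  .for 15 1 (.assign 22 (.arr 5 (.var 15)) ;;
    .cond ((HExpr.var 22).lt (.var 20))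
      (nbrCount 16 17 15 (.assign 17 (((HExpr.arr 5 (.var 9)).eq (.var 22)) *
          (.lit 1 - (HExpr.arr 3 (.var 9)).lt (.arr 3 (.var 15))))) ;;
        .cond (.var 16) (.store 5 (.var 15) (.var 5)) .skip) .skip)

/-- Sets the answer to "Yes" if for each color `i` some vertex of color `i` has neighbors of all
smaller colors. -/
def check : HCmd :=
  .count 23 24 2 25
    (.count 26 15 1 17
      (.assign 17 (.lit 0) ;; .cond ((HExpr.arr 5 (.var 15)).eq (.var 24))
        (.count 27 28 24 29
            (nbrCount 16 30 15 (.assign 30 ((HExpr.arr 5 (.var 9)).eq (.var 28))) ;;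
              .assign 29 ((HExpr.var 16).eq (.lit 0))) ;;
          .assign 17 ((HExpr.var 27).eq (.lit 0))) .skip) ;;
      .assign 25 ((HExpr.var 26).eq (.lit 0))) ;;
  .cond (.var 23) .skip (.assign 0 (.lit 1))

/-- A random partial coloring in which no two adjacent vertices share one of the first `k - 1`
colors; the answer becomes "Yes" if it has the property of a partial Grundy coloring. -/
def trial : HCmd := draw ;; breakBicliques ;; resolve ;; check

/-- For each color `i < k` some vertex of color `i` has neighbors of all smaller colors. -/
def Inst.Full (X : Inst) (C : ℕ → ℕ) : Prop :=
  ∀ i < X.k, ∃ v < X.n, C v = i ∧ ∀ j < i, ∃ u ∈ X.nbr v, C u = j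

/-- Adjacent vertices do not share any of the first `k - 1` colors. -/
def Inst.Proper (X : Inst) (C : ℕ → ℕ) : Prop :=
  ∀ v < X.n, ∀ u ∈ X.nbr v, C u = C v → X.k - 1 ≤ C v

/-- `p` bounds the probability of failure of a search in which so far everything went well (if
`good` holds), the rest of the round succeeds with probability at least `q`, and after an
unsuccessful round one fails with probability at most `ρ`. -/
def Pay (good : Prop) (q ρ p : ℝ) : Prop := (good ∧ p = (1 - q) * ρ) ∨ p = ρ

theorem Pay.mono {good good' : Prop} {q ρ p : ℝ} (h : Pay good q ρ p) (hg : good → good') :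
    Pay good' q ρ p := h.imp (fun h => ⟨hg h.1, h.2⟩) id

/-- A random draw, when the values in `S` are the good ones. -/
theorem Exec.rand_pay {x : ℕ} {e : HExpr} {s : St} {p q q' ρ : ℝ} {b : ℕ} {good : Prop}
    (good' : ℕ → Prop) (S : Finset ℕ) (he : e.Ok Γ s) (hb : e.eval Γ s = b) (hb0 : 0 < b)
    (hS : S ⊆ Finset.range b) (h : Pay good q ρ p) (hg : good → ∀ i ∈ S, good' i)
    (hρ : 0 ≤ ρ) (hq : b * q ≤ S.card * q') :
    Exec Γ (.rand x e) s 1 p fun s' p' => ∃ i < b, s' = s.setVar x i ∧ Pay (good' i) q' ρ p' := by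
  classical
  rcases h with ⟨hgood, rfl⟩ | rfl
  · refine .rand (fun i => if i ∈ S then (1 - q') * ρ else ρ) he (by omega) ?_ ?_
    · intro i hi
      refine ⟨i, by omega, rfl, ?_⟩
      split_ifs with hiS
      · exact .inl ⟨hg hgood i hiS, rfl⟩
      · exact .inr rfl
    · rw [hb]
      have : ∀ i ∈ Finset.range b, (if i ∈ S then (1 - q') * ρ else ρ) =
          ρ - if i ∈ S then q' * ρ else 0 := by
        intro i _; split_ifs <;> ring
      rw [Finset.sum_congr rfl this, Finset.sum_sub_distrib, Finset.sum_ite_mem,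
        Finset.inter_eq_right.2 hS]
      simp only [Finset.sum_const, Finset.card_range, nsmul_eq_mul]
      nlinarith [mul_le_mul_of_nonneg_right hq hρ]
  · refine .rand (fun _ => p) he (by omega) ?_ ?_
    · intro i hi
      exact ⟨i, by omega, rfl, .inr rfl⟩
    · simp

/-- The draws of the vertices multiply the chance of success by the fractions of good values. -/
theorem exec_draw {X : Inst} (hX : X.Wf Γ) {s : St} (hs : X.Holds s) {t : ℕ} {good : Prop}
    {q' ρ p : ℝ} (S : ℕ → Finset ℕ) (hS : ∀ v, S v ⊆ Finset.range (X.k * (X.d + 1)))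
    (hρ : 0 ≤ ρ)
    (h : Pay good ((∏ v ∈ Finset.range X.n, ((S v).card / (X.k * (X.d + 1) : ℕ) : ℝ)) * q') ρ p)
    (ht : 7 * X.n + 4 ≤ t) :
    Exec Γ draw s t p fun s' p' => (∀ v < X.n, s'.arr 5 v ≤ X.k * (X.d + 1)) ∧
      Pay (good ∧ ∀ v < X.n, s'.arr 5 v ∈ S v) q' ρ p' := by
  have hk := hX.two_le
  have hB0 : 0 < X.k * (X.d + 1) := by positivity
  have hB0' : (0 : ℝ) < (X.k * (X.d + 1) : ℕ) := by exact_mod_cast hB0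
  have hB := hX.B_lt
  have hn := hX.n_lt
  refine Exec.for (n := X.n) (fun _ => 3) (fun j s' p' =>
    (∀ v < j, s'.arr 5 v ≤ X.k * (X.d + 1)) ∧ Pay (good ∧ ∀ v < j, s'.arr 5 v ∈ S v)
      ((∏ v ∈ Finset.Ico j X.n, ((S v).card / (X.k * (X.d + 1) : ℕ) : ℝ)) * q') ρ p')
    hs.n (by omega) (by decide) (by decide) ⟨by simp, ?_⟩ ?_ ?_ ?_
  · rw [← Finset.range_eq_Ico]
    exact h.mono fun h => ⟨h, by simp⟩
  · rintro j hj s' p' hf hj' ⟨hle, hpay⟩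
    have hs' := hs.frame hf (by decide) (by decide)
    refine Exec.seq' (t := 1) (t' := 1) (Exec.rand_pay (b := X.k * (X.d + 1))
      (fun i => (good ∧ ∀ v < j, s'.arr 5 v ∈ S v) ∧ i ∈ S j) (S j) (by simp) (by simp [hs'.B])
      hB0 (hS j) hpay (fun h i hi => ⟨h, hi⟩) hρ
      (q' := (∏ v ∈ Finset.Ico (j + 1) X.n, ((S v).card / (X.k * (X.d + 1) : ℕ) : ℝ)) * q') ?_)
      ?_ le_rfl
    · rw [Finset.prod_eq_prod_Ico_succ_bot hj]
      refine le_of_eq ?_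
      field_simp
    · rintro _ p'' - ⟨i, hi, rfl, hpay'⟩
      refine .store (by decide) (by simp) (by simp) ⟨?_, hpay'.mono ?_⟩
      · intro v hv
        simp only [eval_var, St.setVar_arr, St.setArr_arr, St.setVar_var, hj']
        by_cases hvj : v = j
        · subst hvj; simp; omega
        · simpa [hvj] using hle v (by omega)
      · rintro ⟨⟨hg, hS'⟩, hiS⟩
        refine ⟨hg, fun v hv => ?_⟩
        simp only [eval_var, St.setVar_arr, St.setArr_arr, St.setVar_var, hj']
        by_cases hvj : v = j
        · subst hvj; simpa using hiS
        · simpa [hvj] using hS' v (by omega)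
  · rintro s' p' ⟨hle, hpay⟩
    exact ⟨hle, by simpa using hpay⟩
  · simp only [Finset.sum_const, Finset.card_range, smul_eq_mul]
    omega

/-- A colored set `W` of vertices that the search can find. The colors are given by `χ`; when the
vertices of `W` have their colors, and the vertices of `A` have none, then no vertex of `W` loses
its color when conflicts are resolved along the order `pos`. -/
structure Inst.Target (X : Inst) (pos : ℕ → ℕ) (W A : Finset ℕ) (χ : ℕ → ℕ) : Prop where
  lt : ∀ w ∈ W, w < X.n
  lt' : ∀ x ∈ A, x < X.n
  color : ∀ w ∈ W, χ w < X.k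
  side : ∀ j < X.l, ∀ i < X.k - 1, ∃ b < 2, ∀ w ∈ W, χ w = i → X.side j w ≠ b + 1
  behind : ∀ w ∈ W, ∀ u ∈ X.keep w, pos w ≤ pos u → u ∈ W ∨ u ∈ A
  proper : ∀ w ∈ W, ∀ u ∈ W, u ∈ X.nbr w → χ u ≠ χ w
  full : ∀ i < X.k, ∃ v ∈ W, χ v = i ∧ ∀ j < i, ∃ u ∈ W, u ∈ X.nbr v ∧ χ u = j

/-- The vertices of `W` have the colors given by `χ`, and those of `A` have none. -/
def Good (k : ℕ) (W A : Finset ℕ) (χ C : ℕ → ℕ) : Prop :=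
  (∀ w ∈ W, C w = χ w) ∧ ∀ x ∈ A, k ≤ C x

/-- The effect of breaking one biclique, when side `bit i` loses the color `i`. -/
theorem det_breakOne {X : Inst} (hX : X.Wf Γ) {s : St} (hs : X.Holds s) {t j : ℕ}
    (hj : j < X.l) (h12 : s.var 12 = j) (h20 : s.var 20 = X.k - 1) (ht : 11 * X.n + 4 ≤ t) :
    Det Γ (.for 15 1 (.assign 22 (.arr 5 (.var 15)) ;;
        .cond ((HExpr.var 22).lt (.var 20))
          (.cond ((HExpr.arr 6 (.var 22)).eq (.arr 1 (.var 12 * .var 1 + .var 15)))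
            (.store 5 (.var 15) (.var 5)) .skip) .skip)) s t fun s' =>
      ∀ v < X.n, s'.arr 5 v = if s.arr 5 v < X.k - 1 ∧ s.arr 6 (s.arr 5 v) = X.side j v then
        X.k * (X.d + 1) else s.arr 5 v := by
  have hn := hX.n_lt
  have hl := hX.l_lt
  refine Det.for (n := X.n) (fun _ => 7) (fun m s' => (∀ v < m, s'.arr 5 v =
      if s.arr 5 v < X.k - 1 ∧ s.arr 6 (s.arr 5 v) = X.side j v then X.k * (X.d + 1)
      else s.arr 5 v) ∧ ∀ v ≥ m, s'.arr 5 v = s.arr 5 v)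
    hs.n (by omega) (by decide) (by decide) (by simp) ?_ (fun s' h => h.1) ?_
  · rintro m hm s' hf hm' ⟨h1, h2⟩
    have hs' := hs.frame hf (by decide) (by decide)
    have e12 : s'.var 12 = j := by rw [hf.var 12 (by decide), h12]
    have e20 : s'.var 20 = X.k - 1 := by rw [hf.var 20 (by decide), h20]
    have a6 : s'.arr 6 = s.arr 6 := hf.arr 6 (by decide)
    have hidx := idx_lt hj hm
    refine Det.of_wp ?_ (by simp [HCmd.cost])
    simp only [HCmd.wp, ok_arr, ok_var, eval_arr, eval_var, hm', h2 m le_rfl, ok_lt, eval_lt,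
      St.setVar_var, ↓reduceIte, Nat.reduceEqDiff, e20, ok_eq, ok_add, ok_mul, eval_eq, eval_add,
      eval_mul, e12, hs'.n, St.setVar_arr, hs'.side j hj m hm, a6, hs'.B, ne_eq, ite_eq_right_iff,
      one_ne_zero, imp_false, not_not, true_and]
    have key : ∀ (s'' : St) (_ : s''.arr 5 = Function.update (s'.arr 5) m
        (if s.arr 5 m < X.k - 1 ∧ s.arr 6 (s.arr 5 m) = X.side j m then X.k * (X.d + 1)
          else s.arr 5 m)), (∀ v < m + 1, s''.arr 5 v =
      if s.arr 5 v < X.k - 1 ∧ s.arr 6 (s.arr 5 v) = X.side j v then X.k * (X.d + 1)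
      else s.arr 5 v) ∧ ∀ v ≥ m + 1, s''.arr 5 v = s.arr 5 v := by
      intro s'' h
      constructor
      · intro v hv
        by_cases hvm : v = m
        · subst hvm; rw [h, Function.update_self]
        · rw [h, Function.update_of_ne hvm, h1 v (by omega)]
      · intro v hv
        rw [h, Function.update_of_ne (by omega), h2 v (by omega)]
    have hself : Function.update (s'.arr 5) m (s.arr 5 m) = s'.arr 5 := by
      rw [← h2 m le_rfl, Function.update_eq_self]
    refine ⟨⟨by omega, trivial⟩, fun hlt => ⟨⟨⟨by omega, trivial⟩, by omega, by omega, by omega⟩,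
      fun heq => ⟨by omega, key _ ?_⟩, fun heq => key _ ?_⟩, fun hlt => key _ ?_⟩
    · simp only [St.setVar_arr, St.setArr_arr_eq, ↓reduceIte]
      rw [if_pos ⟨hlt, heq⟩]
    · rw [if_neg (fun h => heq h.2), hself]
    · rw [if_neg (fun h => hlt h.1), hself]
  · simp only [Finset.sum_const, Finset.card_range, smul_eq_mul]
    omega

/-- Afterwards no edge of a biclique joins vertices of one of the first `k - 1` colors. If for all
bicliques and all these colors the right side is chosen, which has probability
`(1 / 2) ^ (l * (k - 1))`, then no vertex of `W` loses its color. -/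
theorem exec_breakBicliques {X : Inst} (hX : X.Wf Γ) {s : St} (hs : X.Holds s) {t : ℕ} {V : Prop}
    {W A : Finset ℕ} {χ pos : ℕ → ℕ} {ρ p : ℝ} (hρ : 0 ≤ ρ) (hV : V → X.Target pos W A χ)
    (hC : ∀ v < X.n, s.arr 5 v ≤ X.k * (X.d + 1))
    (h : Pay (V ∧ Good X.k W A χ (s.arr 5)) ((1 / 2) ^ (X.l * (X.k - 1))) ρ p)
    (ht : 30 * X.l * X.n + 6 ≤ t) :
    Exec Γ breakBicliques s t p fun s' p' => s'.var 20 = X.k - 1 ∧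
      (∀ v < X.n, s'.arr 5 v ≤ X.k * (X.d + 1)) ∧
      (∀ u < X.n, ∀ v < X.n, s'.arr 5 u = s'.arr 5 v → s'.arr 5 u < X.k - 1 → ¬ X.Cut u v) ∧
      Pay (V ∧ Good X.k W A χ (s'.arr 5)) 1 ρ p' := by
  have hk := hX.two_le
  have hkn := hX.k_le
  have hn := hX.n_lt
  have hl := hX.l_lt
  have hBk : X.k ≤ X.k * (X.d + 1) := Nat.le_mul_of_pos_right _ (by omega)
  refine Exec.wp_seq (t := 30 * X.l * X.n + 4) ?_ (by simp only [HCmd.cost]; omega)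
  simp only [HCmd.wp, ok_sub, ok_var, ok_lit, eval_sub, eval_var, eval_lit, hs.k]
  refine ⟨⟨trivial, by omega⟩, ?_⟩
  refine Exec.for (n := X.l) (fun _ => 7 * (X.k - 1) + 11 * X.n + 9) (fun j s' p' =>
      s'.var 20 = X.k - 1 ∧ (∀ v < X.n, s'.arr 5 v ≤ X.k * (X.d + 1)) ∧
      (∀ j' < j, ∀ u < X.n, ∀ v < X.n, s'.arr 5 u = s'.arr 5 v → s'.arr 5 u < X.k - 1 →
        X.side j' u * X.side j' v ≠ 2) ∧
      Pay (V ∧ Good X.k W A χ (s'.arr 5)) ((1 / 2) ^ ((X.l - j) * (X.k - 1))) ρ p')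
    (by simp [hs.l]) (by omega) (by decide) (by decide) ⟨by simp, hC, by simp, h⟩ ?_ ?_ ?_
  · rintro j hj s' p' hf hj' ⟨h20, hC', hcut, hpay⟩
    have hs0 : X.Holds (s.setVar 20 (X.k - 1)) := hs.frame (c := .assign 20 (.lit 0))
      ((Frame.refl _ s).setVar (by decide) _) (by decide) (by decide)
    have hs' := hs0.frame hf (by decide) (by decide)
    refine Exec.seq' (t := 7 * (X.k - 1) + 4) (t' := 11 * X.n + 4)
      (R := fun s'' p'' => (∀ i < X.k - 1, s''.arr 6 i = 1 ∨ s''.arr 6 i = 2) ∧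
        Pay (V ∧ Good X.k W A χ (s'.arr 5) ∧ ∀ i < X.k - 1, ∀ w ∈ W, χ w = i →
          X.side j w ≠ s''.arr 6 i) ((1 / 2) ^ ((X.l - (j + 1)) * (X.k - 1))) ρ p'') ?_ ?_ (by omega)
    · refine Exec.for (n := X.k - 1) (fun _ => 3) (fun i s'' p'' =>
        (∀ i' < i, s''.arr 6 i' = 1 ∨ s''.arr 6 i' = 2) ∧
        Pay (V ∧ Good X.k W A χ (s'.arr 5) ∧ ∀ i' < i, ∀ w ∈ W, χ w = i' →
          X.side j w ≠ s''.arr 6 i')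
          ((1 / 2) ^ ((X.l - (j + 1)) * (X.k - 1) + (X.k - 1 - i))) ρ p'')
        h20 (by omega) (by decide) (by decide) ⟨by simp, ?_⟩ ?_ ?_ ?_
      · have : (X.l - (j + 1)) * (X.k - 1) + (X.k - 1 - 0) = (X.l - j) * (X.k - 1) := by
          rw [show X.l - j = X.l - (j + 1) + 1 by omega, add_mul]; simp
        rw [this]
        exact hpay.mono fun h => ⟨h.1, h.2, by simp⟩
      · rintro i hi s₁ p₁ hf₁ hi' ⟨hbit, hpay₁⟩
        -- on a successful run, some bit keeps the color `i` on the side that `W` uses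
        obtain ⟨b, hb⟩ : ∃ b < 2, V → ∀ w ∈ W, χ w = i → X.side j w ≠ b + 1 := by
          by_cases hv : V
          · obtain ⟨b, hb, h⟩ := (hV hv).side j hj i hi
            exact ⟨b, hb, fun _ => h⟩
          · exact ⟨0, by omega, fun h => absurd h hv⟩
        refine Exec.seq' (t := 1) (t' := 1) (Exec.rand_pay (b := 2)
          (fun z => (V ∧ Good X.k W A χ (s'.arr 5) ∧ ∀ i' < i, ∀ w ∈ W, χ w = i' →
            X.side j w ≠ s₁.arr 6 i') ∧ z = b) {b} (by simp) (by simp)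
          (by omega) (by simp [hb.1]) hpay₁ (fun h z hz => ⟨h, by simpa using hz⟩) hρ
          (q' := (1 / 2) ^ ((X.l - (j + 1)) * (X.k - 1) + (X.k - 1 - (i + 1)))) ?_) ?_ le_rfl
        · rw [show X.k - 1 - i = X.k - 1 - (i + 1) + 1 by omega, ← add_assoc, pow_succ,
            Finset.card_singleton]
          refine le_of_eq ?_
          push_cast
          ring
        · rintro _ p₂ - ⟨z, hz, rfl, hpay₂⟩
          refine .store (by decide) (by simp) (by simp; omega) ⟨?_, hpay₂.mono ?_⟩
          · intro i' hi''
            simp only [eval_var, eval_add, eval_lit, St.setVar_arr, St.setArr_arr, St.setVar_var,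
              ↓reduceIte, Nat.reduceEqDiff, hi']
            by_cases h' : i' = i
            · simp [h']; omega
            · simpa [h'] using hbit i' (by omega)
          · rintro ⟨⟨hv, hg, hW⟩, rfl⟩
            refine ⟨hv, hg, fun i' hi'' w hw hχ => ?_⟩
            simp only [eval_var, eval_add, eval_lit, St.setVar_arr, St.setArr_arr, St.setVar_var,
              ↓reduceIte, Nat.reduceEqDiff, hi']
            by_cases h' : i' = i
            · subst h'; simpa using hb.2 hv w hw hχ
            · simpa [h'] using hW i' (by omega) w hw hχ
      · rintro s₁ p₁ ⟨hbit, hpay₁⟩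
        exact ⟨hbit, by simpa using hpay₁⟩
      · simp only [Finset.sum_const, Finset.card_range, smul_eq_mul]
        omega
    · rintro s₁ p₁ hf₁ ⟨hbit, hpay₁⟩
      have hs₁ := hs'.frame hf₁ (by decide) (by decide)
      have e20 : s₁.var 20 = X.k - 1 := by rw [hf₁.var 20 (by decide), h20]
      have a5 : s₁.arr 5 = s'.arr 5 := hf₁.arr 5 (by decide)
      refine .conseq (det_breakOne hX hs₁ hj (by rw [hf₁.var 12 (by decide), hj']) e20 le_rfl
        p₁).frame le_rfl le_rfl ?_
      rintro s₂ p₂ ⟨hf₂, rfl, hC₂⟩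
      rw [a5] at hC₂
      simp only [St.setVar_var, St.setVar_arr, Nat.reduceEqDiff, ↓reduceIte]
      have hkeep : ∀ v < X.n, s₂.arr 5 v < X.k - 1 → s₂.arr 5 v = s'.arr 5 v ∧
          s₁.arr 6 (s'.arr 5 v) ≠ X.side j v := by
        intro v hv hlt
        rw [hC₂ v hv] at hlt ⊢
        split_ifs at hlt ⊢ with hc
        · omega
        · exact ⟨rfl, fun h' => hc ⟨hlt, h'⟩⟩
      refine ⟨by rw [hf₂.var 20 (by decide), e20], fun v hv => ?_, ?_, ?_⟩
      · rw [hC₂ v hv]; split_ifs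
        · exact le_rfl
        · exact hC' v hv
      · intro j' hj'' u hu v hv huv hlt
        obtain ⟨hu1, hu2⟩ := hkeep u hu hlt
        obtain ⟨hv1, hv2⟩ := hkeep v hv (huv ▸ hlt)
        rcases Nat.lt_succ_iff_lt_or_eq.1 hj'' with hlt' | rfl
        · exact hcut j' hlt' u hu v hv (by rw [← hu1, ← hv1, huv]) (by rwa [← hu1])
        · have hcc : s'.arr 5 u = s'.arr 5 v := by rw [← hu1, ← hv1, huv]
          rw [hcc] at hu2
          have hb := hbit (s'.arr 5 v) (by rw [← hv1, ← huv]; exact hlt)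
          have h1 := hX.side_le j' u
          have h2 := hX.side_le j' v
          intro h3
          generalize X.side j' u = a at *
          generalize X.side j' v = b at *
          interval_cases a <;> interval_cases b <;> omega
      · refine hpay₁.mono ?_
        rintro ⟨hv, hg, hW⟩
        have hT := hV hv
        refine ⟨hv, fun w hw => ?_, fun x hx => ?_⟩
        · rw [hC₂ w (hT.lt w hw), if_neg, hg.1 w hw]
          rintro ⟨h1, h2⟩
          rw [hg.1 w hw] at h1 h2
          exact hW _ h1 w hw rfl h2.symm
        · rw [hC₂ x (hT.lt' x hx)]
          have := hg.2 x hx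
          split_ifs <;> omega
  · rintro s' p' ⟨h20, hC', hcut, hpay⟩
    refine ⟨h20, hC', ?_, by simpa using hpay⟩
    rintro u hu v hv huv hlt ⟨j, hj, h2⟩
    exact hcut j hj u hu v hv huv hlt h2
  · simp only [Finset.sum_const, Finset.card_range, smul_eq_mul]
    have : X.l * (7 * (X.k - 1) + 11 * X.n + 9 + 4) ≤ X.l * (30 * X.n) :=
      Nat.mul_le_mul_left _ (by omega)
    linarith

theorem indicator_ne_zero {p : Prop} [Decidable p] : (if p then 1 else 0 : ℕ) ≠ 0 ↔ p := by
  split_ifs with h <;> simp [h]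

/-- Negation of a truth value. -/
theorem det_not {h f : ℕ} {P : Prop} {s : St} (hP : s.var h ≠ 0 ↔ P) :
    Det Γ (.assign f ((HExpr.var h).eq (.lit 0))) s 1 fun s' => s'.var f ≠ 0 ↔ ¬ P := by
  refine Det.of_wp ?_ le_rfl
  by_cases h0 : s.var h = 0
  · simp [HCmd.wp, h0, ← hP]
  · simp [HCmd.wp, h0, ← hP]

/-- Of two adjacent vertices of the same color `< k - 1` at least one loses its color, so that the
coloring becomes proper in these colors; a vertex `v` only loses its color because of a neighbor
that is not before `v` in the order and has the same color initially. -/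
theorem det_resolve {X : Inst} (hX : X.Wf Γ) {s : St} (hs : X.Holds s) {t : ℕ}
    (h20 : s.var 20 = X.k - 1) (ht : 36 * X.size + 4 ≤ t) :
    Det Γ resolve s t fun s' => X.Proper (s'.arr 5) ∧ ∀ v < X.n, s'.arr 5 v = s.arr 5 v ∨
      (s'.arr 5 v = X.k * (X.d + 1) ∧ ∃ u ∈ X.nbr v, s.arr 5 u = s.arr 5 v ∧
        s.arr 5 v < X.k - 1 ∧ s.arr 3 v ≤ s.arr 3 u) := by
  have hn := hX.n_lt
  have hk := hX.two_le
  have hBk : X.k ≤ X.k * (X.d + 1) := Nat.le_mul_of_pos_right _ (by omega)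
  -- the third part of the invariant: if a treated vertex has kept its color, then all its neighbors
  -- of the same color come before it
  refine Det.for (n := X.n) (fun v => 13 * (X.nbr v).length + 20) (fun j s' =>
    (∀ v ≥ j, s'.arr 5 v = s.arr 5 v) ∧
    (∀ v < X.n, s'.arr 5 v = s.arr 5 v ∨
      (s'.arr 5 v = X.k * (X.d + 1) ∧ ∃ u ∈ X.nbr v, s.arr 5 u = s.arr 5 v ∧
        s.arr 5 v < X.k - 1 ∧ s.arr 3 v ≤ s.arr 3 u)) ∧
    ∀ v < j, ∀ u ∈ X.nbr v, s'.arr 5 u = s'.arr 5 v → s'.arr 5 v < X.k - 1 →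
      s.arr 3 u < s.arr 3 v) hs.n (by omega) (by decide) (by decide)
    ⟨by simp, fun v _ => by simp, by simp⟩ ?_ ?_ ?_
  · rintro j hj s' hf hj' ⟨h1, h2, h3⟩
    have hs' := hs.frame hf (by decide) (by decide)
    have e20 : s'.var 20 = X.k - 1 := by rw [hf.var 20 (by decide), h20]
    have a3 : s'.arr 3 = s.arr 3 := hf.arr 3 (by decide)
    refine Det.wp_seq (t := 13 * (X.nbr j).length + 18) ?_ (by simp only [HCmd.cost]; omega)
    simp only [HCmd.wp, ok_arr, ok_var, eval_arr, eval_var, hj', h1 j le_rfl]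
    refine ⟨⟨by omega, trivial⟩, ?_⟩
    have hs1 : X.Holds (s'.setVar 22 (s.arr 5 j)) := hs'.frame (c := .assign 22 (.lit 0))
      ((Frame.refl _ s').setVar (by decide) _) (by decide) (by decide)
    refine Det.cond (t := 13 * (X.nbr j).length + 17) (by simp) (fun hlt => ?_) (fun hlt => ?_) le_rfl
    · have hlt : s.arr 5 j < X.k - 1 := by
        have : (if s.arr 5 j < X.k - 1 then 1 else 0) ≠ 0 := by simpa [e20] using hlt
        exact indicator_ne_zero.1 this
      refine Det.seq (t' := 3) (det_nbrExists hX.toGraph 1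
        (fun u => s'.arr 5 u = s.arr 5 j ∧ s.arr 3 j ≤ s.arr 3 u) hs1.hd (v₀ := j)
        (by simp [hj']) hj (by decide) (by decide) (by decide) (by decide) (by decide) ?_
        le_rfl) ?_ (by linarith)
      · intro u hu s₁ hf₁ hu₁
        have b5 : s₁.arr 5 = s'.arr 5 := hf₁.arr 5 (by decide)
        have b3 : s₁.arr 3 = s.arr 3 := by rw [hf₁.arr 3 (by decide)]; exact a3
        have b15 : s₁.var 15 = j := by rw [hf₁.var 15 (by decide)]; simp [hj']
        have b22 : s₁.var 22 = s.arr 5 j := by rw [hf₁.var 22 (by decide)]; simp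
        refine Det.of_wp ?_ le_rfl
        simp only [HCmd.wp, ok_mul, ok_sub, ok_eq, ok_lt, ok_arr, ok_var, ok_lit, eval_mul, eval_sub,
          eval_eq, eval_lt, eval_arr, eval_var, eval_lit, hu₁, b5, b3, b15, b22, St.setVar_var,
          ↓reduceIte]
        refine ⟨⟨⟨⟨by omega, trivial⟩, trivial⟩, ⟨by omega, ⟨by omega, trivial⟩, by omega, trivial⟩, ?_⟩, ?_⟩
        · split_ifs <;> omega
        · by_cases hc : s'.arr 5 u = s.arr 5 j <;> by_cases hp : s.arr 3 u < s.arr 3 j <;>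
            simp [hc, hp]
          · omega
      · intro s₁ hf₁ hex
        have b5 : s₁.arr 5 = s'.arr 5 := hf₁.arr 5 (by decide)
        have b15 : s₁.var 15 = j := by rw [hf₁.var 15 (by decide)]; simp [hj']
        have bB := (hs1.frame hf₁ (by decide) (by decide)).B
        refine Det.of_wp ?_ (by simp [HCmd.cost])
        simp only [HCmd.wp, ok_var, eval_var, bB, b15, St.setArr_arr_eq, ↓reduceIte, St.setVar_arr,
          b5, true_and]
        refine ⟨fun hne => ⟨by clear hex; omega, fun v hv => ?_, fun v hv => ?_, fun v hv u hu huv hlt' => ?_⟩,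
          fun heq => ⟨fun v hv => h1 v (by omega), h2, fun v hv u hu huv hlt' => ?_⟩⟩
        · rw [Function.update_of_ne (by clear hex; omega), h1 v (by clear hex; omega)]
        · by_cases hvj : v = j
          · subst hvj
            right
            obtain ⟨u, hu, huc, hup⟩ := hex.1 hne
            refine ⟨by simp, u, hu, ?_, hlt, hup⟩
            rcases h2 u (hX.lt v hv u hu) with h' | h'
            · rw [← h', huc]
            · have h'' := h'.1
              clear h' hex h2
              omega
          · rw [Function.update_of_ne hvj]; exact h2 v hv
        · have hvj : v ≠ j := by
            rintro rfl
            rw [Function.update_self] at hlt'; omega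
          rw [Function.update_of_ne hvj] at huv hlt'
          by_cases huj : u = j
          · subst huj; rw [Function.update_self] at huv; omega
          · rw [Function.update_of_ne huj] at huv
            exact h3 v (by omega) u hu huv hlt'
        · by_cases hvj : v = j
          · subst hvj
            by_contra hcon
            exact hex.2 ⟨u, hu, by rw [huv, h1 v le_rfl], not_lt.1 hcon⟩ heq
          · exact h3 v (by omega) u hu huv hlt'
    · have hlt : ¬ s.arr 5 j < X.k - 1 := fun h' => by simp [e20, h'] at hlt
      refine Det.skip ⟨fun v hv => ?_, fun v hv => ?_, fun v hv u hu huv hlt' => ?_⟩ (by omega)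
      · exact h1 v (by omega)
      · exact h2 v hv
      · simp only [St.setVar_arr] at huv hlt'
        by_cases hvj : v = j
        · subst hvj; rw [h1 v le_rfl] at hlt'; omega
        · exact h3 v (by omega) u hu huv hlt'
  · rintro s' ⟨-, h2, h3⟩
    refine ⟨fun v hv u hu huv => ?_, h2⟩
    by_contra hlt
    have hun := hX.lt v hv u hu
    have := h3 v hv u hu huv (by omega)
    have := h3 u hun v (hX.symm v hv u hu) huv.symm (by omega)
    omega
  · refine le_trans ?_ ht
    rw [Inst.size, Finset.mul_sum, add_le_add_iff_right]
    exact Finset.sum_le_sum fun v _ => by omega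

theorem Inst.n_le_size (X : Inst) : X.n ≤ X.size := by
  calc X.n = ∑ v ∈ Finset.range X.n, 1 := by simp
    _ ≤ X.size := Finset.sum_le_sum fun v _ => by omega

/-- The conditions "for all" are checked by counting counterexamples. -/
theorem det_check {X : Inst} (hX : X.Wf Γ) {s : St} (hs : X.Holds s) {t : ℕ}
    (ht : 100 * X.k ^ 2 * X.size + 30 * X.k + 20 ≤ t) :
    Det Γ check s t fun s' => (X.Full (s.arr 5) ∧ s'.var 0 = 1) ∨
      (¬ X.Full (s.arr 5) ∧ s'.var 0 = s.var 0) := by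
  have hn := hX.n_lt
  have hkn := hX.k_le
  have hk := hX.two_le
  have hpow : ∀ v, X.k * (13 * (X.nbr v).length + 25) + 38 ≤
      100 * X.k * ((X.nbr v).length + 1) := by intro v; nlinarith
  refine Det.seq (t := 100 * X.k ^ 2 * X.size + 30 * X.k + 10) (t' := 3)
    (Det.exists (m := X.k) (fun _ => 100 * X.k * X.size + 12)
      (fun i => ¬ ∃ v < X.n, s.arr 5 v = i ∧ ¬ ∃ j < i, ¬ ∃ u ∈ X.nbr v, s.arr 5 u = j)
      hs.k (by omega) (by decide) (by decide) (by decide) (by decide) ?_ ?_) ?_ (by omega)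
  · intro i hi s₁ hf₁ hi₁
    have hs₁ := hs.frame hf₁ (by decide) (by decide)
    have a5 : s₁.arr 5 = s.arr 5 := hf₁.arr 5 (by decide)
    refine Det.seq (t' := 1) (Det.exists (m := X.n)
      (fun v => X.k * (13 * (X.nbr v).length + 25) + 28)
      (fun v => s.arr 5 v = i ∧ ¬ ∃ j < i, ¬ ∃ u ∈ X.nbr v, s.arr 5 u = j)
      hs₁.n (by omega) (by decide) (by decide) (by decide) (by decide) ?_
      (t := 100 * X.k * X.size + 10) ?_) ?_ (by omega)
    · intro v hv s₂ hf₂ hv₂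
      have hs₂ := hs₁.frame hf₂ (by decide) (by decide)
      have b5 : s₂.arr 5 = s.arr 5 := by rw [hf₂.arr 5 (by decide), a5]
      have b24 : s₂.var 24 = i := by rw [hf₂.var 24 (by decide), hi₁]
      refine Det.wp_seq (t := X.k * (13 * (X.nbr v).length + 25) + 26) ?_
        (by simp only [HCmd.cost]; omega)
      simp only [HCmd.wp, ok_lit, eval_lit, Nat.ofNat_pos, true_and]
      refine Det.cond (t := X.k * (13 * (X.nbr v).length + 25) + 25) (by simp) (fun h' => ?_)
        (fun h' => ?_) le_rfl
      · have hvi : s.arr 5 v = i := by simpa [hv₂, b5, b24] using h'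
        refine Det.seq (t := X.k * (13 * (X.nbr v).length + 25) + 10) (t' := 1)
          (Det.exists (m := i) (fun _ => 13 * (X.nbr v).length + 14)
          (fun j => ¬ ∃ u ∈ X.nbr v, s.arr 5 u = j) (by simp [b24]) (by omega) (by decide)
          (by decide) (by decide) (by decide) ?_ ?_) ?_ (by omega)
        · intro j hj s₃ hf₃ hj₃
          have hf₃' : Frame check s₂ s₃ := ((Frame.refl _ s₂).setVar (by decide) 0).trans
            (hf₃.weaken (by decide) (by decide))
          have hs₃ : ∀ v < X.n, s₃.arr 0 v = X.hd v := by
            rw [hf₃'.arr 0 (by decide)]; exact hs₂.hd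
          have c5 : s₃.arr 5 = s.arr 5 := by rw [hf₃'.arr 5 (by decide), b5]
          refine Det.seq (t' := 1) (det_nbrExists hX.toGraph 1 (fun u => s.arr 5 u = j)
            hs₃ (v₀ := v) (by rw [hf₃.var 15 (by decide)]; simp [hv₂]) hv (by decide)
            (by decide) (by decide) (by decide) (by decide) ?_ le_rfl) ?_ (by omega)
          · intro u hu s₄ hf₄ hu₄
            have d5 : s₄.arr 5 = s.arr 5 := by rw [hf₄.arr 5 (by decide), c5]
            have d28 : s₄.var 28 = j := by rw [hf₄.var 28 (by decide), hj₃]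
            refine Det.of_wp ?_ le_rfl
            simp [HCmd.wp, hu₄, d5, d28]
          · intro s₄ _ hex
            exact det_not hex
        · simp only [Finset.sum_const, Finset.card_range, smul_eq_mul]
          have : i * (13 * (X.nbr v).length + 14 + 10) ≤
              X.k * (13 * (X.nbr v).length + 25) := Nat.mul_le_mul hi.le (by omega)
          omega
        · intro s₃ _ hex
          exact (det_not hex).conseq le_rfl fun s₄ _ h => by rw [h, and_iff_right hvi]
      · have hvi : s.arr 5 v ≠ i := by simpa [hv₂, b5, b24] using h'
        exact Det.skip (by simp [hvi]) (by omega)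
    · rw [Inst.size, Finset.mul_sum, add_le_add_iff_right]
      exact Finset.sum_le_sum fun v _ => by have := hpow v; omega
    · intro s₂ _ hex
      exact det_not hex
  · simp only [Finset.sum_const, Finset.card_range, smul_eq_mul]
    nlinarith
  · intro s₁ hf₁ hex
    have h0 : s₁.var 0 = s.var 0 := hf₁.var 0 (by decide)
    have hfull : s₁.var 23 = 0 ↔ X.Full (s.arr 5) := by
      rw [← not_iff_not, ← ne_eq, hex]
      simp [Inst.Full]
    refine Det.of_wp ?_ le_rfl
    simp only [HCmd.wp, ok_var, ok_lit, eval_var, eval_lit, true_and, St.setVar_var, ↓reduceIte]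
    refine ⟨fun h => .inr ⟨fun h' => h (hfull.2 h'), h0⟩, fun h => ⟨by omega, .inl ⟨hfull.1 h, trivial⟩⟩⟩

/-- If all draws went well, the search finds the target. -/
theorem Inst.Target.full_of_good {X : Inst} (hX : X.Wf Γ) {pos : ℕ → ℕ} {W A : Finset ℕ}
    {χ C C' : ℕ → ℕ} (hT : X.Target pos W A χ) (hg : Good X.k W A χ C)
    (hcut : ∀ u < X.n, ∀ v < X.n, C u = C v → C u < X.k - 1 → ¬ X.Cut u v)
    (hC' : ∀ v < X.n, C' v = C v ∨ (C' v = X.k * (X.d + 1) ∧ ∃ u ∈ X.nbr v, C u = C v ∧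
        C v < X.k - 1 ∧ pos v ≤ pos u)) : X.Full C' := by
  have hW : ∀ w ∈ W, C' w = χ w := by
    intro w hw
    have hwn := hT.lt w hw
    rcases hC' w hwn with h | ⟨-, u, hu, huc, hlt, hpos⟩
    · rw [h, hg.1 w hw]
    · have hun := hX.lt w hwn u hu
      have hk : u ∈ X.keep w :=
        Inst.mem_keep.2 ⟨hu, hcut w hwn u hun huc.symm hlt⟩
      rcases hT.behind w hw u hk hpos with huW | huA
      · refine absurd ?_ (hT.proper w hw u huW hu)
        rw [← hg.1 u huW, ← hg.1 w hw, huc]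
      · have := hg.2 u huA
        omega
  intro i hi
  obtain ⟨v, hv, hvi, h⟩ := hT.full i hi
  refine ⟨v, hT.lt v hv, by rw [hW v hv, hvi], fun j hj => ?_⟩
  obtain ⟨u, hu, huv, huj⟩ := h j hj
  exact ⟨u, huv, by rw [hW u hu, huj]⟩

/-- The draws for the vertex `v` that lead to the target. -/
def Inst.choices (X : Inst) (W A : Finset ℕ) (χ : ℕ → ℕ) (v : ℕ) : Finset ℕ :=
  (Finset.range (X.k * (X.d + 1))).filter fun c => (v ∈ W → c = χ v) ∧ (v ∈ A → X.k ≤ c)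

/-- The probability that all draws of one round lead to the target. -/
noncomputable def Inst.chance (X : Inst) (W A : Finset ℕ) (χ : ℕ → ℕ) : ℝ :=
  (∏ v ∈ Finset.range X.n, ((X.choices W A χ v).card / (X.k * (X.d + 1) : ℕ) : ℝ)) *
    (1 / 2) ^ (X.l * (X.k - 1))

/-- The time for one round. -/
def Inst.trialTime (X : Inst) : ℕ :=
  7 * X.n + 30 * X.l * X.n + 36 * X.size + 100 * X.k ^ 2 * X.size + 30 * X.k + 40

/-- One round either finds a coloring, or it leaves the answer as it is, and then not all draws
led to the target. -/
theorem exec_trial {X : Inst} (hX : X.Wf Γ) {s : St} (hs : X.Holds s) {V : Prop}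
    {W A : Finset ℕ} {χ : ℕ → ℕ} {q ρ p : ℝ} (hρ : 0 ≤ ρ) (hV : V → X.Target (s.arr 3) W A χ)
    (hq : V → q ≤ X.chance W A χ) (h : Pay V q ρ p) :
    Exec Γ trial s X.trialTime p fun s' p' =>
      ((∃ C, X.Proper C ∧ X.Full C) ∧ s'.var 0 = 1 ∧ 0 ≤ p') ∨ (s'.var 0 = s.var 0 ∧ p' = ρ) := by
  obtain ⟨p₀, hp₀, hpay⟩ : ∃ p₀ ≤ p, Pay V (X.chance W A χ) ρ p₀ := by
    rcases h with ⟨hv, rfl⟩ | rfl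
    · exact ⟨_, mul_le_mul_of_nonneg_right (by linarith [hq hv]) hρ, .inl ⟨hv, rfl⟩⟩
    · exact ⟨_, le_rfl, .inr rfl⟩
  refine .conseq ?_ le_rfl hp₀ fun _ _ h => h
  refine Exec.seq' (t := 7 * X.n + 4)
    (t' := 30 * X.l * X.n + 36 * X.size + 100 * X.k ^ 2 * X.size + 30 * X.k + 34)
    (exec_draw hX hs (X.choices W A χ) (fun v => Finset.filter_subset _ _) hρ hpay le_rfl) ?_
    (by simp only [Inst.trialTime]; omega)
  rintro s₁ p₁ hf₁ ⟨hC₁, hpay₁⟩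
  have hs₁ := hs.frame hf₁ (by decide) (by decide)
  refine Exec.seq' (t := 30 * X.l * X.n + 6)
    (t' := 36 * X.size + 100 * X.k ^ 2 * X.size + 30 * X.k + 27)
    (exec_breakBicliques hX hs₁ (V := V) (W := W) (A := A) (χ := χ) (pos := s.arr 3) hρ hV hC₁
      (hpay₁.mono ?_) le_rfl) ?_ (by omega)
  · rintro ⟨hv, hS⟩
    have hT := hV hv
    refine ⟨hv, fun w hw => ?_, fun x hx => ?_⟩
    · exact (Finset.mem_filter.1 (hS w (hT.lt w hw))).2.1 hw
    · exact (Finset.mem_filter.1 (hS x (hT.lt' x hx))).2.2 hx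
  rintro s₂ p₂ hf₂ ⟨h20, hC₂, hcut, hpay₂⟩
  have hs₂ := hs₁.frame hf₂ (by decide) (by decide)
  have a3 : s₂.arr 3 = s.arr 3 := by rw [hf₂.arr 3 (by decide), hf₁.arr 3 (by decide)]
  refine Exec.seq' (t := 36 * X.size + 4) (t' := 100 * X.k ^ 2 * X.size + 30 * X.k + 20)
    (det_resolve hX hs₂ h20 le_rfl p₂) ?_ (by omega)
  rintro s₃ p₃ hf₃ ⟨rfl, hprop, hC₃⟩
  have hs₃ := hs₂.frame hf₃ (by decide) (by decide)
  refine .conseq (det_check hX hs₃ le_rfl p₃) le_rfl le_rfl ?_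
  rintro s₄ p₄ ⟨rfl, ⟨hfull, h0⟩ | ⟨hfull, h0⟩⟩
  · refine .inl ⟨⟨_, hprop, hfull⟩, h0, ?_⟩
    rcases hpay₂ with ⟨-, rfl⟩ | rfl
    · simp
    · exact hρ
  · refine .inr ⟨?_, ?_⟩
    · rw [h0, hf₃.var 0 (by decide), hf₂.var 0 (by decide), hf₁.var 0 (by decide)]
    · rcases hpay₂ with ⟨⟨hv, hg⟩, -⟩ | h
      · refine absurd ((hV hv).full_of_good hX hg hcut ?_) hfull
        simpa only [a3] using hC₃
      · exact h

/-! ### Repetition -/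

/-- Adds `1` to the number whose digits are in array `7`. Variable `34` holds the carry. The last
`l (k - 1)` digits are binary, the others have base `B`. -/
def advance : HCmd :=
  .assign 34 (.lit 1) ;; .for 35 32 (.cond (.var 34)
    (.cond ((HExpr.var 35).lt (.var 31)) (.assign 37 (.var 5)) (.assign 37 (.lit 2)) ;;
      .assign 36 (.arr 7 (.var 35) + .lit 1) ;;
      .cond ((HExpr.var 36).lt (.var 37))
        (.store 7 (.var 35) (.var 36) ;; .assign 34 (.lit 0)) (.store 7 (.var 35) (.lit 0))) .skip)

/-- Performs `B ^ (k (k + 1)) * 2 ^ (l (k - 1))` rounds. The number of rounds may not fit into a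
word, so they are counted with an odometer. -/
def rounds : HCmd :=
  .assign 31 (.var 2 * (.var 2 + .lit 1)) ;;
  .assign 32 (.var 31 + .var 4 * (.var 2 - .lit 1)) ;;
  .for 35 32 (.store 7 (.var 35) (.lit 0)) ;;
  .assign 33 (.lit 1) ;;
  .loop (.var 33) (trial ;; advance ;; .assign 33 (.lit 1 - .var 34))

/-- The base of the digit `x` of the odometer. -/
def Inst.base (X : Inst) (x : ℕ) : ℕ := if x < X.k * (X.k + 1) then X.k * (X.d + 1) else 2

/-- The place value of the digit `m` of the odometer. -/
def Inst.place (X : Inst) (m : ℕ) : ℕ := ∏ x ∈ Finset.range m, X.base x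

/-- The number given by the first `m` digits of the odometer. -/
def Inst.value (X : Inst) (a : ℕ → ℕ) (m : ℕ) : ℕ := ∑ x ∈ Finset.range m, a x * X.place x

/-- The number of digits of the odometer. -/
def Inst.digits (X : Inst) : ℕ := X.k * (X.k + 1) + X.l * (X.k - 1)

theorem Inst.base_pos {X : Inst} (hX : X.Wf Γ) (x : ℕ) : 0 < X.base x := by
  have := hX.two_le
  rw [Inst.base]; split_ifs
  · positivity
  · omega

theorem Inst.place_digits (X : Inst) :
    X.place X.digits = (X.k * (X.d + 1)) ^ (X.k * (X.k + 1)) * 2 ^ (X.l * (X.k - 1)) := by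
  rw [Inst.place, Inst.digits, Finset.prod_range_add]
  congr 1
  · rw [Finset.prod_congr rfl (g := fun _ => X.k * (X.d + 1))]
    · simp
    · intro x hx; rw [Inst.base, if_pos (Finset.mem_range.1 hx)]
  · rw [Finset.prod_congr rfl (g := fun _ => 2)]
    · simp
    · intro x _; rw [Inst.base, if_neg (by omega)]

theorem Inst.value_lt {X : Inst} {a : ℕ → ℕ} {m : ℕ}
    (ha : ∀ x < m, a x < X.base x) : X.value a m < X.place m := by
  induction m with
  | zero => simp [Inst.value, Inst.place]
  | succ m ih =>
    have h1 := ih fun x hx => ha x (by omega)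
    have h2 := ha m (by omega)
    have hv : X.value a (m + 1) = X.value a m + a m * X.place m := Finset.sum_range_succ _ _
    have hp : X.place (m + 1) = X.place m * X.base m := Finset.prod_range_succ _ _
    rw [hv, hp]
    calc _ < X.place m + a m * X.place m := by omega
      _ = (a m + 1) * X.place m := by ring
      _ ≤ X.place m * X.base m := by rw [mul_comm]; exact Nat.mul_le_mul_left _ h2

/-- An increment of the odometer; the carry is `1` exactly if it overflows. -/
theorem det_advance {X : Inst} (hX : X.Wf Γ) {s : St} (hs : X.Holds s)
    (h31 : s.var 31 = X.k * (X.k + 1)) (h32 : s.var 32 = X.digits)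
    (ha : ∀ x < X.digits, s.arr 7 x < X.base x) :
    Det Γ advance s (20 * X.digits + 6) fun s' => s'.var 34 ≤ 1 ∧
      (∀ x < X.digits, s'.arr 7 x < X.base x) ∧
      X.value (s'.arr 7) X.digits + s'.var 34 * X.place X.digits =
        X.value (s.arr 7) X.digits + 1 := by
  have hB := hX.B_lt
  have hE := hX.E_lt
  have hE' : X.digits < Γ.I := by
    have : X.l * (X.k - 1) ≤ X.l * X.k := Nat.mul_le_mul_left _ (by omega)
    rw [Inst.digits]; omega
  have hbI : ∀ x, X.base x + 1 < Γ.I := by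
    intro x; rw [Inst.base]; split_ifs <;> omega
  refine Det.wp_seq (t := 20 * X.digits + 4) ?_ (by simp only [HCmd.cost]; omega)
  simp only [HCmd.wp, ok_lit, eval_lit, Nat.one_lt_ofNat, true_and]
  refine Det.for (n := X.digits) (fun _ => 16) (fun m s' => s'.var 34 ≤ 1 ∧
    (∀ x < X.digits, s'.arr 7 x < X.base x) ∧ (∀ x ≥ m, s'.arr 7 x = s.arr 7 x) ∧
    X.value (s'.arr 7) m + s'.var 34 * X.place m = X.value (s.arr 7) m + 1)
    (by simpa using h32) hE' (by decide) (by decide) ?_ ?_ ?_ ?_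
  · simpa [Inst.value, Inst.place] using ha
  · rintro m hm s' hf hm' ⟨hc, hd, heq, hval⟩
    have e31 : s'.var 31 = X.k * (X.k + 1) := by rw [hf.var 31 (by decide)]; simpa using h31
    have e5 : s'.var 5 = X.k * (X.d + 1) := by rw [hf.var 5 (by decide)]; simpa using hs.B
    have hbm := hbI m
    have ham : s'.arr 7 m < X.base m := hd m hm
    have hv : ∀ a : ℕ → ℕ, X.value a (m + 1) = X.value a m + a m * X.place m :=
      fun a => Finset.sum_range_succ _ _
    have hp : X.place (m + 1) = X.place m * X.base m := Finset.prod_range_succ _ _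
    have hupd : ∀ (a : ℕ → ℕ) z, X.value (Function.update a m z) m = X.value a m := by
      intro a z
      refine Finset.sum_congr rfl fun x hx => ?_
      rw [Function.update_of_ne (by simp at hx; omega)]
    have hkey : ∀ (z c : ℕ), s'.var 34 = 1 → c ≤ 1 → z < X.base m →
        z + c * X.base m = s'.arr 7 m + 1 → ∀ b : ℕ → ℕ,
        b = Function.update (s'.arr 7) m z → c ≤ 1 ∧
          (∀ x < X.digits, b x < X.base x) ∧ (∀ x ≥ m + 1, b x = s.arr 7 x) ∧
          X.value b (m + 1) + c * X.place (m + 1) = X.value (s.arr 7) (m + 1) + 1 := by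
      rintro z c h1 hc1 hz hzc _ rfl
      refine ⟨hc1, fun x hx => ?_, fun x hx => ?_, ?_⟩
      · by_cases hxm : x = m
        · subst hxm; simpa using hz
        · rw [Function.update_of_ne hxm]; exact hd x hx
      · rw [Function.update_of_ne (by omega)]; exact heq x (by omega)
      · rw [hv, hv, hp, hupd, Function.update_self, ← heq m le_rfl]
        rw [h1] at hval
        linear_combination hval + X.place m * hzc
    have hbase : (if m < X.k * (X.k + 1) then X.k * (X.d + 1) else 2) = X.base m := rfl
    refine Det.cond (t := 15) (by simp) (fun h34 => ?_) (fun h34 => ?_) le_rfl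
    · have h34 : s'.var 34 = 1 := by simp at h34; omega
      refine Det.seq (t := 3) (t' := 10) (R := fun s'' => s''.var 37 = X.base m) ?_ ?_ (by omega)
      · refine Det.of_wp ?_ le_rfl
        by_cases h : m < X.k * (X.k + 1) <;> simp [HCmd.wp, hm', e31, e5, Inst.base, h]
      · intro s'' hf'' h37
        have b7 : s''.arr 7 = s'.arr 7 := hf''.arr 7 (by decide)
        have b35 : s''.var 35 = m := by rw [hf''.var 35 (by decide), hm']
        have b34 : s''.var 34 = 1 := by rw [hf''.var 34 (by decide), h34]
        refine Det.of_wp ?_ (by decide)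
        simp only [HCmd.wp, ok_add, ok_arr, ok_var, ok_lit, eval_add, eval_arr, eval_var, eval_lit,
          b35, b7, ok_lt, eval_lt, St.setVar_var, ↓reduceIte, Nat.reduceEqDiff, h37]
        refine ⟨⟨⟨by omega, trivial⟩, by omega, by omega⟩, ⟨trivial, trivial⟩, fun hlt => ?_,
          fun hge => ?_⟩
        · have hlt := indicator_ne_zero.1 hlt
          refine ⟨by omega, trivial, trivial, by omega, ?_⟩
          refine hkey (s'.arr 7 m + 1) 0 h34 (by omega) hlt (by omega) _ ?_
          simp [St.setArr_arr_eq, b7]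
        · have hge : ¬ s'.arr 7 m + 1 < X.base m := fun h => indicator_ne_zero.2 h hge
          refine ⟨by omega, trivial, by omega, ?_⟩
          have e34 : ((s''.setVar 36 (s'.arr 7 m + 1)).setArr 7 m 0).var 34 = 1 := by simpa using b34
          rw [e34]
          refine hkey 0 1 h34 le_rfl (by omega) (by omega) _ ?_
          simp [St.setArr_arr_eq, b7]
    · have h34 : s'.var 34 = 0 := by simpa using h34
      refine Det.skip ⟨by simp [h34], hd, fun x hx => heq x (by omega), ?_⟩ (by omega)
      simp only [St.setVar_arr, St.setVar_var, Nat.reduceEqDiff, ↓reduceIte]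
      rw [hv, hv, heq m le_rfl, h34]
      rw [h34] at hval
      omega
  · rintro s' ⟨hc, hd, -, hval⟩
    exact ⟨hc, hd, hval⟩
  · simp only [Finset.sum_const, Finset.card_range, smul_eq_mul]
    omega

/-- The time for `m` rounds. -/
def Inst.loopTime (X : Inst) (m : ℕ) : ℕ := m * (X.trialTime + 20 * X.digits + 11) + 1

/-- All rounds fail with probability at most `(1 - q) ^ m` for `m` rounds. The number `m` can be far
beyond the word length and only occurs as the number of states of the odometer. -/
theorem exec_rounds {X : Inst} (hX : X.Wf Γ) {s : St} (hs : X.Holds s) (h0 : s.var 0 = 0)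
    {W A : Finset ℕ} {χ : ℕ → ℕ} {q : ℝ} (hq1 : q ≤ 1)
    (hT : q ≠ 0 → X.Target (s.arr 3) W A χ) (hq : q ≠ 0 → q ≤ X.chance W A χ) :
    Exec Γ rounds s (X.loopTime (X.place X.digits) + 5 * X.digits + 11)
      ((1 - q) ^ X.place X.digits) fun s' p' =>
      ((∃ C, X.Proper C ∧ X.Full C) ∧ s'.var 0 = 1 ∧ 0 ≤ p') ∨ (s'.var 0 = 0 ∧ p' = 1) := by
  have hE := hX.E_lt
  have hkI : X.k * (X.k + 1) < Γ.I := by omega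
  have hE' : X.digits < Γ.I := by
    have : X.l * (X.k - 1) ≤ X.l * X.k := Nat.mul_le_mul_left _ (by omega)
    rw [Inst.digits]; omega
  -- the loop, when `r` rounds are left
  have key : ∀ r (s' : St) p', Frame rounds s s' → s'.arr 3 = s.arr 3 →
      s'.var 31 = X.k * (X.k + 1) → s'.var 32 = X.digits →
      (∀ x < X.digits, s'.arr 7 x < X.base x) →
      (r ≠ 0 → X.value (s'.arr 7) X.digits + r = X.place X.digits) →
      s'.var 33 = (if r = 0 then 0 else 1) →
      (((∃ C, X.Proper C ∧ X.Full C) ∧ s'.var 0 = 1 ∧ 0 ≤ p') ∨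
        (s'.var 0 = 0 ∧ p' = (1 - q) ^ r)) →
      Exec Γ (.loop (.var 33) (trial ;; advance ;; .assign 33 (.lit 1 - .var 34))) s'
        (X.loopTime r) p' fun s' p' =>
      ((∃ C, X.Proper C ∧ X.Full C) ∧ s'.var 0 = 1 ∧ 0 ≤ p') ∨ (s'.var 0 = 0 ∧ p' = 1) := by
    intro r
    induction r with
    | zero =>
      intro s' p' hf h3 h31 h32 hd hval h33 hpay
      refine .conseq (.loop_done (by simp) (by simpa using h33) ?_) (by simp [Inst.loopTime]) le_rfl
        fun _ _ h => h
      simpa using hpay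
    | succ r ih =>
      intro s' p' hf h3 h31 h32 hd hval h33 hpay
      have hval := hval (by omega)
      have hs' := hs.frame hf (by decide) (by decide)
      have hp1 : 0 ≤ (1 - q) ^ r := pow_nonneg (by linarith) r
      obtain ⟨ρ, hρ, hpay', hρ'⟩ : ∃ ρ, 0 ≤ ρ ∧ Pay (q ≠ 0) q ρ p' ∧
          (((∃ C, X.Proper C ∧ X.Full C) ∧ s'.var 0 = 1) ∨
            (s'.var 0 = 0 ∧ ρ = (1 - q) ^ r)) := by
        rcases hpay with ⟨hC, h1, hp⟩ | ⟨h1, rfl⟩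
        · exact ⟨p', hp, .inr rfl, .inl ⟨hC, h1⟩⟩
        · refine ⟨_, hp1, ?_, .inr ⟨h1, rfl⟩⟩
          by_cases h : q = 0
          · right; simp [h]
          · left; exact ⟨h, by ring⟩
      have htime : X.trialTime + (20 * X.digits + 6 + 1 + 1) + 1 + X.loopTime r + 1 ≤
          X.loopTime (r + 1) := by
        simp only [Inst.loopTime, add_mul]; omega
      refine .conseq (.loop_step (t := X.trialTime + (20 * X.digits + 6 + 1 + 1) + 1)
        (t' := X.loopTime r) (fun s'' p'' => Frame rounds s s'' ∧ s''.arr 3 = s.arr 3 ∧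
          s''.var 31 = X.k * (X.k + 1) ∧ s''.var 32 = X.digits ∧
          (∀ x < X.digits, s''.arr 7 x < X.base x) ∧
          (r ≠ 0 → X.value (s''.arr 7) X.digits + r = X.place X.digits) ∧
          s''.var 33 = (if r = 0 then 0 else 1) ∧
          (((∃ C, X.Proper C ∧ X.Full C) ∧ s''.var 0 = 1 ∧ 0 ≤ p'') ∨
            (s''.var 0 = 0 ∧ p'' = (1 - q) ^ r))) (by simp) (by simp [h33]) ?_ ?_) htime
        le_rfl fun _ _ h => h
      · refine .conseq (Q := fun s'' p'' => Frame (trial ;; advance ;; .assign 33 (.lit 1 - .var 34))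
          s' s'' ∧ (∀ x < X.digits, s''.arr 7 x < X.base x) ∧
          (r ≠ 0 → X.value (s''.arr 7) X.digits + r = X.place X.digits) ∧
          s''.var 33 = (if r = 0 then 0 else 1) ∧
          (((∃ C, X.Proper C ∧ X.Full C) ∧ s''.var 0 = 1 ∧ 0 ≤ p'') ∨
            (s''.var 0 = 0 ∧ p'' = (1 - q) ^ r))) (Exec.frame ?_) le_rfl le_rfl ?_
        · refine Exec.seq' (t := X.trialTime) (t' := 20 * X.digits + 6 + 1 + 1)
            (exec_trial hX hs' (V := q ≠ 0) hρ (by rwa [h3]) hq hpay') ?_ (by omega)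
          intro s₁ p₁ hf₁ hres
          have hs₁ := hs'.frame hf₁ (by decide) (by decide)
          have a7 : s₁.arr 7 = s'.arr 7 := hf₁.arr 7 (by decide)
          have hadv := det_advance hX hs₁ (by rw [hf₁.var 31 (by decide), h31])
            (by rw [hf₁.var 32 (by decide), h32]) (by rwa [a7])
          rw [a7] at hadv
          refine Exec.seq' (t := 20 * X.digits + 6) (t' := 1) (hadv p₁) ?_ (by omega)
          rintro s₂ p₂ hf₂ ⟨rfl, hc, hd', hval'⟩
          have hlt := Inst.value_lt hd'
          have h34 : s₂.var 34 = if r = 0 then 1 else 0 := by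
            rcases Nat.le_one_iff_eq_zero_or_eq_one.1 hc with h | h
            · rw [h] at hval' ⊢
              rw [if_neg]; omega
            · rw [h] at hval' ⊢
              rw [if_pos]; omega
          refine .assign (by simp) ?_
          simp only [St.setVar_arr, eval_sub, eval_lit, eval_var, St.setVar_var, ↓reduceIte, h34,
            OfNat.zero_ne_ofNat]
          have e0 : s₂.var 0 = s₁.var 0 := hf₂.var 0 (by decide)
          refine ⟨hd', fun hr => ?_, by split_ifs <;> rfl, ?_⟩
          · rw [h34, if_neg hr] at hval'; omega
          · rw [e0]
            rcases hres with h | ⟨h, rfl⟩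
            · exact .inl h
            · rw [h]
              rcases hρ' with ⟨hC, h1⟩ | h
              · exact .inl ⟨hC, h1, hρ⟩
              · exact .inr h
        · rintro s'' p'' ⟨hf'', h⟩
          refine ⟨hf.trans (hf''.weaken (by decide) (by decide)), ?_, ?_, ?_, h⟩
          · rw [hf''.arr 3 (by decide), h3]
          · rw [hf''.var 31 (by decide), h31]
          · rw [hf''.var 32 (by decide), h32]
      · rintro s'' p'' ⟨h1, h2, h3, h4, h5, h6, h7, h8⟩
        exact ih s'' p'' h1 h2 h3 h4 h5 h6 h7 h8
  have hpl : 0 < X.place X.digits := Finset.prod_pos fun x _ => Inst.base_pos hX x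
  have hdig : X.k * (X.k + 1) + X.l * (X.k - 1) = X.digits := rfl
  have hlk : X.l * (X.k - 1) ≤ X.digits := by omega
  have hk := hX.two_le
  have hkl : X.k ≤ X.k * (X.k + 1) := Nat.le_mul_of_pos_right _ (by omega)
  refine Exec.wp_seq (t := X.loopTime (X.place X.digits) + 5 * X.digits + 9) ?_
    (by simp only [HCmd.cost]; omega)
  simp only [HCmd.wp, ok_mul, ok_add, ok_var, ok_lit, eval_mul, eval_add, eval_var, eval_lit, hs.k]
  refine ⟨⟨trivial, ⟨trivial, by omega, by omega⟩, by omega⟩, ?_⟩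
  refine Exec.wp_seq (t := X.loopTime (X.place X.digits) + 5 * X.digits + 7) ?_
    (by simp only [HCmd.cost]; omega)
  simp only [HCmd.wp, ok_mul, ok_add, ok_sub, ok_var, ok_lit, eval_mul, eval_add, eval_sub, eval_var,
    eval_lit, St.setVar_var, ↓reduceIte, Nat.reduceEqDiff, hs.k, hs.l, hdig]
  refine ⟨⟨trivial, ⟨trivial, ⟨trivial, by omega⟩, by omega⟩, by omega⟩, ?_⟩
  refine Exec.seq' (t := 5 * X.digits + 4) (t' := X.loopTime (X.place X.digits) + 2)
    (R := fun s' p' => p' = (1 - q) ^ X.place X.digits ∧ ∀ x < X.digits, s'.arr 7 x = 0)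
    (Det.for (n := X.digits) (fun _ => 1) (fun m s' => ∀ x < m, s'.arr 7 x = 0)
      (by simp) hE' (by decide) (by decide) (by simp) ?_ (fun _ h => h) ?_ _) ?_ (by omega)
  · intro m hm s' _ hm' h
    refine Det.of_wp ?_ le_rfl
    simp only [HCmd.wp, ok_var, ok_lit, eval_var, eval_lit, hm', St.setVar_arr, St.setArr_arr,
      true_and]
    refine ⟨by omega, by omega, fun x hx => ?_⟩
    split_ifs with hc
    · rfl
    · exact h x (by omega)
  · simp only [Finset.sum_const, Finset.card_range, smul_eq_mul]; omega
  rintro s₁ p₁ hf₁ ⟨rfl, hz⟩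
  refine Exec.wp_seq (t := X.loopTime (X.place X.digits)) ?_ (by simp only [HCmd.cost]; omega)
  simp only [HCmd.wp, ok_lit, eval_lit, Nat.one_lt_ofNat, true_and]
  have hf : Frame rounds s s₁ :=
    (((Frame.refl _ s).setVar (by decide) _).setVar (by decide) _).trans
      (hf₁.weaken (by decide) (by decide))
  refine key _ _ _ (hf.setVar (by decide) _) ?_ ?_ ?_ ?_ ?_ ?_ (.inr ⟨?_, rfl⟩)
  · simp [hf₁.arr 3 (by decide)]
  · simp [hf₁.var 31 (by decide)]
  · simp [hf₁.var 32 (by decide)]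
  · intro x hx; simpa [hz x hx] using Inst.base_pos hX x
  · intro _
    have : X.value (s₁.arr 7) X.digits = 0 :=
      Finset.sum_eq_zero fun x hx => by rw [hz x (Finset.mem_range.1 hx), zero_mul]
    simp [this]
  · simp; omega
  · simp [hf₁.var 0 (by decide), h0]

/-- Computes an order of the vertices, and searches. If there is no suitable order, the answer is
"Yes". -/
def search : HCmd :=
  (peelInit ;; peelMain) ;; .cond ((HExpr.var 14).eq (.var 1)) rounds (.assign 0 (.lit 1))

/-- The time for the search. -/
def Inst.searchTime (X : Inst) : ℕ :=
  94 * (X.l + 1) * X.size + 20 * X.n + 5 * X.digits + 25 + X.loopTime (X.place X.digits)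

/-- The search succeeds with probability at least `1 - (1 - q) ^ m`, where `m` is the number of
rounds, if for each order of the vertices there is a target found in one round with probability at
least `q` (where `q = 0` requires nothing). -/
theorem exec_search {X : Inst} (hX : X.Wf Γ) {s : St} (hs : X.Holds s) (h0 : s.var 0 = 0)
    {q : ℝ} (hq1 : q ≤ 1)
    (hT : q ≠ 0 → ∀ pos : ℕ → ℕ,
      (∀ v < X.n, ((X.keep v).filter fun u => pos v ≤ pos u).card ≤ X.d) →
      ∃ W A χ, X.Target pos W A χ ∧ q ≤ X.chance W A χ) :
    Exec Γ search s X.searchTime ((1 - q) ^ X.place X.digits) fun s' p' =>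
      (s'.var 0 ≠ 0 ∧ ((∃ C, X.Proper C ∧ X.Full C) ∨
        ∃ U : Finset ℕ, U.Nonempty ∧ (∀ v ∈ U, v < X.n) ∧
          ∀ v ∈ U, X.d < ((X.keep v).filter fun u => u ∈ U).card) ∧ 0 ≤ p') ∨
      (s'.var 0 = 0 ∧ 1 ≤ p') := by
  have hp1 : 0 ≤ (1 - q) ^ X.place X.digits := pow_nonneg (by linarith) _
  refine Exec.seq' (t := 94 * (X.l + 1) * X.size + 20 * X.n + 11)
    (t' := X.loopTime (X.place X.digits) + 5 * X.digits + 12) (det_peel hX hs le_rfl _) ?_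
    (by simp only [Inst.searchTime]; omega)
  rintro s₁ _ hf₁ ⟨rfl, -, -, hgood, hbad⟩
  have hs₁ := hs.frame hf₁ (by decide) (by decide)
  have h0' : s₁.var 0 = 0 := by rw [hf₁.var 0 (by decide), h0]
  refine .conseq (.cond (t := X.loopTime (X.place X.digits) + 5 * X.digits + 11) (by simp) ?_)
    (by omega) le_rfl fun _ _ h => h
  simp only [eval_eq, eval_var, hs₁.n]
  split_ifs with h1 h2 h2
  · by_cases hq : q = 0
    · refine .conseq (exec_rounds hX hs₁ h0' (q := q) (W := ∅) (A := ∅) (χ := id) hq1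
        (fun h => absurd hq h) (fun h => absurd hq h)) le_rfl le_rfl ?_
      rintro s' p' (⟨hC, h, hp⟩ | ⟨h, rfl⟩)
      · exact .inl ⟨by omega, .inl hC, hp⟩
      · exact .inr ⟨h, le_rfl⟩
    · obtain ⟨W, A, χ, htar, hch⟩ := hT hq _ (hgood h1)
      refine .conseq (exec_rounds hX hs₁ h0' hq1 (fun _ => htar) (fun _ => hch)) le_rfl le_rfl ?_
      rintro s' p' (⟨hC, h, hp⟩ | ⟨h, rfl⟩)
      · exact .inl ⟨by omega, .inl hC, hp⟩
      · exact .inr ⟨h, le_rfl⟩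
  · exact absurd one_ne_zero h2
  · exact absurd rfl h2
  · refine .conseq (.assign (Q := fun s' p' => s'.var 0 = 1 ∧ 0 ≤ p') (by simp) ⟨by simp, hp1⟩)
      (by omega) le_rfl ?_
    rintro s' p' ⟨h, hp⟩
    exact .inl ⟨by omega, .inr (hbad (by assumption)), hp⟩

end ArrayLang

/-! ### Witnesses for partial Grundy colorings -/

/-- A partial coloring (colors `k` and larger mean that a vertex is not colored) whose color classes
satisfy the condition of a partial Grundy coloring can be extended to a partial Grundy coloring:
an uncolored vertex either gets a color that its neighborhood misses, or it is the first vertex of a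
new color `k`. -/
theorem hasPartialGrundyColoring_of_partial {V : Type*} [Fintype V] (G : SimpleGraph V) (k : ℕ)
    (c : V → ℕ) (hproper : ∀ u v, G.Adj u v → c u = c v → k ≤ c u)
    (hfull : ∀ i < k, ∃ v, c v = i ∧ ∀ j < i, ∃ u, G.Adj v u ∧ c u = j) :
    HasPartialGrundyColoring G k := by
  classical
  induction hm : (Finset.univ.filter fun v => k ≤ c v).card generalizing k c with
  | zero =>
    have hlt : ∀ v, c v < k := by
      intro v
      by_contra h
      have : v ∈ Finset.univ.filter fun v => k ≤ c v := by simpa using h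
      rw [Finset.card_eq_zero.1 hm] at this
      simp at this
    refine ⟨k, le_rfl, fun v => ⟨c v, hlt v⟩, fun u v huv h => ?_, fun i => ?_⟩
    · have := hproper u v huv (by simpa using h)
      have := hlt u
      omega
    · obtain ⟨v, hv, h⟩ := hfull i i.2
      refine ⟨v, Fin.ext hv, fun j hj => ?_⟩
      obtain ⟨u, hu, huj⟩ := h j hj
      exact ⟨u, hu, Fin.ext huj⟩
  | succ m ih =>
    obtain ⟨v, hv⟩ := Finset.card_pos.1 (by omega : 0 < (Finset.univ.filter fun v => k ≤ c v).card)
    have hkv : k ≤ c v := by simpa using hv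
    have herase : ((Finset.univ.filter fun v => k ≤ c v).erase v).card = m := by
      rw [Finset.card_erase_of_mem hv]; omega
    by_cases hmiss : ∃ i < k, ∀ u, G.Adj v u → c u ≠ i
    · obtain ⟨i, hi, hno⟩ := hmiss
      refine ih k (Function.update c v i) (fun u w huw h => ?_) (fun i' hi' => ?_) ?_
      · by_cases hu : u = v
        · subst hu
          rw [Function.update_self, Function.update_of_ne huw.ne'] at h
          exact absurd h.symm (hno w huw)
        · by_cases hw : w = v
          · subst hw
            rw [Function.update_self, Function.update_of_ne hu] at h
            exact absurd h (hno u huw.symm)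
          · rw [Function.update_of_ne hu, Function.update_of_ne hw] at h
            rw [Function.update_of_ne hu]
            exact hproper u w huw h
      · obtain ⟨x, hx, h⟩ := hfull i' hi'
        refine ⟨x, ?_, fun j hj => ?_⟩
        · rw [Function.update_of_ne, hx]
          rintro rfl; omega
        · obtain ⟨y, hy, hyj⟩ := h j hj
          refine ⟨y, hy, ?_⟩
          rw [Function.update_of_ne, hyj]
          rintro rfl; omega
      · rw [← herase]
        congr 1
        ext u
        by_cases hu : u = v
        · subst hu; simp [hi]
        · simp [hu]
    -- `v` has neighbors of all `k` colors, so it may form a new color class; the other uncolored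
    -- vertices stay uncolored
    · push Not at hmiss
      obtain ⟨k', hk', h⟩ := ih (k + 1) (fun u => if u = v then k else if k ≤ c u then k + 1 else c u)
        (fun u w huw h => by
          by_contra hlt
          by_cases hu : u = v
          · subst hu
            simp only [if_pos, if_neg huw.ne'] at h
            split_ifs at h <;> omega
          · by_cases hw : w = v
            · subst hw
              simp only [if_pos, if_neg huw.ne] at h
              split_ifs at h <;> omega
            · simp only [if_neg hu, if_neg hw] at h hlt
              have := hproper u w huw
              split_ifs at h hlt <;> omega)
        (fun i hi => by
          have hcol : ∀ u j, j < k → c u = j →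
              (if u = v then k else if k ≤ c u then k + 1 else c u) = j := by
            intro u j hj huj
            rw [if_neg (by rintro rfl; omega), if_neg (by omega), huj]
          rcases Nat.lt_succ_iff_lt_or_eq.1 hi with hi | rfl
          · obtain ⟨x, hx, h⟩ := hfull i hi
            refine ⟨x, hcol x i hi hx, fun j hj => ?_⟩
            obtain ⟨y, hy, hyj⟩ := h j hj
            exact ⟨y, hy, hcol y j (by omega) hyj⟩
          · refine ⟨v, by simp, fun j hj => ?_⟩
            obtain ⟨y, hy, hyj⟩ := hmiss j hj
            exact ⟨y, hy, hcol y j hj hyj⟩)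
        (by
          rw [← herase]
          congr 1
          ext u
          by_cases hu : u = v
          · simp [hu]
          · rw [Finset.mem_filter, Finset.mem_erase, Finset.mem_filter, if_neg hu]
            simp only [Finset.mem_univ, true_and, ne_eq, hu, not_false_eq_true]
            split_ifs with h
            · simp [h]
            · simp only [h, iff_false]; omega)
      exact ⟨k', by omega, h⟩

/-- Here the last color need not form an independent set: all its vertices but one may lose it. -/
theorem hasPartialGrundyColoring_of_partial' {V : Type*} [Fintype V] (G : SimpleGraph V) {k : ℕ}
    (hk : 0 < k) (c : V → ℕ) (hproper : ∀ u v, G.Adj u v → c u = c v → k - 1 ≤ c u)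
    (hfull : ∀ i < k, ∃ v, c v = i ∧ ∀ j < i, ∃ u, G.Adj v u ∧ c u = j) :
    HasPartialGrundyColoring G k := by
  classical
  obtain ⟨v₀, hv₀, h₀⟩ := hfull (k - 1) (by omega)
  refine hasPartialGrundyColoring_of_partial G k
    (fun u => if c u = k - 1 ∧ u ≠ v₀ then k else c u) (fun u w huw h => ?_) (fun i hi => ?_)
  · by_contra hlt
    have := hproper u w huw
    by_cases hu : u = v₀
    · subst hu
      have hw := huw.ne'
      simp only [ne_eq, not_true_eq_false, and_false, if_false, hw, not_false_eq_true,
        and_true] at h hlt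
      split_ifs at h <;> omega
    · by_cases hw : w = v₀
      · subst hw
        simp only [ne_eq, not_true_eq_false, and_false, if_false, hu, not_false_eq_true,
          and_true] at h hlt
        split_ifs at h hlt <;> omega
      · simp only [ne_eq, hu, hw, not_false_eq_true, and_true] at h hlt
        split_ifs at h hlt <;> omega
  · have hcol : ∀ u j, j < k - 1 → c u = j → (if c u = k - 1 ∧ u ≠ v₀ then k else c u) = j := by
      intro u j hj huj
      rw [if_neg (by omega), huj]
    rcases Nat.lt_or_ge i (k - 1) with hi' | hi'
    · obtain ⟨x, hx, h⟩ := hfull i hi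
      refine ⟨x, hcol x i hi' hx, fun j hj => ?_⟩
      obtain ⟨y, hy, hyj⟩ := h j hj
      exact ⟨y, hy, hcol y j (by omega) hyj⟩
    · obtain rfl : i = k - 1 := by omega
      refine ⟨v₀, by simp [hv₀], fun j hj => ?_⟩
      obtain ⟨y, hy, hyj⟩ := h₀ j hj
      exact ⟨y, hy, hcol y j hj hyj⟩

theorem Finset.sum_range_succ_mul_two (k : ℕ) :
    (∑ i ∈ Finset.range k, (i + 1)) * 2 = k * (k + 1) := by
  induction k with
  | zero => simp
  | succ k ih => rw [Finset.sum_range_succ, add_mul, ih]; ring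

/-- In a yes-instance, `k (k + 1) / 2` vertices suffice to see the first `k` color classes, and only
one vertex of the last class is needed. -/
theorem HasPartialGrundyColoring.exists_small {V : Type*} {G : SimpleGraph V} {k : ℕ}
    (h : HasPartialGrundyColoring G k) :
    ∃ (W : Finset V) (χ : V → ℕ), 2 * W.card ≤ k * (k + 1) ∧ (∀ w ∈ W, χ w < k) ∧
      (∀ u v, G.Adj u v → χ u ≠ χ v) ∧
      ∀ i < k, ∃ v ∈ W, χ v = i ∧ ∀ j < i, ∃ u ∈ W, G.Adj v u ∧ χ u = j := by
  classical
  obtain ⟨k', hk', f, hproper, hfull⟩ := h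
  choose v hv hvf using fun i : Fin k => hfull ⟨i, by omega⟩
  choose u hu huf using fun (i : Fin k) (j : Fin i) => hvf i ⟨j, by omega⟩ j.2
  refine ⟨Finset.univ.image fun x : Σ i : Fin k, Option (Fin i) => x.2.elim (v x.1) (u x.1),
    fun x => f x, ?_, ?_, fun x y hxy h => hproper x y hxy (Fin.ext h), fun i hi => ?_⟩
  · have hcard : Fintype.card (Σ i : Fin k, Option (Fin i)) * 2 = k * (k + 1) := by
      rw [Fintype.card_sigma]
      simp only [Fintype.card_option, Fintype.card_fin]
      rw [Fin.sum_univ_eq_sum_range (fun i => i + 1), Finset.sum_range_succ_mul_two]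
    have := Finset.card_image_le (s := Finset.univ)
      (f := fun x : Σ i : Fin k, Option (Fin i) => x.2.elim (v x.1) (u x.1))
    rw [Finset.card_univ] at this
    omega
  · intro w hw
    obtain ⟨⟨i, j⟩, -, rfl⟩ := Finset.mem_image.1 hw
    cases j with
    | none => simp [hv]
    | some j => simp only [Option.elim_some, huf]; omega
  · refine ⟨v ⟨i, hi⟩, Finset.mem_image.2 ⟨⟨⟨i, hi⟩, none⟩, by simp, rfl⟩, by simp [hv],
      fun j hj => ⟨u ⟨i, hi⟩ ⟨j, hj⟩, Finset.mem_image.2 ⟨⟨⟨i, hi⟩, some ⟨j, hj⟩⟩, by simp, rfl⟩,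
        hu _ _, by simp [huf]⟩⟩

namespace ArrayLang

variable {Γ : Env}

/-- The lists of `X` describe `G`, and the sides of the bicliques are completely joined. -/
structure Inst.Models {n : ℕ} (X : Inst) (G : SimpleGraph (Fin n)) : Prop where
  n_eq : X.n = n
  adj : ∀ v u : Fin n, (u : ℕ) ∈ X.nbr v ↔ G.Adj v u
  joined : ∀ j < X.l, ∀ u < X.n, ∀ v < X.n, X.side j u = 1 → X.side j v = 2 → v ∈ X.nbr u

theorem Inst.Models.hasPartialGrundyColoring {n : ℕ} {X : Inst} {G : SimpleGraph (Fin n)}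
    (hG : X.Models G) (hk : 0 < X.k) {C : ℕ → ℕ} (hp : X.Proper C) (hf : X.Full C)
    (hlt : ∀ v < X.n, ∀ u ∈ X.nbr v, u < X.n) : HasPartialGrundyColoring G X.k := by
  obtain rfl := hG.n_eq
  refine hasPartialGrundyColoring_of_partial' G hk (fun v => C v)
    (fun u v huv h => hp u u.2 v ((hG.adj _ _).2 huv) h.symm) (fun i hi => ?_)
  obtain ⟨v, hv, hvi, h⟩ := hf i hi
  refine ⟨⟨v, hv⟩, hvi, fun j hj => ?_⟩
  obtain ⟨u, hu, huj⟩ := h j hj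
  exact ⟨⟨u, hlt v hv u hu⟩, (hG.adj ⟨v, hv⟩ ⟨u, hlt v hv u hu⟩).1 hu, huj⟩

/-- For `W` take the few vertices that witness a coloring, and for `A` the vertices behind those of
`W` in the graph without the bicliques; each vertex has at most `d` of them. No color of `W` is
needed on both sides of a biclique, because vertices on different sides are adjacent. -/
theorem Inst.Models.exists_target {n : ℕ} {X : Inst} {G : SimpleGraph (Fin n)}
    (hX : X.Graph Γ) (hG : X.Models G) (h : HasPartialGrundyColoring G X.k) (pos : ℕ → ℕ)
    (hpos : ∀ v < X.n, ((X.keep v).filter fun u => pos v ≤ pos u).card ≤ X.d) :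
    ∃ W A χ, X.Target pos W A χ ∧ 2 * W.card ≤ X.k * (X.k + 1) ∧ A.card ≤ X.d * W.card ∧
      Disjoint W A := by
  classical
  obtain rfl := hG.n_eq
  obtain ⟨W, χ, hcard, hcol, hproper, hfull⟩ := h.exists_small
  let χ' : ℕ → ℕ := fun v => if hv : v < X.n then χ ⟨v, hv⟩ else 0
  have hχ : ∀ v : Fin X.n, χ' v = χ v := fun v => by simp [χ']
  let W' := W.map Fin.valEmbedding
  have hW : ∀ w ∈ W', ∃ v ∈ W, (v : ℕ) = w := fun w hw => by simpa [W'] using hw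
  have hW' : ∀ v : Fin X.n, v ∈ W → (v : ℕ) ∈ W' := fun v hv => by
    exact Finset.mem_map_of_mem Fin.valEmbedding hv
  refine ⟨W', (W'.biUnion fun w => (X.keep w).filter fun u => pos w ≤ pos u) \ W', χ',
    ⟨fun w hw => ?_, fun x hx => ?_, fun w hw => ?_, fun j hj i hi => ?_,
      fun w hw u hu hle => ?_, fun w hw u hu hadj => ?_, fun i hi => ?_⟩, ?_, ?_, ?_⟩
  · obtain ⟨v, -, rfl⟩ := hW w hw; exact v.2
  · obtain ⟨w, hw, hx⟩ := Finset.mem_biUnion.1 (Finset.mem_sdiff.1 hx).1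
    obtain ⟨v, -, rfl⟩ := hW w hw
    exact hX.lt v v.2 x (Inst.mem_keep.1 (Finset.mem_filter.1 hx).1).1
  · obtain ⟨v, hv, rfl⟩ := hW w hw
    rw [hχ]; exact hcol v hv
  · -- vertices of one color on both sides would be adjacent
    by_contra hcon
    push Not at hcon
    obtain ⟨w, hw, hwi, hw1⟩ := hcon 0 (by omega)
    obtain ⟨w', hw', hwi', hw2⟩ := hcon 1 (by omega)
    obtain ⟨v, -, rfl⟩ := hW w hw
    obtain ⟨v', -, rfl⟩ := hW w' hw'
    rw [hχ] at hwi hwi'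
    exact hproper v v' ((hG.adj _ _).1 (hG.joined j hj v v.2 v' v'.2 hw1 hw2))
      (hwi.trans hwi'.symm)
  · by_cases huW : u ∈ W'
    · exact .inl huW
    · exact .inr (Finset.mem_sdiff.2 ⟨Finset.mem_biUnion.2 ⟨w, hw, Finset.mem_filter.2 ⟨hu, hle⟩⟩, huW⟩)
  · obtain ⟨v, -, rfl⟩ := hW w hw
    obtain ⟨v', -, rfl⟩ := hW u hu
    rw [hχ, hχ]
    exact (hproper v v' ((hG.adj _ _).1 hadj)).symm
  · obtain ⟨v, hv, hvi, h⟩ := hfull i hi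
    refine ⟨v, hW' v hv, by rw [hχ, hvi], fun j hj => ?_⟩
    obtain ⟨u, hu, huv, huj⟩ := h j hj
    exact ⟨u, hW' u hu, (hG.adj _ _).2 huv, by rw [hχ, huj]⟩
  · simpa [W'] using hcard
  · refine (Finset.card_le_card Finset.sdiff_subset).trans ?_
    rw [mul_comm]
    refine Finset.card_biUnion_le_card_mul _ _ _ fun w hw => ?_
    obtain ⟨v, -, rfl⟩ := hW w hw
    exact hpos v v.2
  · exact Finset.disjoint_sdiff

/-! ### Probability of success and running time -/

/-- A lower bound for the probability that one round leads to a given target. -/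
noncomputable def successProb (k d l : ℕ) : ℝ :=
  (1 / ((k * (d + 1) : ℕ) : ℝ)) ^ (k * (k + 1) / 2) *
    ((d : ℝ) / (d + 1)) ^ (d * (k * (k + 1) / 2)) * (1 / 2) ^ (l * (k - 1))

/-- A vertex of `W` gets its color with probability `1 / (k (d + 1))`, and a vertex of `A` gets no
color with probability `d / (d + 1)`. -/
theorem Inst.Target.le_chance {X : Inst} (hk : 0 < X.k) {pos χ : ℕ → ℕ} {W A : Finset ℕ}
    (hT : X.Target pos W A χ) (hW : 2 * W.card ≤ X.k * (X.k + 1))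
    (hA : A.card ≤ X.d * W.card) (hWA : Disjoint W A) :
    successProb X.k X.d X.l ≤ X.chance W A χ := by
  classical
  have hBk : X.k ≤ X.k * (X.d + 1) := Nat.le_mul_of_pos_right _ (by omega)
  have hB0 : (0 : ℝ) < (X.k * (X.d + 1) : ℕ) := by exact_mod_cast (by omega : 0 < X.k * (X.d + 1))
  have hB1 : (1 : ℝ) ≤ (X.k * (X.d + 1) : ℕ) := by exact_mod_cast (by omega : 1 ≤ X.k * (X.d + 1))
  have hterm : ∀ v ∈ Finset.range X.n,
      ((X.choices W A χ v).card / (X.k * (X.d + 1) : ℕ) : ℝ) =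
        (if v ∈ W then 1 / ((X.k * (X.d + 1) : ℕ) : ℝ) else 1) *
          (if v ∈ A then (X.d / (X.d + 1) : ℝ) else 1) := by
    intro v _
    by_cases hvW : v ∈ W
    · have hvA : v ∉ A := Finset.disjoint_left.1 hWA hvW
      have hχ := hT.color v hvW
      have : X.choices W A χ v = {χ v} := by
        ext c
        simp only [Inst.choices, Finset.mem_filter, Finset.mem_range, hvW, hvA, forall_const,
          IsEmpty.forall_iff, and_true, Finset.mem_singleton]
        constructor
        · exact fun h => h.2
        · rintro rfl; exact ⟨by omega, rfl⟩
      rw [this, if_pos hvW, if_neg hvA]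
      simp
    · by_cases hvA : v ∈ A
      · have : X.choices W A χ v = Finset.Ico X.k (X.k * (X.d + 1)) := by
          ext c
          simp only [Inst.choices, Finset.mem_filter, Finset.mem_range, hvW, hvA, forall_const,
            IsEmpty.forall_iff, true_and, Finset.mem_Ico]
          tauto
        have hk' : (X.k : ℝ) ≠ 0 := by positivity
        rw [this, if_neg hvW, if_pos hvA, Nat.card_Ico, Nat.cast_sub hBk]
        push_cast
        field_simp
        ring
      · have : X.choices W A χ v = Finset.range (X.k * (X.d + 1)) := by
          ext c; simp [Inst.choices, hvW, hvA]
        rw [this, if_neg hvW, if_neg hvA, Finset.card_range, div_self hB0.ne', one_mul]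
  have hWn : Finset.range X.n ∩ W = W :=
    Finset.inter_eq_right.2 fun w hw => Finset.mem_range.2 (hT.lt w hw)
  have hAn : Finset.range X.n ∩ A = A :=
    Finset.inter_eq_right.2 fun w hw => Finset.mem_range.2 (hT.lt' w hw)
  have hWs : W.card ≤ X.k * (X.k + 1) / 2 := by omega
  have hd0 : (0 : ℝ) ≤ X.d / (X.d + 1) := by positivity
  have hd1 : (X.d / (X.d + 1) : ℝ) ≤ 1 := by
    rw [div_le_one (by positivity)]; linarith
  rw [Inst.chance, Finset.prod_congr rfl hterm, Finset.prod_mul_distrib, Finset.prod_ite_mem,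
    Finset.prod_ite_mem, hWn, hAn, Finset.prod_const, Finset.prod_const, successProb]
  refine mul_le_mul_of_nonneg_right ?_ (by positivity)
  refine mul_le_mul (pow_le_pow_of_le_one (by positivity) ?_ hWs)
    (pow_le_pow_of_le_one hd0 hd1 (hA.trans (Nat.mul_le_mul_left _ hWs))) (by positivity)
    (by positivity)
  rw [div_le_one hB0]; exact hB1

theorem successProb_le_one (k d l : ℕ) : successProb k d l ≤ 1 := by
  have h1 : 1 / ((k * (d + 1) : ℕ) : ℝ) ≤ 1 := by
    rcases Nat.eq_zero_or_pos (k * (d + 1)) with h | h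
    · rw [h]; simp
    · rw [div_le_one (by exact_mod_cast h)]; exact_mod_cast h
  have h2 : (d / (d + 1) : ℝ) ≤ 1 := by
    rw [div_le_one (by positivity)]; linarith
  rw [successProb]
  refine mul_le_one₀ (mul_le_one₀ (pow_le_one₀ (by positivity) h1) (by positivity)
    (pow_le_one₀ (by positivity) h2)) (by positivity) (pow_le_one₀ (by norm_num) (by norm_num))

theorem exp_neg_one_le_pow (d : ℕ) : Real.exp (-1) ≤ (d / (d + 1) : ℝ) ^ d := by
  rcases Nat.eq_zero_or_pos d with rfl | hd
  · simp
  · have hd' : (0 : ℝ) < d := by exact_mod_cast hd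
    have h : ((d + 1) / d : ℝ) ^ d ≤ Real.exp 1 := by
      have h1 : ((d + 1) / d : ℝ) ≤ Real.exp (1 / d) := by
        have := Real.add_one_le_exp (1 / d : ℝ)
        rw [add_div, div_self hd'.ne']; linarith
      calc ((d + 1) / d : ℝ) ^ d ≤ Real.exp (1 / d) ^ d := pow_le_pow_left₀ (by positivity) h1 d
        _ = Real.exp 1 := by rw [← Real.exp_nat_mul]; congr 1; field_simp
    rw [Real.exp_neg, ← inv_div, inv_pow]
    exact inv_anti₀ (by positivity) h

/-- The expected number of successful rounds is at least `2`. -/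
theorem two_le_rounds_mul_successProb {k d : ℕ} (hk : 2 ≤ k) (l : ℕ) :
    2 ≤ (((k * (d + 1)) ^ (k * (k + 1)) * 2 ^ (l * (k - 1)) : ℕ) : ℝ) * successProb k d l := by
  obtain ⟨s, hs⟩ : ∃ s, k * (k + 1) = 2 * s := (Nat.even_mul_succ_self k).two_dvd
  have hs3 : 3 ≤ s := by nlinarith
  have hB0 : (0 : ℝ) < (k * (d + 1) : ℕ) := by
    have : 0 < k * (d + 1) := by positivity
    exact_mod_cast this
  have e : (((k * (d + 1)) ^ (k * (k + 1)) * 2 ^ (l * (k - 1)) : ℕ) : ℝ) * successProb k d l =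
      ((k * (d + 1) : ℕ) * (d / (d + 1)) ^ d : ℝ) ^ s := by
    rw [successProb, hs, Nat.mul_div_cancel_left _ (by omega : 0 < 2), pow_mul _ d s, mul_pow _ _ s,
      Nat.cast_mul, Nat.cast_pow, Nat.cast_pow]
    have h2 : ((2 : ℕ) : ℝ) ^ (l * (k - 1)) * (1 / 2) ^ (l * (k - 1)) = 1 := by
      rw [← mul_pow]; norm_num
    have h3 : (((k * (d + 1) : ℕ)) : ℝ) ^ (2 * s) * (1 / ((k * (d + 1) : ℕ) : ℝ)) ^ s =
        ((k * (d + 1) : ℕ)) ^ s := by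
      rw [two_mul, pow_add, mul_assoc, ← mul_pow, mul_one_div_cancel hB0.ne', one_pow, mul_one]
    linear_combination ((((d / (d + 1) : ℝ) ^ d) ^ s) * (((k * (d + 1) : ℕ)) : ℝ) ^ (2 * s) * (1 / ((k * (d + 1) : ℕ) : ℝ)) ^ s) * h2 +
      (((d / (d + 1) : ℝ) ^ d) ^ s) * h3
  rw [e]
  -- for `d ≥ 1` the base is at least `4 / e`
  have hbase : (1.4 : ℝ) ≤ (k * (d + 1) : ℕ) * (d / (d + 1)) ^ d := by
    rcases Nat.eq_zero_or_pos d with rfl | hd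
    · have : (2 : ℝ) ≤ k := by exact_mod_cast hk
      simp; linarith
    · have hB : (4 : ℝ) ≤ (k * (d + 1) : ℕ) := by
        have : 4 ≤ k * (d + 1) := by nlinarith
        exact_mod_cast this
      have h1 := exp_neg_one_le_pow d
      have h2 : (0.36 : ℝ) ≤ Real.exp (-1) := by
        have := Real.exp_neg_one_gt_d9; linarith
      nlinarith
  calc (2 : ℝ) ≤ 1.4 ^ 3 := by norm_num
    _ ≤ 1.4 ^ s := pow_le_pow_right₀ (by norm_num) hs3
    _ ≤ _ := pow_le_pow_left₀ (by norm_num) hbase s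

theorem one_sub_pow_le_third {q : ℝ} {m : ℕ} (hq : q ≤ 1) (h : 2 ≤ m * q) :
    (1 - q) ^ m ≤ 1 / 3 := by
  have h1 : 1 - q ≤ Real.exp (-q) := by have := Real.add_one_le_exp (-q); linarith
  calc (1 - q) ^ m ≤ Real.exp (-q) ^ m := pow_le_pow_left₀ (by linarith) h1 m
    _ = Real.exp (-(m * q)) := by rw [← Real.exp_nat_mul]; congr 1; ring
    _ ≤ Real.exp (-1) * Real.exp (-1) := by
      rw [← Real.exp_add]; exact Real.exp_le_exp.2 (by linarith)
    _ ≤ 1 / 3 := by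
      have h2 := Real.exp_neg_one_lt_d9
      have h3 := Real.exp_pos (-1)
      nlinarith

/-- The number of rounds is `(k (d + 1)) ^ (k ^ 2 + k) * 2 ^ (l (k - 1))`. The spare factors
`(k (d + 1)) ^ (k ^ 2)` and `2 ^ l` absorb the time of one round. -/
theorem Inst.searchTime_le {X : Inst} (hk : 2 ≤ X.k) (hkn : X.k ≤ X.n) :
    X.searchTime ≤ 600 * ((X.k * (X.d + 1)) ^ (2 * X.k ^ 2 + X.k) * 2 ^ (X.l * X.k) * X.size) := by
  have hn := X.n_le_size
  have hl : X.l < 2 ^ X.l := Nat.lt_two_pow_self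
  set P := X.k ^ 2 * 2 ^ X.l * X.size with hP
  have hk2 : 4 ≤ X.k ^ 2 := by nlinarith
  have hkk : X.k ≤ X.k ^ 2 := by nlinarith
  have hL : 1 ≤ 2 ^ X.l := Nat.one_le_two_pow
  have hsz : 1 ≤ X.size := by omega
  have p1 : X.k ^ 2 * X.size ≤ P := by
    rw [hP, mul_right_comm]; exact Nat.le_mul_of_pos_right _ (by omega)
  have p2 : X.size ≤ P := le_trans (Nat.le_mul_of_pos_left _ (by omega)) p1
  have p3 : (X.l + 1) * X.size ≤ P := by
    rw [hP]; exact Nat.mul_le_mul_right _ (le_trans hl (Nat.le_mul_of_pos_left _ (by omega)))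
  have p4 : X.l * X.n ≤ P := (Nat.mul_le_mul (by omega) hn).trans p3
  have p5 : X.k * (X.k + 1) ≤ 2 * P := by
    have : X.k ^ 2 ≤ X.k ^ 2 * X.size := Nat.le_mul_of_pos_right _ hsz
    nlinarith
  have p6 : X.l * (X.k - 1) ≤ P := (Nat.mul_le_mul_left _ (by omega : X.k - 1 ≤ X.n)).trans p4
  have p7 : X.digits ≤ 3 * P := by rw [Inst.digits]; omega
  have p8 : X.trialTime ≤ 250 * P := by
    rw [Inst.trialTime]
    nlinarith
  have hpl : 1 ≤ X.place X.digits := by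
    rw [X.place_digits]; exact Nat.one_le_iff_ne_zero.2 (by positivity)
  have p9 : P ≤ X.place X.digits * P := Nat.le_mul_of_pos_left _ hpl
  have hmain : X.searchTime ≤ 600 * (X.place X.digits * P) := by
    have : X.place X.digits * (X.trialTime + 20 * X.digits + 11) ≤ X.place X.digits * (321 * P) :=
      Nat.mul_le_mul_left _ (by omega)
    rw [Inst.searchTime, Inst.loopTime]
    nlinarith
  refine hmain.trans (Nat.mul_le_mul_left _ ?_)
  rw [hP, X.place_digits]
  have hB : X.k ^ 2 ≤ (X.k * (X.d + 1)) ^ X.k ^ 2 :=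
    calc X.k ^ 2 ≤ (X.k * (X.d + 1)) ^ 2 :=
          Nat.pow_le_pow_left (Nat.le_mul_of_pos_right _ (by omega)) _
      _ ≤ _ := Nat.pow_le_pow_right (by positivity) (by omega)
  have hlk : X.l * X.k = X.l * (X.k - 1) + X.l := by
    conv_lhs => rw [show X.k = X.k - 1 + 1 by omega]
    ring
  calc (X.k * (X.d + 1)) ^ (X.k * (X.k + 1)) * 2 ^ (X.l * (X.k - 1)) * (X.k ^ 2 * 2 ^ X.l * X.size)
      = (X.k * (X.d + 1)) ^ (X.k * (X.k + 1)) * X.k ^ 2 * (2 ^ (X.l * (X.k - 1)) * 2 ^ X.l) *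
          X.size := by ring
    _ ≤ (X.k * (X.d + 1)) ^ (X.k * (X.k + 1)) * (X.k * (X.d + 1)) ^ X.k ^ 2 *
          (2 ^ (X.l * (X.k - 1)) * 2 ^ X.l) * X.size := by gcongr
    _ = _ := by
      rw [hlk, ← pow_add, ← pow_add]
      congr 3
      ring

/-- The search for a graph with bicliques. The set `U` certifies that the order of the vertices
does not exist. -/
theorem exec_search_models {n : ℕ} {X : Inst} (hX : X.Wf Γ) {G : SimpleGraph (Fin n)}
    (hG : X.Models G) {p : ℝ} (hp : 1 / 3 ≤ p) (hno : ¬ HasPartialGrundyColoring G X.k → 1 ≤ p)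
    {s : St} (hs : X.Holds s) (h0 : s.var 0 = 0) :
    Exec Γ search s X.searchTime p fun s' p' =>
      (s'.var 0 ≠ 0 ∧ (HasPartialGrundyColoring G X.k ∨
        ∃ U : Finset ℕ, U.Nonempty ∧ (∀ v ∈ U, v < X.n) ∧
          ∀ v ∈ U, X.d < ((X.keep v).filter fun u => u ∈ U).card) ∧ 0 ≤ p') ∨
      (s'.var 0 = 0 ∧ 1 ≤ p') := by
  have hk := hX.two_le
  by_cases hyes : HasPartialGrundyColoring G X.k
  · refine .conseq (exec_search hX hs h0 (successProb_le_one X.k X.d X.l) fun _ pos hpos => ?_)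
        le_rfl ((one_sub_pow_le_third (successProb_le_one X.k X.d X.l) ?_).trans hp)
        fun s' p' h => ?_
    · obtain ⟨W, A, χ, hT, h1, h2, h3⟩ := hG.exists_target hX.toGraph hyes pos hpos
      exact ⟨W, A, χ, hT, hT.le_chance (by omega) h1 h2 h3⟩
    · rw [X.place_digits]; exact two_le_rounds_mul_successProb hk X.l
    · exact h.imp (fun h => ⟨h.1, .inl hyes, h.2.2⟩) id
  · refine .conseq (exec_search hX hs h0 (q := 0) zero_le_one fun h => absurd rfl h) le_rfl
      (by simpa using hno hyes) fun s' p' h => ?_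
    refine h.imp (fun h => ⟨h.1, h.2.1.imp ?_ id, h.2.2⟩) id
    rintro ⟨C, hp, hf⟩
    exact hG.hasPartialGrundyColoring (by omega) hp hf hX.lt

/-! ### Reading the input -/

/-- The input contains the list `S`, preceded by its length, at the position `p`. -/
structure ListAt (Γ : Env) (p : ℕ) (S : List ℕ) : Prop where
  le : p + S.length < Γ.x.length
  len : Γ.x.getD p 0 = S.length
  get : ∀ t (h : t < S.length), Γ.x.getD (p + t + 1) 0 = S[t]

theorem length_flatMap_range (S : ℕ → List ℕ) (n : ℕ) :
    ((List.range n).flatMap fun v => (S v).length :: S v).length =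
      ∑ v ∈ Finset.range n, ((S v).length + 1) := by
  induction n with
  | zero => simp
  | succ n ih =>
    rw [List.range_succ, List.flatMap_append, List.length_append, ih, Finset.sum_range_succ]
    simp

/-- In a sequence of lists, each preceded by its length, the list `v` is found behind all previous
ones. -/
theorem listAt_flatMap {pre post : List ℕ} {S : ℕ → List ℕ} {n : ℕ}
    (hx : Γ.x = pre ++ (List.range n).flatMap (fun v => (S v).length :: S v) ++ post) {v : ℕ}
    (hv : v < n) : ListAt Γ (pre.length + ∑ u ∈ Finset.range v, ((S u).length + 1)) (S v) := by
  obtain ⟨post', h⟩ : ∃ post', Γ.x = (pre ++ (List.range v).flatMap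
      (fun v => (S v).length :: S v)) ++ ((S v).length :: (S v ++ post')) := by
    obtain ⟨m, rfl⟩ : ∃ m, n = v + 1 + m := ⟨n - (v + 1), by omega⟩
    refine ⟨((List.range m).map (v + 1 + ·)).flatMap (fun v => (S v).length :: S v) ++ post, ?_⟩
    rw [hx, List.range_add, List.range_succ]
    simp [List.flatMap_append]
  have hlen : (pre ++ (List.range v).flatMap (fun v => (S v).length :: S v)).length =
      pre.length + ∑ u ∈ Finset.range v, ((S u).length + 1) := by
    rw [List.length_append, length_flatMap_range]
  rw [← hlen]
  generalize pre ++ (List.range v).flatMap (fun v => (S v).length :: S v) = q at h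
  refine ⟨?_, ?_, fun t ht => ?_⟩
  · rw [h]; simp
  · rw [h]; simp
  · rw [h, List.getD_append_right _ _ _ _ (by omega),
      show q.length + t + 1 - q.length = t + 1 by omega, List.getD_cons_succ,
      List.getD_append _ _ _ _ ht, List.getD_eq_getElem _ _ ht]

theorem flatMap_range_two_mul (S : ℕ → List ℕ) (l : ℕ) :
    (List.range (2 * l)).flatMap (fun v => (S v).length :: S v) = (List.range l).flatMap fun j =>
      ((S (2 * j)).length :: S (2 * j)) ++ ((S (2 * j + 1)).length :: S (2 * j + 1)) := by
  induction l with
  | zero => simp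
  | succ l ih =>
    rw [show 2 * (l + 1) = 2 * l + 1 + 1 by ring, List.range_succ, List.range_succ,
      List.range_succ]
    simp only [List.flatMap_append, ih]
    simp

theorem flatMap_finRange {n : ℕ} {f : Fin n → List ℕ} {g : ℕ → List ℕ}
    (h : ∀ v : Fin n, f v = g v) : (List.finRange n).flatMap f = (List.range n).flatMap g := by
  rw [← List.map_coe_finRange_eq_range, List.flatMap_map]
  exact congrArg (fun f => (List.finRange n).flatMap f) (funext h)

/-- Lists of vertices as lists of numbers. -/
def toNat {n l : ℕ} (S : Fin l → List (Fin n)) (v : ℕ) : List ℕ :=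
  if h : v < l then (S ⟨v, h⟩).map Fin.val else []

theorem toNat_coe {n l : ℕ} (S : Fin l → List (Fin n)) (v : Fin l) :
    toNat S v = (S v).map Fin.val := by
  simp [toNat]

theorem encodeVertices_eq {n l : ℕ} (S : Fin l → List (Fin n)) (v : Fin l) :
    encodeVertices (S v) = (toNat S v).length :: toNat S v := by
  rw [toNat_coe, encodeVertices, List.length_map]

theorem encodeAdjacency_eq {n : ℕ} (adj : Fin n → List (Fin n)) :
    encodeAdjacency adj = (List.range n).flatMap fun v => (toNat adj v).length :: toNat adj v :=
  flatMap_finRange fun v => encodeVertices_eq adj v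

theorem mem_toNat {n l : ℕ} {S : Fin l → List (Fin n)} {v u : ℕ} (h : u ∈ toNat S v) :
    ∃ (hv : v < l) (hu : u < n), (⟨u, hu⟩ : Fin n) ∈ S ⟨v, hv⟩ := by
  rw [toNat] at h
  split_ifs at h with hv
  · obtain ⟨w, hw, rfl⟩ := List.mem_map.1 h
    exact ⟨hv, w.2, hw⟩
  · simp at h

theorem mem_toNat_coe {n l : ℕ} {S : Fin l → List (Fin n)} {v : Fin l} {u : Fin n} :
    (u : ℕ) ∈ toNat S v ↔ u ∈ S v := by
  rw [toNat_coe, List.mem_map]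
  constructor
  · rintro ⟨w, hw, h⟩
    rwa [← Fin.ext h]
  · exact fun h => ⟨u, h, rfl⟩

/-- The encoded adjacency lists are in the input at the positions described by `hd`. -/
theorem Inst.graph_of_encode {n : ℕ} {X : Inst} {G : SimpleGraph (Fin n)}
    {adj : Fin n → List (Fin n)} (hadj : IsAdjacencyList G adj) {pre post : List ℕ}
    (hx : Γ.x = pre ++ encodeAdjacency adj ++ post) (hn : X.n = n) (hnbr : X.nbr = toNat adj)
    (hhd : ∀ v, X.hd v = pre.length + ∑ u ∈ Finset.range v, ((X.nbr u).length + 1))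
    (hI : Γ.x.length + 16 < Γ.I) : X.Graph Γ := by
  obtain rfl := hn
  have hat : ∀ v < X.n, ListAt Γ (X.hd v) (X.nbr v) := by
    intro v hv
    rw [encodeAdjacency_eq] at hx
    have := listAt_flatMap hx hv
    rwa [← hnbr, ← hhd] at this
  have hnl : X.n ≤ Γ.x.length := by
    rw [hx, encodeAdjacency_eq, List.length_append, List.length_append, length_flatMap_range]
    have : ∑ v ∈ Finset.range X.n, 1 ≤ ∑ v ∈ Finset.range X.n, ((toNat adj v).length + 1) :=
      Finset.sum_le_sum fun v _ => by omega
    simp only [Finset.sum_const, Finset.card_range, smul_eq_mul, mul_one] at this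
    omega
  have hmem : ∀ {v u : ℕ}, u ∈ X.nbr v →
      ∃ (hv : v < X.n) (hu : u < X.n), G.Adj ⟨v, hv⟩ ⟨u, hu⟩ := by
    intro v u h
    rw [hnbr] at h
    obtain ⟨hv, hu, h⟩ := mem_toNat h
    exact ⟨hv, hu, ((hadj _).2 _).1 h⟩
  refine ⟨fun v hv => (hat v hv).le, fun v hv => (hat v hv).len, fun v hv => (hat v hv).get,
    fun v hv => ?_, fun v hv u hu => (hmem hu).2.1, fun v hv u hu => ?_, fun v hv h => ?_, hI,
    by omega⟩
  · rw [hnbr, toNat, dif_pos hv]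
    exact (hadj _).1.map Fin.val_injective
  · obtain ⟨h1, h2, h⟩ := hmem hu
    rw [hnbr]
    exact mem_toNat_coe.2 (((hadj ⟨u, h2⟩).2 ⟨v, h1⟩).2 h.symm)
  · obtain ⟨h1, h2, h⟩ := hmem h
    exact G.irrefl h

/-- Computes the positions of the neighbor lists; the first one is in variable `6`. -/
def readGraph : HCmd :=
  .for 15 1 (.store 0 (.var 15) (.var 6) ;; .assign 6 (.var 6 + .inp (.var 6) + .lit 1))

theorem det_readGraph {X : Inst} (hX : X.Graph Γ) {s : St} {p t : ℕ} (hn : s.var 1 = X.n)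
    (h6 : s.var 6 = p) (hhd : ∀ v, X.hd v = p + ∑ u ∈ Finset.range v, ((X.nbr u).length + 1))
    (ht : 7 * X.n + 4 ≤ t) :
    Det Γ readGraph s t fun s' => s'.var 6 = X.hd X.n ∧ ∀ v < X.n, s'.arr 0 v = X.hd v := by
  have hnI := hX.n_lt
  have hxI := hX.len_lt
  refine Det.for (n := X.n) (fun _ => 3) (fun m s' => s'.var 6 = X.hd m ∧
    ∀ v < m, s'.arr 0 v = X.hd v) hn (by omega) (by decide) (by decide) ?_ ?_ (fun _ h => h) ?_
  · simp [h6, hhd]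
  · rintro m hm s' _ hm' ⟨h1, h2⟩
    have hl := hX.len m hm
    have hsucc : X.hd (m + 1) = X.hd m + (X.nbr m).length + 1 := by
      rw [hhd, hhd, Finset.sum_range_succ]; omega
    refine Det.of_wp ?_ (by decide)
    simp only [HCmd.wp, ok_var, eval_var, hm', h1, ok_add, ok_inp, ok_lit, eval_add, eval_inp,
      eval_lit, St.setArr_var, hX.deg m hm, St.setVar_var, ↓reduceIte, St.setVar_arr,
      St.setArr_arr, true_and, Nat.reduceEqDiff, hsucc]
    refine ⟨by omega, ⟨⟨by omega, by omega⟩, by omega, by omega⟩, fun v hv => ?_⟩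
    split_ifs with h
    · rw [h]
    · exact h2 v (by omega)
  · simp only [Finset.sum_const, Finset.card_range, smul_eq_mul]; omega

/-- Reads the list of the vertices on side `b` of the biclique in variable `12`. -/
def readSide (b : ℕ) : HCmd :=
  .assign 8 (.inp (.var 6)) ;;
  .for 10 8 (.store 1 (.var 12 * .var 1 + .inp (.var 6 + .var 10 + .lit 1)) (.lit b)) ;;
  .assign 6 (.var 6 + .var 8 + .lit 1)

/-- The side is marked in array `1`, and variable `6` moves on to the next list. -/
theorem det_readSide {s : St} {b n j p : ℕ} {S : List ℕ} (hb : b < 16) (hS : ListAt Γ p S)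
    (hSn : ∀ u ∈ S, j * n + u < Γ.I) (hI : Γ.x.length + 16 < Γ.I)
    (h1 : s.var 1 = n) (h6 : s.var 6 = p) (h12 : s.var 12 = j) :
    Det Γ (readSide b) s (5 * S.length + 8) fun s' => s'.var 6 = p + S.length + 1 ∧
      ∀ i, s'.arr 1 i = if ∃ u ∈ S, i = j * n + u then b else s.arr 1 i := by
  have hle := hS.le
  refine Det.wp_seq (t := 5 * S.length + 6) ?_ (by simp only [HCmd.cost]; omega)
  simp only [HCmd.wp, ok_inp, ok_var, eval_inp, eval_var, h6, hS.len]
  refine ⟨⟨trivial, by omega⟩, ?_⟩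
  refine Det.seq (t := 5 * S.length + 4) (t' := 1)
    (R := fun s' => ∀ i, s'.arr 1 i = if ∃ u ∈ S, i = j * n + u then b else s.arr 1 i)
    (Det.for (n := S.length) (fun _ => 1) (fun m s' => ∀ i, s'.arr 1 i =
      if ∃ u ∈ S.take m, i = j * n + u then b else s.arr 1 i) (by simp) (by omega)
      (by simp [HCmd.for, HCmd.wv]) (by simp [HCmd.wv]) (by simp) ?_ ?_ ?_) ?_ (by omega)
  · intro m hm s' hf hm' hInv
    have e6 : s'.var 6 = p := by rw [hf.var 6 (by simp [HCmd.for, HCmd.wv])]; simpa using h6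
    have e1 : s'.var 1 = n := by rw [hf.var 1 (by simp [HCmd.for, HCmd.wv])]; simpa using h1
    have e12 : s'.var 12 = j := by rw [hf.var 12 (by simp [HCmd.for, HCmd.wv])]; simpa using h12
    have hlt := hSn _ (List.getElem_mem hm)
    refine Det.of_wp ?_ le_rfl
    simp only [HCmd.wp, ok_add, ok_mul, ok_inp, ok_var, ok_lit, eval_add, eval_mul, eval_inp,
      eval_var, eval_lit, e6, e1, e12, hm', hS.get m hm, St.setVar_arr, St.setArr_arr, hb, true_and]
    refine ⟨by omega, ⟨by omega, ⟨⟨by omega, by omega, by omega⟩, by omega⟩, by omega⟩, fun i => ?_⟩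
    have hmem : (∃ u ∈ S.take (m + 1), i = j * n + u) ↔
        (∃ u ∈ S.take m, i = j * n + u) ∨ i = j * n + S[m] := by
      rw [List.take_succ_eq_append_getElem hm]
      simp only [List.mem_append, List.mem_singleton, or_and_right, exists_or, exists_eq_left]
    rw [hInv i]
    by_cases hi : i = j * n + S[m]
    · rw [if_pos hi, if_pos (hmem.2 (.inr hi))]
    · rw [if_neg hi]
      refine if_congr ⟨fun h => hmem.2 (.inl h), fun h => (hmem.1 h).resolve_right hi⟩ rfl rfl
  · intro s' h; simpa using h
  · simp only [Finset.sum_const, Finset.card_range, smul_eq_mul]; omega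
  · intro s' hf h
    have e6 : s'.var 6 = p := by rw [hf.var 6 (by simp [HCmd.for, HCmd.wv])]; simpa using h6
    have e8 : s'.var 8 = S.length := by rw [hf.var 8 (by simp [HCmd.for, HCmd.wv])]; simp
    refine Det.of_wp ?_ le_rfl
    simp only [HCmd.wp, ok_add, ok_var, ok_lit, eval_add, eval_var, eval_lit, e6, e8,
      St.setVar_var, ↓reduceIte, St.setVar_arr, h, implies_true, and_true, true_and]
    exact ⟨by omega, by omega⟩

/-- Reads the bicliques; variable `6` holds the position of the first one. -/
def readSides : HCmd := .for 12 4 (readSide 1 ;; readSide 2)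

theorem det_readSides {s : St} {l n p : ℕ} {S : ℕ → List ℕ} (hn : s.var 1 = n) (hl : s.var 4 = l)
    (h6 : s.var 6 = p) (hI : Γ.x.length + 16 < Γ.I) (hlI : l * n + l + n + 16 < Γ.I)
    (hS : ∀ y < 2 * l, ListAt Γ (p + ∑ z ∈ Finset.range y, ((S z).length + 1)) (S y))
    (hSn : ∀ y < 2 * l, (S y).length ≤ n ∧ ∀ u ∈ S y, u < n)
    (hdisj : ∀ j < l, ∀ u ∈ S (2 * j), u ∉ S (2 * j + 1)) (h1 : s.arr 1 = fun _ => 0) :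
    Det Γ readSides s (l * (10 * n + 21) + 4) fun s' => ∀ j < l, ∀ v < n, s'.arr 1 (j * n + v) =
      if v ∈ S (2 * j) then 1 else if v ∈ S (2 * j + 1) then 2 else 0 := by
  refine Det.for (n := l) (fun _ => 10 * n + 17) (fun m s' =>
    s'.var 6 = p + ∑ z ∈ Finset.range (2 * m), ((S z).length + 1) ∧
    (∀ j < m, ∀ v < n, s'.arr 1 (j * n + v) =
      if v ∈ S (2 * j) then 1 else if v ∈ S (2 * j + 1) then 2 else 0) ∧
    ∀ j ≥ m, ∀ v < n, s'.arr 1 (j * n + v) = 0) hl (by omega) (by decide) (by decide)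
    (by simp [h6, h1]) ?_ (fun s' h => h.2.1) ?_
  · rintro m hm s' hf hm' ⟨i6, i1, i0⟩
    have e1 : s'.var 1 = n := by rw [hf.var 1 (by decide), hn]
    have hb1 := hSn (2 * m) (by omega)
    have hb2 := hSn (2 * m + 1) (by omega)
    have hidx : ∀ u < n, m * n + u < Γ.I := fun u hu => by have := idx_lt hm hu; omega
    refine Det.seq (t := 5 * n + 8) (t' := 5 * n + 8) ((det_readSide (by omega) (hS (2 * m) (by omega))
      (fun u hu => hidx u (hb1.2 u hu)) hI e1 i6 hm').conseq (by omega) fun _ _ h => h) ?_ (by omega)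
    rintro s₁ hf₁ ⟨k6, k1⟩
    have hsum : p + ∑ z ∈ Finset.range (2 * m + 1), ((S z).length + 1) =
        p + ∑ z ∈ Finset.range (2 * m), ((S z).length + 1) + (S (2 * m)).length + 1 := by
      rw [Finset.sum_range_succ]; omega
    refine (det_readSide (by omega) (hS (2 * m + 1) (by omega)) (fun u hu => hidx u (hb2.2 u hu)) hI
      (by rw [hf₁.var 1 (by decide), e1]) (by rw [k6, hsum])
      (by rw [hf₁.var 12 (by decide), hm'])).conseq (by omega) ?_
    rintro s₂ - ⟨l6, l1⟩
    simp only [St.setVar_var, St.setVar_arr, Nat.reduceEqDiff, ↓reduceIte]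
    have hne : ∀ j v u, v < n → u < n → j ≠ m → j * n + v ≠ m * n + u := by
      intro j v u hv hu hj h
      exact hj ((idx_inj hv hu).1 h).1
    refine ⟨?_, fun j hj v hv => ?_, fun j hj v hv => ?_⟩
    · rw [l6, show 2 * (m + 1) = 2 * m + 1 + 1 by ring, Finset.sum_range_succ _ (2 * m + 1)]
      omega
    · by_cases hjm : j = m
      · subst hjm
        have hS1 : ∀ y, (∃ u ∈ S y, j * n + v = j * n + u) ↔ v ∈ S y := by
          intro y
          constructor
          · rintro ⟨u, hu, h⟩
            rwa [show v = u by omega]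
          · exact fun h => ⟨v, h, rfl⟩
        rw [l1, k1, i0 j le_rfl v hv]
        simp only [hS1]
        by_cases h : v ∈ S (2 * j)
        · simp [h, hdisj j hm v h]
        · simp [h]
      · rw [l1, if_neg, k1, if_neg, i1 j (by omega) v hv]
        · rintro ⟨u, hu, h⟩; exact hne j v u hv (hb1.2 u hu) hjm h
        · rintro ⟨u, hu, h⟩; exact hne j v u hv (hb2.2 u hu) hjm h
    · rw [l1, if_neg, k1, if_neg, i0 j (by omega) v hv]
      · rintro ⟨u, hu, h⟩; exact hne j v u hv (hb1.2 u hu) (by omega) h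
      · rintro ⟨u, hu, h⟩; exact hne j v u hv (hb2.2 u hu) (by omega) h
  · simp only [Finset.sum_const, Finset.card_range, smul_eq_mul]; linarith

end ArrayLang

/-! ### Structural Partial Grundy Coloring -/

theorem HasPartialGrundyColoring.le_card {n k : ℕ} {G : SimpleGraph (Fin n)}
    (h : HasPartialGrundyColoring G k) : k ≤ n := by
  obtain ⟨k', hk', f, -, hf⟩ := h
  have hs : Function.Surjective f := fun i => (hf i).imp fun _ h => h.1
  simpa using hk'.trans (by simpa using Fintype.card_le_of_surjective f hs)

theorem hasPartialGrundyColoring_of_lt_two {n k : ℕ} (G : SimpleGraph (Fin n)) (hn : 0 < n)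
    (hk : k < 2) : HasPartialGrundyColoring G k := by
  refine hasPartialGrundyColoring_of_partial G k (fun v => if v = ⟨0, hn⟩ then 0 else k)
    (fun u v huv h => ?_) (fun i hi => ⟨⟨0, hn⟩, by simp; omega, fun j hj => by omega⟩)
  by_cases hu : u = ⟨0, hn⟩
  · have hv : v ≠ ⟨0, hn⟩ := fun hv => huv.ne (hu.trans hv.symm)
    simp only [if_pos hu, if_neg hv] at h ⊢
    omega
  · simp [hu]

/-- The sets of edges in lists of neighbors and in the graph have the right numbers of elements. -/
theorem sum_length_adj {n : ℕ} {G : SimpleGraph (Fin n)} {adj : Fin n → List (Fin n)}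
    (hadj : IsAdjacencyList G adj) :
    ∑ v ∈ Finset.range n, ((ArrayLang.toNat adj v).length + 1) = 2 * G.edgeSet.ncard + n := by
  classical
  have h1 : ∀ v : Fin n, (ArrayLang.toNat adj v).length = G.degree v := by
    intro v
    rw [ArrayLang.toNat_coe, List.length_map, ← List.toFinset_card_of_nodup (hadj v).1,
      ← G.card_neighborFinset_eq_degree]
    congr 1
    ext u
    simp [(hadj v).2]
  rw [Finset.sum_add_distrib, ← Fin.sum_univ_eq_sum_range (fun v => (ArrayLang.toNat adj v).length),
    Finset.sum_congr rfl fun v _ => h1 v, G.sum_degrees_eq_twice_card_edges,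
    Set.ncard_eq_toFinset_card', SimpleGraph.edgeFinset]
  simp

namespace ArrayLang

variable {Γ : Env}

/-- The algorithm for Structural Partial Grundy Coloring. -/
def structural : HCmd :=
  .assign 1 (.inp (.lit 0)) ;; .assign 2 (.inp (.lit 1)) ;;
  .cond ((HExpr.var 2).lt (.lit 2)) (.assign 0 (.lit 1))
    (.cond ((HExpr.var 1).lt (.var 2)) .skip
      ((.assign 3 (.inp (.lit 2)) ;; .assign 4 (.inp (.lit 3)) ;;
        .assign 5 (.var 2 * (.var 3 + .lit 1)) ;; .assign 6 (.lit 4)) ;;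
        readGraph ;; readSides ;; search))

/-- The sides of the bicliques, in the order of the input. -/
def sideLists {n l : ℕ} (L R : Fin l → List (Fin n)) (y : ℕ) : List ℕ :=
  if y % 2 = 0 then toNat L (y / 2) else toNat R (y / 2)

theorem sideLists_even {n l : ℕ} (L R : Fin l → List (Fin n)) (j : ℕ) :
    sideLists L R (2 * j) = toNat L j := by simp [sideLists]

theorem sideLists_odd {n l : ℕ} (L R : Fin l → List (Fin n)) (j : ℕ) :
    sideLists L R (2 * j + 1) = toNat R j := by
  have h1 : (2 * j + 1) % 2 = 1 := by omega
  have h2 : (2 * j + 1) / 2 = j := by omega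
  simp [sideLists, h1, h2]

theorem encodeSPGC_eq {n : ℕ} (k d l : ℕ) (adj : Fin n → List (Fin n))
    (L R : Fin l → List (Fin n)) :
    encodeSPGC k d l adj L R = [n, k, d, l] ++ encodeAdjacency adj ++
      (List.range (2 * l)).flatMap fun y => (sideLists L R y).length :: sideLists L R y := by
  rw [encodeSPGC, flatMap_range_two_mul]
  congr 1
  refine flatMap_finRange fun i => ?_
  rw [sideLists_even, sideLists_odd, encodeVertices_eq, encodeVertices_eq]

/-- The instance for the search that is given in the input. -/
def givenInst {n l : ℕ} (k d : ℕ) (adj : Fin n → List (Fin n)) (L R : Fin l → List (Fin n)) :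
    Inst where
  n := n
  k := k
  d := d
  l := l
  nbr := toNat adj
  side j v := if v ∈ sideLists L R (2 * j) then 1 else if v ∈ sideLists L R (2 * j + 1) then 2 else 0
  hd v := 4 + ∑ u ∈ Finset.range v, ((toNat adj u).length + 1)

section
variable {n k d l : ℕ} {G : SimpleGraph (Fin n)} {adj : Fin n → List (Fin n)}
  {L R : Fin l → List (Fin n)}

theorem givenInst_side_eq_one {j v : ℕ} :
    (givenInst k d adj L R).side j v = 1 ↔ v ∈ toNat L j := by
  simp only [givenInst, sideLists_even, sideLists_odd]
  split_ifs with h <;> simp [h]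

theorem givenInst_side_eq_two {j v : ℕ} (h : (givenInst k d adj L R).side j v = 2) :
    v ∈ toNat R j := by
  simp only [givenInst, sideLists_even, sideLists_odd] at h
  split_ifs at h <;> simp_all

theorem disjoint_toNat (hB : IsSPGCInstance G d l L R) {j v : ℕ} (h : v ∈ toNat L j) :
    v ∉ toNat R j := by
  intro h'
  obtain ⟨hj, hv, h⟩ := mem_toNat h
  obtain ⟨_, _, h'⟩ := mem_toNat h'
  exact Set.disjoint_left.1 (hB.1 ⟨j, hj⟩).2.2.2.2.1 h h'

theorem givenInst_models (hadj : IsAdjacencyList G adj) (hB : IsSPGCInstance G d l L R) :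
    (givenInst k d adj L R).Models G where
  n_eq := rfl
  adj v u := by
    change (u : ℕ) ∈ toNat adj v ↔ _
    rw [mem_toNat_coe, (hadj v).2]
  joined j hj u hu v hv h1 h2 := by
    obtain ⟨hj, hu, h1⟩ := mem_toNat (givenInst_side_eq_one.1 h1)
    obtain ⟨_, hv, h2⟩ := mem_toNat (givenInst_side_eq_two h2)
    exact (mem_toNat_coe (v := ⟨u, hu⟩) (u := ⟨v, hv⟩)).2
      (((hadj _).2 _).2 ((hB.1 ⟨j, hj⟩).2.2.2.2.2 _ h1 _ h2))

/-- In a degenerate graph every set of vertices contains one of small degree in the set. -/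
theorem givenInst_not_dense (hadj : IsAdjacencyList G adj) (hB : IsSPGCInstance G d l L R) :
    ¬ ∃ U : Finset ℕ, U.Nonempty ∧ (∀ v ∈ U, v < n) ∧
      ∀ v ∈ U, d < (((givenInst k d adj L R).keep v).filter fun u => u ∈ U).card := by
  classical
  rintro ⟨U, ⟨v₀, hv₀⟩, hU, hdeg⟩
  obtain ⟨v, hv, -, hcard⟩ := hB.2 ((⊤ : SimpleGraph.Subgraph _).induce {v | (v : ℕ) ∈ U})
    ⟨⟨v₀, hU _ hv₀⟩, hv₀⟩
  have hsub : (((givenInst k d adj L R).keep v).filter fun u => u ∈ U : Set ℕ) ⊆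
      Fin.val '' (((⊤ : SimpleGraph.Subgraph (G.deleteEdges (⋃ i, bicliqueEdges {v | v ∈ L i}
        {v | v ∈ R i}))).induce {v | (v : ℕ) ∈ U}).neighborSet v) := by
    intro u hu
    obtain ⟨hu, huU⟩ := Finset.mem_filter.1 (Finset.mem_coe.1 hu)
    obtain ⟨hu, hcut⟩ := Inst.mem_keep.1 hu
    obtain ⟨_, hun, hadj'⟩ := mem_toNat hu
    refine ⟨⟨u, hun⟩, ?_, rfl⟩
    simp only [SimpleGraph.Subgraph.mem_neighborSet, SimpleGraph.Subgraph.induce_adj,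
      Set.mem_ofPred_eq, SimpleGraph.Subgraph.top_adj, SimpleGraph.deleteEdges_adj, Set.mem_iUnion,
      not_exists]
    refine ⟨hv, huU, ((hadj v).2 _).1 hadj', fun i hi => hcut ?_⟩
    obtain ⟨a, ha, b, hb, hab⟩ := hi
    have hside : (givenInst k d adj L R).side i a * (givenInst k d adj L R).side i b = 2 := by
      have h1 : (givenInst k d adj L R).side i a = 1 :=
        givenInst_side_eq_one.2 (mem_toNat_coe.2 ha)
      have h2 : (givenInst k d adj L R).side i b = 2 := by
        have hbR : (b : ℕ) ∈ toNat R i := mem_toNat_coe.2 hb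
        have hbL : (b : ℕ) ∉ toNat L i := fun h => disjoint_toNat hB h hbR
        simp [givenInst, sideLists_even, sideLists_odd, hbR, hbL]
      rw [h1, h2]
    rcases Sym2.eq_iff.1 hab with ⟨rfl, rfl⟩ | ⟨rfl, rfl⟩
    · exact ⟨i, i.2, hside⟩
    · exact ⟨i, i.2, by rw [mul_comm]; exact hside⟩
  have h1 := Set.ncard_le_ncard hsub (Set.toFinite _)
  rw [Set.ncard_coe_finset, Set.ncard_image_of_injective _ Fin.val_injective] at h1
  have := hdeg v hv
  omega

/-- The postcondition says that the answer "Yes" is correct, and that the answer "No" costs a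
probability of failure of `1`. -/
theorem exec_structural (hn : 0 < n) (hadj : IsAdjacencyList G adj)
    (hB : IsSPGCInstance G d l L R) (hx : Γ.x = encodeSPGC k d l adj L R)
    (hxI : Γ.x.length + 16 < Γ.I) (hlI : l * n + l + n + 16 < Γ.I)
    (hBI : k * (d + 1) + d + 16 < Γ.I) (hEI : k * (k + 1) + l * k + l + 16 < Γ.I)
    {p : ℝ} (hp : 1 / 3 ≤ p) (hno : ¬ HasPartialGrundyColoring G k → 1 ≤ p) :
      Exec Γ structural ⟨fun _ => 0, fun _ _ => 0⟩
        (700 * ((k * (d + 1)) ^ (2 * k ^ 2 + k) * 2 ^ (l * k) * (givenInst k d adj L R).size) + 10) p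
        fun s' p' => (s'.var 0 ≠ 0 ∧ HasPartialGrundyColoring G k ∧ 0 ≤ p') ∨
          (s'.var 0 = 0 ∧ 1 ≤ p') := by
  set X := givenInst k d adj L R with hXdef
  set M := (k * (d + 1)) ^ (2 * k ^ 2 + k) * 2 ^ (l * k) * X.size with hM
  have hxe := hx
  rw [encodeSPGC_eq] at hxe
  have hlen4 : 4 ≤ Γ.x.length := by rw [hxe]; simp
  have hinp : ∀ i < 4, Γ.x.getD i 0 = [n, k, d, l].getD i 0 := by
    intro i hi
    rw [hxe, List.append_assoc, List.getD_append _ _ _ _ (by simpa using hi)]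
  have i0 : Γ.x.getD 0 0 = n := by rw [hinp 0 (by omega)]; rfl
  have i1 : Γ.x.getD 1 0 = k := by rw [hinp 1 (by omega)]; rfl
  have i2 : Γ.x.getD 2 0 = d := by rw [hinp 2 (by omega)]; rfl
  have i3 : Γ.x.getD 3 0 = l := by rw [hinp 3 (by omega)]; rfl
  -- the first two commands
  have hstart : ∀ {c : HCmd} {t : ℕ} {p : ℝ} {Q : St → ℝ → Prop},
      Exec Γ c (((⟨fun _ => 0, fun _ _ => 0⟩ : St).setVar 1 n).setVar 2 k) t p Q →
      Exec Γ (.assign 1 (.inp (.lit 0)) ;; .assign 2 (.inp (.lit 1)) ;; c)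
        ⟨fun _ => 0, fun _ _ => 0⟩ (t + 4) p Q := by
    intro c t p Q h
    refine Exec.wp_seq (t := t + 2) ?_ (by simp only [HCmd.cost]; omega)
    simp only [HCmd.wp, ok_inp, ok_lit, eval_inp, eval_lit, i0]
    refine ⟨⟨by omega, by omega⟩, ?_⟩
    refine Exec.wp_seq (t := t) ?_ (by simp only [HCmd.cost]; omega)
    simp only [HCmd.wp, ok_inp, ok_lit, eval_inp, eval_lit, i1]
    exact ⟨⟨by omega, by omega⟩, h⟩
  by_cases hk : k < 2
  · have hyes := hasPartialGrundyColoring_of_lt_two G hn hk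
    refine .conseq (hstart (.cond (t := 1) (by simp) ?_)) (by omega) le_rfl fun _ _ h => h
    rw [if_pos (by simp [hk])]
    exact .assign (by simp) (.inl ⟨by simp, hyes, by linarith⟩)
  by_cases hkn : n < k
  · have hno' : ¬ HasPartialGrundyColoring G k := fun h => by have := h.le_card; omega
    refine .conseq (hstart (.cond (t := 2) (by simp) ?_)) (by omega) le_rfl fun _ _ h => h
    rw [if_neg (by simp [hk])]
    refine .cond (by simp) ?_
    rw [if_pos (by simp [hkn])]
    exact .skip (.inr ⟨by simp, hno hno'⟩)
  have hgraph : X.Graph Γ := Inst.graph_of_encode (X := X) hadj hxe rfl rfl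
    (fun v => by simp [hXdef, givenInst]) hxI
  have hX : X.Wf Γ :=
    { hgraph with
      two_le := by change 2 ≤ k; omega
      k_le := by change k ≤ n; omega
      side_le := by intro j v; simp only [hXdef, givenInst]; split_ifs <;> omega
      l_lt := hlI
      B_lt := hBI
      E_lt := hEI }
  have hlists : ∀ y < 2 * l, (sideLists L R y).length ≤ n ∧ ∀ u ∈ sideLists L R y, u < n := by
    have haux : ∀ (S : Fin l → List (Fin n)), (∀ i, (S i).Nodup) → ∀ j,
        (toNat S j).length ≤ n ∧ ∀ u ∈ toNat S j, u < n := by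
      intro S hS j
      refine ⟨?_, fun u hu => (mem_toNat hu).2.1⟩
      rw [toNat]
      split_ifs with h
      · simpa using (hS ⟨j, h⟩).length_le_card
      · simp
    intro y _
    rw [sideLists]
    split_ifs
    · exact haux L (fun i => (hB.1 i).1) _
    · exact haux R (fun i => (hB.1 i).2.1) _
  have hpos : ∀ y < 2 * l, ListAt Γ
      (X.hd n + ∑ z ∈ Finset.range y, ((sideLists L R z).length + 1)) (sideLists L R y) := by
    intro y hy
    have := listAt_flatMap (pre := [n, k, d, l] ++ encodeAdjacency adj) (post := [])
      (S := sideLists L R) (n := 2 * l) (by rw [hxe, List.append_nil]) hy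
    rwa [List.length_append, encodeAdjacency_eq, length_flatMap_range] at this
  have hsize : X.searchTime ≤ 600 * M := X.searchTime_le (by change 2 ≤ k; omega) (by change k ≤ n; omega)
  have hk0 : 0 < k := by omega
  have hnM : X.size ≤ M := Nat.le_mul_of_pos_left _ (by positivity)
  have hlM : l * n ≤ M := by
    refine Nat.mul_le_mul ?_ X.n_le_size
    calc l ≤ l * k := Nat.le_mul_of_pos_right _ (by omega)
      _ ≤ 2 ^ (l * k) := Nat.lt_two_pow_self.le
      _ ≤ _ := Nat.le_mul_of_pos_left _ (by positivity)
  have hlM' : l ≤ l * n := Nat.le_mul_of_pos_right _ hn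
  have hnM' : n ≤ X.size := X.n_le_size
  refine .conseq (hstart (.cond (t := 7 * n + l * (10 * n + 21) + X.searchTime + 23)
    (by simp) ?_)) ?_ le_rfl fun _ _ h => h
  swap
  · have : l * (10 * n + 21) = 10 * (l * n) + 21 * l := by ring
    omega
  rw [if_neg (by simp [hk])]
  refine .conseq (.cond (t := 7 * n + l * (10 * n + 21) + X.searchTime + 20) (by simp) ?_)
    (by omega) le_rfl fun _ _ h => h
  rw [if_neg (by simp [hkn])]
  refine Exec.wp_seq (t := 7 * n + l * (10 * n + 21) + X.searchTime + 12) ?_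
    (by simp only [HCmd.cost]; omega)
  simp only [HCmd.wp, ok_inp, ok_lit, eval_inp, eval_lit, i2, i3, ok_mul, ok_var, ok_add, eval_mul,
    eval_var, eval_add, St.setVar_var, ↓reduceIte, Nat.reduceEqDiff]
  have hkB : d + 1 ≤ k * (d + 1) := Nat.le_mul_of_pos_left _ (by omega)
  refine ⟨⟨by omega, by omega⟩, ⟨by omega, by omega⟩,
    ⟨trivial, ⟨trivial, by omega, by omega⟩, by omega⟩, by omega, ?_⟩
  refine Exec.seq' (t := 7 * n + 4) (t' := l * (10 * n + 21) + 4 + X.searchTime + 1)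
    (det_readGraph hgraph (by rfl) (p := 4) (by rfl) (fun v => rfl) le_rfl p) ?_ (by omega)
  rintro s₁ _ hf₁ ⟨rfl, h6, h0⟩
  refine Exec.seq' (t := l * (10 * n + 21) + 4) (t' := X.searchTime)
    (det_readSides (l := l) (n := n) (p := X.hd n) (S := sideLists L R)
      (by simp [hf₁.var 1 (by decide)]) (by simp [hf₁.var 4 (by decide)]) h6 hxI hlI hpos hlists
      (fun j _ u hu => ?_) (by simp [hf₁.arr 1 (by decide)]) _) ?_ (by omega)
  · rw [sideLists_even] at hu
    rw [sideLists_odd]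
    exact disjoint_toNat hB hu
  rintro s₂ _ hf₂ ⟨rfl, hside⟩
  refine .conseq (exec_search_models hX (givenInst_models hadj hB) hp hno (s := s₂)
    ⟨⟨?_, ?_, ?_⟩, ?_, ?_, ?_, hside⟩ ?_) le_rfl le_rfl ?_
  · simp [hf₂.var 1 (by decide), hf₁.var 1 (by decide), hXdef, givenInst]
  · simp [hf₂.var 2 (by decide), hf₁.var 2 (by decide), hXdef, givenInst]
  · rw [hf₂.arr 0 (by decide)]; exact h0
  · simp [hf₂.var 3 (by decide), hf₁.var 3 (by decide), hXdef, givenInst]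
  · simp [hf₂.var 4 (by decide), hf₁.var 4 (by decide), hXdef, givenInst]
  · simp [hf₂.var 5 (by decide), hf₁.var 5 (by decide), hXdef, givenInst]
  · simp [hf₂.var 0 (by decide), hf₁.var 0 (by decide)]
  · rintro s' p' (⟨h0, hres, hp0⟩ | h)
    · refine .inl ⟨h0, hres.resolve_right (givenInst_not_dense hadj hB), hp0⟩
    · exact .inr h

end

/-! ### Word length -/

theorem eval_const_of_lt {w a : ℕ} {S : WordRAM.State} (h : a < 2 ^ w) :
    (WordRAM.Expr.const a).eval w S = a := Nat.mod_eq_of_lt h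

theorem eval_add_of_lt {w a b : ℕ} {e f : WordRAM.Expr} {S : WordRAM.State} (he : e.eval w S = a)
    (hf : f.eval w S = b) (h : a + b < 2 ^ w) : (WordRAM.Expr.bin .add e f).eval w S = a + b := by
  simp only [WordRAM.Expr.eval, he, hf, WordRAM.Op.apply]; exact Nat.mod_eq_of_lt h

theorem eval_mul_of_lt {w a b : ℕ} {e f : WordRAM.Expr} {S : WordRAM.State} (he : e.eval w S = a)
    (hf : f.eval w S = b) (h : a * b < 2 ^ w) : (WordRAM.Expr.bin .mul e f).eval w S = a * b := by
  simp only [WordRAM.Expr.eval, he, hf, WordRAM.Op.apply]; exact Nat.mod_eq_of_lt h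

theorem eval_load_const {w a : ℕ} {r : ℕ → ℕ} {x : List ℕ} (h : a < 2 ^ w) :
    (WordRAM.Expr.load (.const a)).eval w ⟨r, fun i => x.getD i 0⟩ = x.getD a 0 := by
  simp only [WordRAM.Expr.eval, Nat.mod_eq_of_lt h]

theorem getD_lt_of_sum_lt {x : List ℕ} {I : ℕ} (h : x.sum < I) (i : ℕ) : x.getD i 0 < I := by
  rcases Nat.lt_or_ge i x.length with hi | hi
  · rw [List.getD_eq_getElem _ _ hi]
    exact lt_of_le_of_lt (List.le_sum_of_mem (List.getElem_mem hi)) h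
  · rw [List.getD_eq_default _ _ hi]; omega

/-- A bound for the probability of failure that is suitable for yes- and for no-instances. -/
theorem exists_failure_bound (yes : Prop) :
    ∃ p : ℝ, 1 / 3 ≤ p ∧ (¬ yes → 1 ≤ p) ∧ (yes → p ≤ 1 / 3) := by
  by_cases h : yes
  · exact ⟨1 / 3, le_rfl, fun h' => absurd h h', fun _ => le_rfl⟩
  · exact ⟨1, by norm_num, fun _ => le_rfl, fun h' => absurd h' h⟩

/-- The algorithm for Structural Partial Grundy Coloring, for all sufficiently large words. -/
theorem structural_spec : ∃ (P : WordRAM.Cmd) (c C : ℕ),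
    ∀ (n k d l : ℕ) (G : SimpleGraph (Fin n)) (adj : Fin n → List (Fin n))
      (L R : Fin l → List (Fin n)),
      0 < n → 0 < k → IsAdjacencyList G adj → IsSPGCInstance G d l L R →
      ∀ w : ℕ, WordRAM.Admissible c w (encodeSPGC k d l adj L R) →
        WordRAM.DecidesOneSided P w
          (C * ((k * (d + 1)) ^ (2 * k ^ 2 + k) * 2 ^ (l * k) * (G.edgeSet.ncard + n)))
          (encodeSPGC k d l adj L R) (HasPartialGrundyColoring G k) := by
  -- register `1` becomes `(n + 1) * (n + 2 * l) + 4`, which is at least the length of the input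
  refine ⟨.seq (.assign 1 (.bin .add (.bin .mul (.bin .add (.load (.const 0)) (.const 1))
    (.bin .add (.load (.const 0)) (.bin .mul (.const 2) (.load (.const 3))))) (.const 4)))
    structural.compile, 5, 1412, fun n k d l G adj L R hn hk hadj hB w hw => ?_⟩
  set x := encodeSPGC k d l adj L R with hx
  have hxe := encodeSPGC_eq k d l adj L R
  rw [← hx] at hxe
  -- all numbers are bounded by powers of `N`
  set N := x.length + x.sum + 2 with hN
  have hlen : x.length = 4 + ∑ v ∈ Finset.range n, ((toNat adj v).length + 1) +
      ∑ y ∈ Finset.range (2 * l), ((sideLists L R y).length + 1) := by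
    rw [hxe, List.length_append, List.length_append, encodeAdjacency_eq, length_flatMap_range,
      length_flatMap_range]
    rfl
  have hsum : n + k + d + l ≤ x.sum := by
    rw [hxe, List.sum_append, List.sum_append]
    simp only [List.sum_cons, List.sum_nil]
    omega
  have hNl : n + k + d + l + 6 ≤ N := by omega
  have hside : ∀ y, (sideLists L R y).length ≤ n := by
    have haux : ∀ (S : Fin l → List (Fin n)), (∀ i, (S i).Nodup) → ∀ j,
        (toNat S j).length ≤ n := by
      intro S hS j
      rw [toNat]
      split_ifs with h
      · simpa using (hS ⟨j, h⟩).length_le_card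
      · simp
    intro y
    rw [sideLists]
    split_ifs
    · exact haux L (fun i => (hB.1 i).1) _
    · exact haux R (fun i => (hB.1 i).2.1) _
  have hnbr : ∀ v, (toNat adj v).length ≤ n := by
    intro v
    rw [toNat]
    split_ifs with h
    · simpa using (hadj ⟨v, h⟩).1.length_le_card
    · simp
  have hb : x.length ≤ (n + 1) * (n + 2 * l) + 4 := by
    have h1 : ∑ v ∈ Finset.range n, ((toNat adj v).length + 1) ≤ n * (n + 1) := by
      simpa using Finset.sum_le_card_nsmul (Finset.range n) _ (n + 1)
        (fun v _ => Nat.add_le_add_right (hnbr v) 1)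
    have h2 : ∑ y ∈ Finset.range (2 * l), ((sideLists L R y).length + 1) ≤ 2 * l * (n + 1) := by
      simpa using Finset.sum_le_card_nsmul (Finset.range (2 * l)) _ (n + 1)
        (fun v _ => Nat.add_le_add_right (hside v) 1)
    rw [hlen]
    linarith
  have hw' : N ^ 5 ≤ 2 ^ w := hw
  have hN8 : 8 ≤ N := by omega
  have hN2 : 8 * N ≤ N ^ 2 := by nlinarith
  have hN3 : 8 * N ^ 2 ≤ N ^ 3 := by rw [pow_succ N 2, mul_comm]; exact Nat.mul_le_mul_left _ hN8
  have hN4 : 8 * N ^ 3 ≤ N ^ 4 := by rw [pow_succ N 3, mul_comm]; exact Nat.mul_le_mul_left _ hN8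
  have hN5 : 8 * N ^ 4 ≤ N ^ 5 := by rw [pow_succ N 4, mul_comm]; exact Nat.mul_le_mul_left _ hN8
  have hprod : ∀ {a b : ℕ}, a ≤ N → b ≤ N → a * b ≤ N ^ 2 := fun ha hb => by
    rw [pow_two]; exact Nat.mul_le_mul ha hb
  have hbN : (n + 1) * (n + 2 * l) ≤ 2 * N ^ 2 := by
    have := hprod (show n + 1 ≤ N by omega) (show n + l ≤ N by omega)
    have h2 : (n + 1) * (n + 2 * l) ≤ (n + 1) * (2 * (n + l)) := Nat.mul_le_mul_left _ (by omega)
    linarith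
  have hln := hprod (show l ≤ N by omega) (show n ≤ N by omega)
  have hkd := hprod (show k ≤ N by omega) (show d + 1 ≤ N by omega)
  have hkk := hprod (show k ≤ N by omega) (show k + 1 ≤ N by omega)
  have hlk := hprod (show l ≤ N by omega) (show k ≤ N by omega)
  obtain ⟨p, hp, hno, hyes⟩ := exists_failure_bound (HasPartialGrundyColoring G k)
  have hex := exec_structural (Γ := ⟨x, N ^ 3⟩) (k := k) hn hadj hB hx
    (by simp only; omega) (by simp only; omega) (by simp only; omega) (by simp only; omega) hp hno
  have hroom : Room ⟨x, N ^ 3⟩ ((n + 1) * (n + 2 * l) + 4) w :=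
    { len := hb
      entries := getD_lt_of_sum_lt (by simp only; omega)
      small := by simp only; omega
      large := by simp only; omega }
  refine decidesOneSided_of_exec hroom ?_ hex ?_ hyes
  · have e0 : x.getD 0 0 = n := by rw [hxe]; rfl
    have e3 : x.getD 3 0 = l := by rw [hxe]; rfl
    have h2l : 2 * l ≤ (n + 1) * (n + 2 * l) :=
      (Nat.le_add_left _ _).trans (Nat.le_mul_of_pos_left _ (by omega))
    have hn0 := eval_load_const (w := w) (a := 0) (r := fun _ => 0) (x := x) (by omega)
    have hl0 := eval_load_const (w := w) (a := 3) (r := fun _ => 0) (x := x) (by omega)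
    rw [e0] at hn0
    rw [e3] at hl0
    exact eval_add_of_lt (eval_mul_of_lt (eval_add_of_lt hn0 (eval_const_of_lt (by omega)) (by omega))
      (eval_add_of_lt hn0 (eval_mul_of_lt (eval_const_of_lt (by omega)) hl0 (by omega)) (by omega))
      (by omega)) (eval_const_of_lt (by omega)) (by omega)
  · have hsize : (givenInst k d adj L R).size = 2 * G.edgeSet.ncard + n := sum_length_adj hadj
    rw [hsize]
    have hM1 : 0 < (k * (d + 1)) ^ (2 * k ^ 2 + k) * 2 ^ (l * k) := by positivity
    generalize (k * (d + 1)) ^ (2 * k ^ 2 + k) * 2 ^ (l * k) = M at hM1 ⊢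
    have h1 : M * (2 * G.edgeSet.ncard + n) ≤ 2 * (M * (G.edgeSet.ncard + n)) := by
      rw [← mul_assoc, mul_comm 2 M, mul_assoc]
      exact Nat.mul_le_mul_left _ (by omega)
    have h2 : 0 < M * (G.edgeSet.ncard + n) := Nat.mul_pos hM1 (by omega)
    omega

/-! ### Graphs without a partial Grundy coloring are close to unions of bicliques -/

/-- The search could find a partial Grundy coloring. -/
def Inst.Found (X : Inst) : Prop := ∃ C, X.Proper C ∧ X.Full C

/-- Neighbors have different colors. -/
def Inst.Colored (X : Inst) (f : ℕ → ℕ) : Prop := ∀ v < X.n, ∀ u ∈ X.nbr v, f u ≠ f v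

/-- Vertices `a 0, a 1, …` in one color class of `f` get the colors `0, 1, …`, and the vertices of
another class get colors that do not conflict with them. -/
theorem Inst.found_of_classes {X : Inst} (hX : X.Graph Γ) {f g a : ℕ → ℕ} {p q : ℕ}
    (hf : X.Colored f) (hpq : p ≠ q) (ha : ∀ i < X.k, a i < X.n ∧ f (a i) = p)
    (hinj : ∀ i < X.k, ∀ j < X.k, a i = a j → i = j)
    (hg : ∀ j < X.k, ∀ w ∈ X.nbr (a j), f w = q → g w ≠ j)
    (hfull : ∀ i < X.k, ∀ j < i, ∃ w ∈ X.nbr (a i), f w = q ∧ g w = j) : X.Found := by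
  classical
  let C : ℕ → ℕ := fun w =>
    if h : ∃ i < X.k, a i = w then h.choose else if f w = q then g w else X.k
  have hCa : ∀ i < X.k, C (a i) = i := by
    intro i hi
    have h : ∃ i' < X.k, a i' = a i := ⟨i, hi, rfl⟩
    simp only [C, dif_pos h]
    exact hinj _ h.choose_spec.1 _ hi h.choose_spec.2
  -- every colored vertex is some `a i`, or it has color `q` in `f`
  have hcases : ∀ w, C w < X.k → (∃ i < X.k, a i = w ∧ C w = i) ∨ (f w = q ∧ C w = g w) := by
    intro w hw
    by_cases h : ∃ i < X.k, a i = w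
    · obtain ⟨i, hi, rfl⟩ := h
      exact .inl ⟨i, hi, rfl, hCa i hi⟩
    · simp only [C, dif_neg h] at hw ⊢
      split_ifs at hw ⊢ with h'
      · exact .inr ⟨h', rfl⟩
      · omega
  refine ⟨C, fun v hv u hu huv => ?_, fun i hi => ⟨a i, (ha i hi).1, hCa i hi, fun j hj => ?_⟩⟩
  · by_contra hlt
    rcases hcases v (by omega) with ⟨i, hi, rfl, h1⟩ | ⟨h1, h2⟩
    · rcases hcases u (by omega) with ⟨i', hi', rfl, h3⟩ | ⟨h3, h4⟩
      · obtain rfl : i = i' := by omega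
        exact hX.irrefl _ hv hu
      · exact hg i hi u hu h3 (by omega)
    · rcases hcases u (by omega) with ⟨i', hi', rfl, h3⟩ | ⟨h3, h4⟩
      · exact hg i' hi' v (hX.symm _ hv _ hu) h1 (by omega)
      · exact hf v hv u hu (h3.trans h1.symm)
  · obtain ⟨w, hw, hwq, hwj⟩ := hfull i hi j hj
    refine ⟨w, hw, ?_⟩
    have h : ¬ ∃ i < X.k, a i = w := by
      rintro ⟨i', hi', rfl⟩
      exact hpq ((ha i' hi').2.symm.trans hwq)
    simp only [C, dif_neg h, if_pos hwq, hwj]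

/-- A complement of a matching between two color classes. -/
theorem Inst.found_of_comatching {X : Inst} (hX : X.Graph Γ) {f a b : ℕ → ℕ} {p q : ℕ}
    (hf : X.Colored f) (hpq : p ≠ q) (ha : ∀ i < X.k, a i < X.n ∧ f (a i) = p)
    (hb : ∀ i < X.k, f (b i) = q)
    (hab : ∀ i < X.k, ∀ j < X.k, b j ∈ X.nbr (a i) ↔ i ≠ j) : X.Found := by
  classical
  have hbinj : ∀ i < X.k, ∀ j < X.k, b i = b j → i = j := by
    intro i hi j hj h
    by_contra hij
    exact (hab i hi i hi).1 (h ▸ (hab i hi j hj).2 hij) rfl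
  let g : ℕ → ℕ := fun w => if h : ∃ i < X.k, b i = w then h.choose else X.k
  have hgb : ∀ i < X.k, g (b i) = i := by
    intro i hi
    have h : ∃ i' < X.k, b i' = b i := ⟨i, hi, rfl⟩
    simp only [g, dif_pos h]
    exact hbinj _ h.choose_spec.1 _ hi h.choose_spec.2
  refine X.found_of_classes (g := g) hX hf hpq ha (fun i hi j hj h => ?_) (fun j hj w hw hwq h => ?_)
    fun i hi j hj => ⟨b j, (hab i hi j (by omega)).2 (by omega), hb j (by omega), hgb j (by omega)⟩
  · by_contra hij
    exact (hab i hi i hi).1 (h ▸ (hab j hj i hi).2 (Ne.symm hij)) rfl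
  · by_cases hex : ∃ i < X.k, b i = w
    · obtain ⟨i, hi, rfl⟩ := hex
      rw [hgb i hi] at h
      subst h
      exact (hab i hi i hi).1 hw rfl
    · simp only [g, dif_neg hex] at h
      omega

/-- The number of vertices of color `q` that are adjacent to exactly one of `a` and `c`. -/
def Inst.dist (X : Inst) (f : ℕ → ℕ) (q a c : ℕ) : ℕ :=
  ((Finset.range X.n).filter fun u => f u = q ∧ ¬ (u ∈ X.nbr a ↔ u ∈ X.nbr c)).card

/-- The neighbors of `v` of color `q`. -/
def Inst.nbrs (X : Inst) (f : ℕ → ℕ) (q v : ℕ) : Finset ℕ :=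
  (Finset.range X.n).filter fun u => f u = q ∧ u ∈ X.nbr v

theorem Inst.dist_eq (X : Inst) (f : ℕ → ℕ) (q a c : ℕ) :
    X.dist f q a c = (X.nbrs f q a \ X.nbrs f q c).card + (X.nbrs f q c \ X.nbrs f q a).card := by
  rw [← Finset.card_union_of_disjoint disjoint_sdiff_sdiff, Inst.dist]
  refine congrArg Finset.card (Finset.ext fun u => ?_)
  simp only [Inst.nbrs, Finset.mem_filter, Finset.mem_union, Finset.mem_sdiff]
  tauto

/-- Many vertices of one color whose neighborhoods in the color class `q` differ a lot. They get
different colors, ordered by the sizes of these neighborhoods; then for `j < i` the `i`-th one has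
many neighbors that are not adjacent to the `j`-th one, and one of these gets the color `j`. -/
theorem Inst.found_of_far {X : Inst} (hX : X.Graph Γ) {f : ℕ → ℕ} {p q : ℕ} (hf : X.Colored f)
    (hk : 2 ≤ X.k) (Z : Finset ℕ) (hZ : X.k ≤ Z.card) (hZp : ∀ c ∈ Z, c < X.n ∧ f c = p)
    (hfar : ∀ c ∈ Z, ∀ c' ∈ Z, c ≠ c' → 2 * X.k ^ 2 ≤ X.dist f q c c') : X.Found := by
  classical
  have hpq : p ≠ q := by
    rintro rfl
    obtain ⟨c, hc, c', hc', hne⟩ := Finset.one_lt_card.1 (by omega : 1 < Z.card)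
    have h := hfar c hc c' hc' hne
    have h0 : ∀ c ∈ Z, X.nbrs f p c = ∅ := by
      intro c hc
      refine Finset.filter_eq_empty_iff.2 fun u _ h => ?_
      exact hf c (hZp c hc).1 u h.2 (h.1.trans (hZp c hc).2.symm)
    rw [X.dist_eq, h0 c hc, h0 c' hc'] at h
    simp at h
    omega
  -- enumerate `Z` by increasing numbers of neighbors
  let e := Z.equivFin.symm
  let h : Fin Z.card → ℕ := fun i => (X.nbrs f q (e i)).card
  let z : Fin Z.card → ℕ := fun i => e (Tuple.sort h i)
  have hzZ : ∀ i, z i ∈ Z := fun i => (e (Tuple.sort h i)).2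
  have hzinj : ∀ i j, z i = z j → i = j := fun i j hij =>
    (Tuple.sort h).injective (e.injective (Subtype.ext hij))
  have hmono : ∀ i j, i ≤ j → (X.nbrs f q (z i)).card ≤ (X.nbrs f q (z j)).card :=
    fun i j hij => Tuple.monotone_sort h hij
  let a : ℕ → ℕ := fun i => if hi : i < Z.card then z ⟨i, hi⟩ else 0
  have ha : ∀ i (hi : i < Z.card), a i = z ⟨i, hi⟩ := fun i hi => dif_pos hi
  -- the vertices that can give `a i` a neighbor of color `j`, for `x = (i, j)` with `j < i`; the
  -- value for other pairs only has to be large enough for Hall's condition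
  let t : Fin X.k × Fin X.k → Finset ℕ := fun x => if x.2 < x.1 then
    X.nbrs f q (a x.1) \ X.nbrs f q (a x.2) else Finset.range (X.k ^ 2)
  have ht : ∀ x, X.k ^ 2 ≤ (t x).card := by
    intro x
    simp only [t]
    split_ifs with hlt
    · have h1 : a x.1 = z ⟨x.1, by omega⟩ := ha _ _
      have h2 : a x.2 = z ⟨x.2, by omega⟩ := ha _ _
      have h3 := hfar _ (hzZ ⟨x.1, by omega⟩) _ (hzZ ⟨x.2, by omega⟩) (fun h => by
        have := Fin.mk.inj_iff.1 (hzinj _ _ h)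
        omega)
      have h4 := hmono ⟨x.2, by omega⟩ ⟨x.1, by omega⟩ (by simpa using hlt.le)
      rw [X.dist_eq, ← h1, ← h2] at h3
      rw [← h1, ← h2] at h4
      have h5 := Finset.card_sdiff_add_card_inter (X.nbrs f q (a x.1)) (X.nbrs f q (a x.2))
      have h6 := Finset.card_sdiff_add_card_inter (X.nbrs f q (a x.2)) (X.nbrs f q (a x.1))
      rw [Finset.inter_comm] at h6
      omega
    · simp
  -- distinct representatives exist by Hall's theorem
  obtain ⟨u, huinj, hu⟩ := (Finset.all_card_le_biUnion_card_iff_exists_injective t).1 (by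
    intro S
    rcases S.eq_empty_or_nonempty with rfl | ⟨x, hx⟩
    · simp
    · calc S.card ≤ Fintype.card (Fin X.k × Fin X.k) := Finset.card_le_univ S
        _ = X.k ^ 2 := by simp [pow_two]
        _ ≤ (t x).card := ht x
        _ ≤ _ := Finset.card_le_card (Finset.subset_biUnion_of_mem t hx))
  have hu' : ∀ x : Fin X.k × Fin X.k, x.2 < x.1 →
      u x ∈ X.nbrs f q (a x.1) ∧ u x ∉ X.nbrs f q (a x.2) := by
    intro x hx
    have := hu x
    simp only [t, if_pos hx] at this
    exact Finset.mem_sdiff.1 this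
  let g : ℕ → ℕ := fun w => if h : ∃ x : Fin X.k × Fin X.k, x.2 < x.1 ∧ u x = w then
    (h.choose.2 : ℕ) else X.k
  have hgu : ∀ x : Fin X.k × Fin X.k, x.2 < x.1 → g (u x) = x.2 := by
    intro x hx
    have h : ∃ y : Fin X.k × Fin X.k, y.2 < y.1 ∧ u y = u x := ⟨x, hx, rfl⟩
    simp only [g, dif_pos h]
    rw [huinj h.choose_spec.2]
  refine X.found_of_classes (g := g) (a := a) hX hf hpq (fun i hi => ?_) (fun i hi j hj hij => ?_)
    (fun j hj w hw hwq hgw => ?_) fun i hi j hj => ?_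
  · rw [ha i (by omega)]
    exact hZp _ (hzZ _)
  · rw [ha i (by omega), ha j (by omega)] at hij
    exact Fin.mk.inj_iff.1 (hzinj _ _ hij)
  · by_cases hex : ∃ x : Fin X.k × Fin X.k, x.2 < x.1 ∧ u x = w
    · obtain ⟨x, hx, rfl⟩ := hex
      rw [hgu x hx] at hgw
      subst hgw
      refine (hu' x hx).2 (Finset.mem_filter.2 ⟨Finset.mem_range.2 ?_, hwq, hw⟩)
      exact Finset.mem_range.1 (Finset.mem_filter.1 (hu' x hx).1).1
    · simp only [g, dif_neg hex] at hgw
      omega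
  · have hx : (⟨⟨i, hi⟩, ⟨j, by omega⟩⟩ : Fin X.k × Fin X.k).2 <
      (⟨⟨i, hi⟩, ⟨j, by omega⟩⟩ : Fin X.k × Fin X.k).1 := hj
    have h1 := (Finset.mem_filter.1 (hu' _ hx).1).2
    exact ⟨_, h1.2, h1.1, hgu _ hx⟩

/-- If the vertices in `L` have almost the same neighbors of color `q` as `c`, then only few of the
neighbors of `c` are not adjacent to all of `L`: in a minimal subset of `L` that misses all of these
neighbors, each vertex misses one that the others do not miss. -/
theorem Inst.card_exceptional_le {X : Inst} (hX : X.Graph Γ) {f : ℕ → ℕ} {p q D c : ℕ}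
    (hf : X.Colored f) (hpq : p ≠ q) (hno : ¬ X.Found) (L : Finset ℕ)
    (hL : ∀ a ∈ L, a < X.n ∧ f a = p) (hD : ∀ a ∈ L, (X.nbrs f q c \ X.nbrs f q a).card ≤ D) :
    ((X.nbrs f q c).filter fun b => ∃ a ∈ L, b ∉ X.nbr a).card ≤ (X.k - 1) * D := by
  classical
  set E := (X.nbrs f q c).filter fun b => ∃ a ∈ L, b ∉ X.nbr a with hE
  let P : Finset ℕ → Prop := fun Y => ∀ b ∈ E, ∃ a ∈ Y, b ∉ X.nbr a
  obtain ⟨Y, hY, hmin⟩ := Finset.exists_min_image (L.powerset.filter P) Finset.card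
    ⟨L, Finset.mem_filter.2 ⟨Finset.mem_powerset.2 (Finset.Subset.refl L), fun b hb =>
      (Finset.mem_filter.1 hb).2⟩⟩
  obtain ⟨hYL, hYE⟩ := Finset.mem_filter.1 hY
  have hYL := Finset.mem_powerset.1 hYL
  have hEq : ∀ b ∈ E, b < X.n ∧ f b = q := fun b hb => by
    have := Finset.mem_filter.1 (Finset.mem_filter.1 hb).1
    exact ⟨Finset.mem_range.1 this.1, this.2.1⟩
  have hcov : E ⊆ Y.biUnion fun a => X.nbrs f q c \ X.nbrs f q a := by
    intro b hb
    obtain ⟨a, ha, hba⟩ := hYE b hb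
    exact Finset.mem_biUnion.2 ⟨a, ha, Finset.mem_sdiff.2 ⟨(Finset.mem_filter.1 hb).1, fun h =>
      hba (Finset.mem_filter.1 h).2.2⟩⟩
  have hle : E.card ≤ Y.card * D := (Finset.card_le_card hcov).trans
    (Finset.card_biUnion_le_card_mul _ _ _ fun a ha => hD a (hYL ha))
  refine hle.trans (Nat.mul_le_mul_right _ ?_)
  by_contra hlt
  refine hno ?_
  -- by minimality, each `a ∈ Y` is the only vertex of `Y` that misses a certain `b`
  have hpriv : ∀ a, ∃ b, a ∈ Y → f b = q ∧ b ∉ X.nbr a ∧ ∀ a' ∈ Y, a' ≠ a → b ∈ X.nbr a' := by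
    intro a
    by_cases ha : a ∈ Y
    · have hlt := Finset.card_erase_lt_of_mem ha
      have hnot : ¬ P (Y.erase a) := fun h => by
        have := hmin (Y.erase a) (Finset.mem_filter.2 ⟨Finset.mem_powerset.2
          ((Finset.erase_subset _ _).trans hYL), h⟩)
        omega
      simp only [P, not_forall, not_exists, not_and, not_not] at hnot
      obtain ⟨b, hb, hball⟩ := hnot
      obtain ⟨a', ha', hba'⟩ := hYE b hb
      have haa : a' = a := by
        by_contra hne
        exact hba' (hball a' (Finset.mem_erase.2 ⟨hne, ha'⟩))
      exact ⟨b, fun _ => ⟨(hEq b hb).2, haa ▸ hba', fun a'' ha'' hne =>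
        hball a'' (Finset.mem_erase.2 ⟨hne, ha''⟩)⟩⟩
    · exact ⟨0, fun h => absurd h ha⟩
  choose b hb using hpriv
  let e := Y.equivFin.symm
  let a : ℕ → ℕ := fun i => if hi : i < Y.card then e ⟨i, hi⟩ else 0
  have ha : ∀ i (hi : i < Y.card), a i = e ⟨i, hi⟩ := fun i hi => dif_pos hi
  have haY : ∀ i < X.k, a i ∈ Y := fun i hi => by
    rw [ha i (by omega)]; exact (e _).2
  refine X.found_of_comatching (a := a) (b := fun i => b (a i)) hX hf hpq
    (fun i hi => hL _ (hYL (haY i hi))) (fun i hi => (hb _ (haY i hi)).1) fun i hi j hj => ?_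
  constructor
  · rintro h rfl
    exact (hb _ (haY i hi)).2.1 h
  · intro hij
    refine (hb _ (haY j hj)).2.2 _ (haY i hi) fun h => hij ?_
    rw [ha i (by omega), ha j (by omega)] at h
    exact Fin.mk.inj_iff.1 (e.injective (Subtype.ext h))

/-- A choice of representatives: each vertex has one of the same color, with almost the same
neighbors of color `q`, while representatives of the same color differ a lot. -/
structure Inst.Represents (X : Inst) (f : ℕ → ℕ) (q : ℕ) (rep : ℕ → ℕ) (m : ℕ) : Prop where
  le : ∀ a < m, rep a ≤ a
  idem : ∀ a < m, rep (rep a) = rep a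
  color : ∀ a < m, f (rep a) = f a
  near : ∀ a < m, X.dist f q a (rep a) < 2 * X.k ^ 2
  far : ∀ a < m, ∀ c < a, rep a = a → rep c = c → f c = f a → 2 * X.k ^ 2 ≤ X.dist f q a c

theorem Inst.dist_comm (X : Inst) (f : ℕ → ℕ) (q a c : ℕ) : X.dist f q a c = X.dist f q c a := by
  rw [X.dist_eq, X.dist_eq, add_comm]

/-- There are fewer than `k` representatives of each color, as these are far from each other. -/
theorem Inst.Represents.card_le {X : Inst} (hX : X.Graph Γ) {f rep : ℕ → ℕ} {q : ℕ}
    (hf : X.Colored f) (hk : 2 ≤ X.k) (hcol : ∀ v < X.n, f v < X.k) (hno : ¬ X.Found)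
    (h : X.Represents f q rep X.n) :
    ((Finset.range X.n).filter fun c => rep c = c).card ≤ X.k ^ 2 := by
  classical
  rw [pow_two]
  refine (Finset.card_le_mul_card_image_of_maps_to (f := f) (t := Finset.range X.k) (n := X.k)
    (fun c hc => ?_) fun p _ => ?_).trans (by simp)
  · exact Finset.mem_range.2 (hcol c (Finset.mem_range.1 (Finset.mem_filter.1 hc).1))
  · by_contra hlt
    refine hno (X.found_of_far (p := p) (q := q) hX hf hk
      (((Finset.range X.n).filter fun c => rep c = c).filter fun c => f c = p) (by omega)
      (fun c hc => ?_) fun c hc c' hc' hne => ?_)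
    · simp only [Finset.mem_filter, Finset.mem_range] at hc
      exact ⟨hc.1.1, hc.2⟩
    · simp only [Finset.mem_filter, Finset.mem_range] at hc hc'
      rcases Nat.lt_or_gt_of_ne hne with hlt | hlt
      · rw [X.dist_comm]
        exact h.far c' hc'.1.1 c hlt hc'.1.2 hc.1.2 (hc.2.trans hc'.2.symm)
      · exact h.far c hc.1.1 c' hlt hc.1.2 hc'.1.2 (hc'.2.trans hc.2.symm)

open Classical in
/-- The biclique of the representative `c`: on one side the vertices represented by `c`, on the
other side their common neighbors of color `q`. -/
noncomputable def Inst.row (X : Inst) (f : ℕ → ℕ) (q : ℕ) (rep : ℕ → ℕ) (c v : ℕ) : ℕ :=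
  if rep v = c then 1 else if f v = q ∧ ∀ a < X.n, rep a = c → a ∈ X.nbr v then 2 else 0

/-- Deleting the bicliques of all representatives leaves a graph of small maximum degree. -/
theorem Inst.card_keep_le {X : Inst} (hX : X.Graph Γ) {f : ℕ → ℕ} (hf : X.Colored f)
    (hk : 2 ≤ X.k) (hno : ¬ X.Found) (hcol : ∀ v < X.n, 0 < f v ∧ f v < X.k)
    (hrow : ∀ q < X.k - 1, ∃ rep, X.Represents f (q + 1) rep X.n ∧ ∀ c < X.n, rep c = c →
      ∃ j < X.l, ∀ v < X.n, X.side j v = X.row f (q + 1) rep c v) {v : ℕ} (hv : v < X.n) :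
    (X.keep v).card ≤ 2 * X.k ^ 4 := by
  classical
  have hsub : X.keep v ⊆ (Finset.range (X.k - 1)).biUnion fun q =>
      (X.keep v).filter fun u => f u = q + 1 := by
    intro u hu
    have hun := hX.lt v hv u (Inst.mem_keep.1 hu).1
    have := hcol u hun
    refine Finset.mem_biUnion.2 ⟨f u - 1, Finset.mem_range.2 (by omega), ?_⟩
    exact Finset.mem_filter.2 ⟨hu, by omega⟩
  have hq : ∀ q ∈ Finset.range (X.k - 1), ((X.keep v).filter fun u => f u = q + 1).card ≤
      X.k * (2 * X.k ^ 2) := by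
    intro q hq
    have hq := Finset.mem_range.1 hq
    by_cases hpq : f v = q + 1
    · have : ((X.keep v).filter fun u => f u = q + 1) = ∅ :=
        Finset.filter_eq_empty_iff.2 fun u hu h =>
          hf v hv u (Inst.mem_keep.1 hu).1 (h.trans hpq.symm)
      rw [this]; simp
    obtain ⟨rep, hrep, hrows⟩ := hrow q hq
    have hle := hrep.le v hv
    obtain ⟨j, hj, hside⟩ := hrows (rep v) (by omega) (hrep.idem v hv)
    set L := (Finset.range X.n).filter fun a => rep a = rep v with hL
    set E := (X.nbrs f (q + 1) (rep v)).filter fun b => ∃ a ∈ L, b ∉ X.nbr a with hE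
    have hEcard : E.card ≤ (X.k - 1) * (2 * X.k ^ 2) := by
      refine X.card_exceptional_le (p := f v) hX hf hpq hno L (fun a ha => ?_) fun a ha => ?_
      · obtain ⟨ha, hav⟩ := Finset.mem_filter.1 ha
        have ha := Finset.mem_range.1 ha
        exact ⟨ha, by rw [← hrep.color a ha, hav, hrep.color v hv]⟩
      · obtain ⟨ha, hav⟩ := Finset.mem_filter.1 ha
        have h1 := hrep.near a (Finset.mem_range.1 ha)
        rw [hav, X.dist_eq] at h1
        omega
    have hNcard : (X.nbrs f (q + 1) v \ X.nbrs f (q + 1) (rep v)).card ≤ 2 * X.k ^ 2 := by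
      have h1 := hrep.near v hv
      rw [X.dist_eq] at h1
      omega
    -- an edge to a neighbor of the representative that is adjacent to the whole class belongs to the
    -- biclique of the representative
    have hsub' : ((X.keep v).filter fun u => f u = q + 1) ⊆
        (X.nbrs f (q + 1) v \ X.nbrs f (q + 1) (rep v)) ∪ E := by
      intro u hu
      obtain ⟨hu, huq⟩ := Finset.mem_filter.1 hu
      obtain ⟨hu, hcut⟩ := Inst.mem_keep.1 hu
      have hun := hX.lt v hv u hu
      by_cases huc : u ∈ X.nbr (rep v)
      · refine Finset.mem_union_right _ (Finset.mem_filter.2 ⟨Finset.mem_filter.2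
          ⟨Finset.mem_range.2 hun, huq, huc⟩, ?_⟩)
        by_contra hall
        push Not at hall
        refine hcut ⟨j, hj, ?_⟩
        have hru : rep u ≠ rep v := fun h => hpq (by
          rw [← hrep.color v hv, ← h, hrep.color u hun, huq])
        rw [hside v hv, hside u hun, Inst.row, Inst.row, if_pos rfl, if_neg hru, if_pos]
        exact ⟨huq, fun a ha hav => hX.symm a ha u (hall a (Finset.mem_filter.2
          ⟨Finset.mem_range.2 ha, hav⟩))⟩
      · refine Finset.mem_union_left _ (Finset.mem_sdiff.2 ⟨Finset.mem_filter.2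
          ⟨Finset.mem_range.2 hun, huq, hu⟩, fun h => huc (Finset.mem_filter.1 h).2.2⟩)
    calc _ ≤ _ := Finset.card_le_card hsub'
      _ ≤ _ := Finset.card_union_le _ _
      _ ≤ 2 * X.k ^ 2 + (X.k - 1) * (2 * X.k ^ 2) := Nat.add_le_add hNcard hEcard
      _ = (X.k - 1 + 1) * (2 * X.k ^ 2) := by ring
      _ = _ := by rw [show X.k - 1 + 1 = X.k by omega]
  calc (X.keep v).card ≤ _ := Finset.card_le_card hsub
    _ ≤ (Finset.range (X.k - 1)).card * (X.k * (2 * X.k ^ 2)) :=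
        Finset.card_biUnion_le_card_mul _ _ _ hq
    _ ≤ X.k * (X.k * (2 * X.k ^ 2)) := by
        rw [Finset.card_range]; exact Nat.mul_le_mul_right _ (by omega)
    _ = 2 * X.k ^ 4 := by ring

/-- A coloring (where `0` means uncolored) in which each vertex has neighbors of all smaller colors,
and each uncolored vertex has neighbors of all colors. -/
structure Inst.Greedy (X : Inst) (m : ℕ) (f : ℕ → ℕ) : Prop where
  le : ∀ v < X.n, f v ≤ m
  proper : ∀ v < X.n, ∀ u ∈ X.nbr v, f u = f v → f v = 0
  full : ∀ v < X.n, ∀ y < m, f v = 0 ∨ y + 1 < f v → ∃ u ∈ X.nbr v, f u = y + 1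

/-- An uncolored vertex has neighbors of all `k - 1` colors, and serves as the vertex of the last
color. -/
theorem Inst.Greedy.found {X : Inst} (hX : X.Graph Γ) (hk : 2 ≤ X.k) {f : ℕ → ℕ}
    (h : X.Greedy (X.k - 1) f) {v₀ : ℕ} (hv₀ : v₀ < X.n) (h0 : f v₀ = 0) : X.Found := by
  have hcol : ∀ u j, f u = j + 1 → (if u = v₀ then X.k - 1 else if f u = 0 then X.k else f u - 1) = j := by
    intro u j hu
    rw [if_neg (by rintro rfl; omega), if_neg (by omega), hu]; rfl
  refine ⟨fun w => if w = v₀ then X.k - 1 else if f w = 0 then X.k else f w - 1,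
    fun v hv u hu huv => ?_, fun i hi => ?_⟩
  · have h1 := h.proper v hv u hu
    simp only at huv ⊢
    by_cases hv' : v = v₀
    · simp [hv']
    · by_cases hu' : u = v₀
      · simp only [if_neg hv', if_pos hu'] at huv ⊢; omega
      · simp only [if_neg hv', if_neg hu'] at huv ⊢
        have := h.le u (hX.lt v hv u hu)
        split_ifs at huv ⊢ <;> omega
  · rcases Nat.lt_or_ge i (X.k - 1) with hi' | hi'
    · obtain ⟨w, hw, hwi⟩ := h.full v₀ hv₀ i hi' (.inl h0)
      refine ⟨w, hX.lt _ hv₀ w hw, hcol w i hwi, fun j hj => ?_⟩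
      obtain ⟨u, hu, huj⟩ := h.full w (hX.lt _ hv₀ w hw) j (by omega) (.inr (by omega))
      exact ⟨u, hu, hcol u j huj⟩
    · refine ⟨v₀, hv₀, by simp; omega, fun j hj => ?_⟩
      obtain ⟨u, hu, huj⟩ := h.full v₀ hv₀ j (by omega) (.inl h0)
      exact ⟨u, hu, hcol u j huj⟩

/-! ### Computing the bicliques -/

theorem Inst.Graph.length_nbr_le {X : Inst} (hX : X.Graph Γ) {v : ℕ} (hv : v < X.n) :
    (X.nbr v).length ≤ X.n := by
  classical
  rw [← List.toFinset_card_of_nodup (hX.nodup v hv)]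
  simpa using Finset.card_le_card (fun u hu => Finset.mem_range.2
    (hX.lt v hv u (List.mem_toFinset.1 hu)) : (X.nbr v).toFinset ⊆ Finset.range X.n)

/-- Array `5` becomes a greedy coloring with `k - 1` colors: for each color, every uncolored vertex
without a neighbor of this color gets it. -/
def greedyColoring : HCmd :=
  .for 38 20 (.assign 40 (.var 38 + .lit 1) ;; .for 15 1 (.cond (.arr 5 (.var 15)) .skip
    (nbrCount 16 17 15 (.assign 17 ((HExpr.arr 5 (.var 9)).eq (.var 40))) ;;
      .cond (.var 16) .skip (.store 5 (.var 15) (.var 40)))))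

/-- The color class `m + 1` becomes a maximal independent set among the vertices that are not
colored yet. -/
theorem det_greedyColoring {X : Inst} (hX : X.Graph Γ) {s : St} (hs : X.HoldsGraph s)
    (hk : X.k - 1 + 16 < Γ.I) (h20 : s.var 20 = X.k - 1) (h5 : s.arr 5 = fun _ => 0) :
    Det Γ greedyColoring s ((X.k - 1) * (X.n * (13 * X.n + 21) + 10) + 4) fun s' =>
      X.Greedy (X.k - 1) (s'.arr 5) := by
  have hn := hX.n_lt
  refine Det.for (n := X.k - 1) (fun _ => X.n * (13 * X.n + 21) + 6)
    (fun m s' => X.Greedy m (s'.arr 5)) h20 (by omega) (by decide) (by decide) ?_ ?_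
    (fun _ h => h) ?_
  · simp only [St.setVar_arr, h5]
    exact ⟨by simp, by simp, by simp⟩
  · intro x hx s₁ hf₁ hx₁ hg
    have hs₁ := hs.frame hf₁ (by decide) (by decide)
    refine Det.wp_seq (t := X.n * (13 * X.n + 21) + 4) ?_ (by simp only [HCmd.cost]; omega)
    simp only [HCmd.wp, ok_add, ok_var, ok_lit, eval_add, eval_var, eval_lit, hx₁]
    refine ⟨⟨trivial, by omega, by omega⟩, ?_⟩
    refine Det.for (n := X.n) (fun _ => 13 * X.n + 17) (fun j s' =>
      (∀ v < X.n, s'.arr 5 v ≤ x + 1) ∧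
      (∀ v < X.n, ∀ u ∈ X.nbr v, s'.arr 5 u = s'.arr 5 v → s'.arr 5 v = 0) ∧
      (∀ v < X.n, ∀ y < x, s'.arr 5 v = 0 ∨ y + 1 < s'.arr 5 v → ∃ u ∈ X.nbr v, s'.arr 5 u = y + 1) ∧
      ∀ v < X.n, v < j → s'.arr 5 v = 0 → ∃ u ∈ X.nbr v, s'.arr 5 u = x + 1)
      (by simpa using hs₁.n) (by omega) (by decide) (by decide) ?_ ?_ ?_ ?_
    · refine ⟨fun v hv => ?_, hg.proper, hg.full, by simp⟩
      have := hg.le v hv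
      simp only [St.setVar_arr]
      omega
    · rintro j hj s₂ hf₂ hj₂ ⟨h1, h2, h3, h4⟩
      have hs₂ := (hs₁.frame (c := .assign 40 (.lit 0)) ((Frame.refl _ s₁).setVar (by decide) (x + 1))
        (by decide) (by decide)).frame hf₂ (by decide) (by decide)
      have e40 : s₂.var 40 = x + 1 := by rw [hf₂.var 40 (by decide)]; simp
      refine Det.cond (t := 13 * X.n + 16) (by simp) (fun h0 => ?_) (fun h0 => ?_) le_rfl
      · have h0 : s₂.arr 5 j ≠ 0 := by simpa [hj₂] using h0
        refine Det.skip ⟨h1, h2, h3, fun v hv hvj hv0 => h4 v hv ?_ hv0⟩ (by omega)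
        rcases Nat.lt_succ_iff_lt_or_eq.1 hvj with h | rfl
        · exact h
        · exact absurd hv0 h0
      · have h0 : s₂.arr 5 j = 0 := by simpa [hj₂] using h0
        refine Det.seq (t := 13 * X.n + 12) (t' := 3) (det_nbrExists hX 1
          (fun u => s₂.arr 5 u = x + 1) hs₂.hd (v₀ := j) hj₂ hj (by decide) (by decide) (by decide)
          (by decide) (by decide) ?_ ?_) ?_ (by omega)
        · intro u hu s₃ hf₃ hu₃
          have b5 : s₃.arr 5 = s₂.arr 5 := hf₃.arr 5 (by decide)
          have b40 : s₃.var 40 = x + 1 := by rw [hf₃.var 40 (by decide), e40]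
          refine Det.of_wp ?_ le_rfl
          simp [HCmd.wp, hu₃, b5, b40]
        · have := Nat.mul_le_mul_left 13 (hX.length_nbr_le hj)
          omega
        · intro s₃ hf₃ hex
          have b5 : s₃.arr 5 = s₂.arr 5 := hf₃.arr 5 (by decide)
          have b40 : s₃.var 40 = x + 1 := by rw [hf₃.var 40 (by decide), e40]
          have b15 : s₃.var 15 = j := by rw [hf₃.var 15 (by decide), hj₂]
          refine Det.of_wp ?_ (by simp [HCmd.cost])
          simp only [HCmd.wp, ok_var, eval_var, b40, b15, St.setArr_arr_eq, ↓reduceIte,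
            St.setVar_arr, b5, true_and]
          refine ⟨fun hne => ⟨h1, h2, h3, fun v hv hvj hv0 => ?_⟩, fun heq =>
            ⟨by decide, fun v hv => ?_, fun v hv u hu huv => ?_, fun v hv y hy hvy => ?_,
              fun v hv hvj hv0 => ?_⟩⟩
          · rcases Nat.lt_succ_iff_lt_or_eq.1 hvj with h | rfl
            · exact h4 v hv h hv0
            · exact hex.1 hne
          · by_cases hvj : v = j
            · subst hvj; simp
            · rw [Function.update_of_ne hvj]; exact h1 v hv
          · have hno : ∀ w ∈ X.nbr j, s₂.arr 5 w ≠ x + 1 := fun w hw h => hex.2 ⟨w, hw, h⟩ heq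
            by_cases hvj : v = j
            · subst hvj
              have huv' : u ≠ v := by rintro rfl; exact hX.irrefl _ hv hu
              rw [Function.update_self, Function.update_of_ne huv'] at huv
              exact absurd huv (hno u hu)
            · rw [Function.update_of_ne hvj] at huv ⊢
              by_cases huj : u = j
              · subst huj
                rw [Function.update_self] at huv
                exact absurd huv.symm (hno v (hX.symm v hv u hu))
              · rw [Function.update_of_ne huj] at huv
                exact h2 v hv u hu huv
          · have hvy' : s₂.arr 5 v = 0 ∨ y + 1 < s₂.arr 5 v := by
              by_cases hvj : v = j
              · subst hvj; exact .inl h0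
              · rwa [Function.update_of_ne hvj] at hvy
            obtain ⟨u, hu, huy⟩ := h3 v hv y hy hvy'
            refine ⟨u, hu, ?_⟩
            rw [Function.update_of_ne, huy]
            rintro rfl
            omega
          · have hvj' : v ≠ j := by
              rintro rfl
              rw [Function.update_self] at hv0
              omega
            rw [Function.update_of_ne hvj'] at hv0
            obtain ⟨u, hu, hux⟩ := h4 v hv (by omega) hv0
            refine ⟨u, hu, ?_⟩
            rw [Function.update_of_ne, hux]
            rintro rfl
            omega
    · rintro s₂ ⟨h1, h2, h3, h4⟩
      simp only [St.setVar_arr]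
      refine ⟨h1, h2, fun v hv y hy hvy => ?_⟩
      rcases Nat.lt_succ_iff_lt_or_eq.1 hy with hy | rfl
      · exact h3 v hv y hy hvy
      · refine h4 v hv hv (hvy.resolve_right ?_)
        have := h1 v hv
        omega
    · simp only [Finset.sum_const, Finset.card_range, smul_eq_mul]; linarith
  · simp only [Finset.sum_const, Finset.card_range, smul_eq_mul]; linarith

/-- Variable `39` becomes the number of vertices of the color in variable `40` that are adjacent to
exactly one of the vertices in the variables `15` and `24`. -/
def distance : HCmd :=
  .count 39 21 1 17
    (nbrCount 16 30 15 (.assign 30 ((HExpr.var 9).eq (.var 21))) ;;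
      nbrCount 22 30 24 (.assign 30 ((HExpr.var 9).eq (.var 21))) ;;
      .assign 17 ((HExpr.arr 5 (.var 21)).eq (.var 40) *
        (.lit 1 - ((HExpr.var 16).eq (.lit 0)).eq ((HExpr.var 22).eq (.lit 0)))))

/-- The vertices of color `q` that are adjacent to exactly one of `a` and `c` are counted. -/
theorem det_distance {X : Inst} (hX : X.Graph Γ) {s : St} (hs : X.HoldsGraph s) {a c q : ℕ}
    (ha : a < X.n) (hc : c < X.n) (h15 : s.var 15 = a) (h24 : s.var 24 = c) (h40 : s.var 40 = q) :
    Det Γ distance s (X.n * (26 * X.n + 40) + 10) fun s' =>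
      s'.var 39 = X.dist (s.arr 5) q a c := by
  classical
  have hn := hX.n_lt
  refine (Det.count (m := X.n) (fun _ => 26 * X.n + 30)
    (fun u => s.arr 5 u = q ∧ ¬ (u ∈ X.nbr a ↔ u ∈ X.nbr c)) hs.n (by omega) (by decide) (by decide)
    (by decide) (by decide) ?_ ?_)
  · intro u hu s₁ hf₁ hu₁
    have hs₁ := hs.frame hf₁ (by decide) (by decide)
    have e15 : s₁.var 15 = a := by rw [hf₁.var 15 (by decide), h15]
    refine Det.seq (t := 13 * X.n + 12) (t' := 13 * X.n + 12 + 1 + 1) (det_nbrExists hX 1 (fun w => w = u)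
      hs₁.hd e15 ha (by decide) (by decide) (by decide) (by decide) (by decide) ?_ ?_) ?_ (by omega)
    · intro w hw s₂ hf₂ hw₂
      refine Det.of_wp ?_ le_rfl
      simp [HCmd.wp, hw₂, hf₂.var 21 (by decide), hu₁]
    · have := Nat.mul_le_mul_left 13 (hX.length_nbr_le ha)
      omega
    intro s₂ hf₂ hex₂
    have hs₂ := hs₁.frame hf₂ (by decide) (by decide)
    have e24 : s₂.var 24 = c := by rw [hf₂.var 24 (by decide), hf₁.var 24 (by decide), h24]
    refine Det.seq (t := 13 * X.n + 12) (t' := 1) (det_nbrExists hX 1 (fun w => w = u)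
      hs₂.hd e24 hc (by decide) (by decide) (by decide) (by decide) (by decide) ?_ ?_) ?_ (by omega)
    · intro w hw s₃ hf₃ hw₃
      refine Det.of_wp ?_ le_rfl
      simp [HCmd.wp, hw₃, hf₃.var 21 (by decide), hf₂.var 21 (by decide), hu₁]
    · have := Nat.mul_le_mul_left 13 (hX.length_nbr_le hc)
      omega
    intro s₃ hf₃ hex₃
    simp only [exists_eq_right] at hex₂ hex₃
    have e16 : s₃.var 16 = s₂.var 16 := hf₃.var 16 (by decide)
    have e5 : s₃.arr 5 = s.arr 5 := by
      rw [hf₃.arr 5 (by decide), hf₂.arr 5 (by decide), hf₁.arr 5 (by decide)]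
    have e40 : s₃.var 40 = q := by
      rw [hf₃.var 40 (by decide), hf₂.var 40 (by decide), hf₁.var 40 (by decide), h40]
    have e21 : s₃.var 21 = u := by rw [hf₃.var 21 (by decide), hf₂.var 21 (by decide), hu₁]
    have hI : 1 < Γ.I := by omega
    rw [← e16] at hex₂
    refine Det.of_wp ?_ le_rfl
    by_cases hq : s.arr 5 u = q <;> by_cases h1 : s₃.var 16 = 0 <;> by_cases h2 : s₃.var 22 = 0 <;>
      simp [HCmd.wp, e21, e5, e40, hq, h1, h2, ← hex₂, ← hex₃] <;> omega
  · simp only [Finset.sum_const, Finset.card_range, smul_eq_mul]; linarith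

/-- Array `8` becomes a choice of representatives for the color in variable `40`; variable `41`
holds the threshold `2 k ^ 2`. -/
def represent : HCmd :=
  .for 15 1 (.assign 25 (.var 15) ;;
    .for 24 1 (.cond ((HExpr.var 24).lt (.var 15) * ((HExpr.arr 8 (.var 24)).eq (.var 24) *
          (HExpr.arr 5 (.var 24)).eq (.arr 5 (.var 15))))
        (distance ;; .cond ((HExpr.var 39).lt (.var 41)) (.assign 25 (.var 24)) .skip) .skip) ;;
    .store 8 (.var 15) (.var 25))

/-- A vertex is represented by an earlier representative that is close to it, and by itself if there
is none. -/
theorem det_represent {X : Inst} (hX : X.Graph Γ) {s : St} (hs : X.HoldsGraph s) {q : ℕ}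
    (hk : 2 ≤ X.k) (h40 : s.var 40 = q) (h41 : s.var 41 = 2 * X.k ^ 2) :
    Det Γ represent s (X.n * (X.n * (X.n * (26 * X.n + 40) + 20) + 15) + 4) fun s' =>
      X.Represents (s.arr 5) q (s'.arr 8) X.n := by
  have hn := hX.n_lt
  have hk2 : 0 < 2 * X.k ^ 2 := by positivity
  set f := s.arr 5 with hf5
  refine Det.for (n := X.n) (fun _ => X.n * (X.n * (26 * X.n + 40) + 20) + 9)
    (fun m s' => X.Represents f q (s'.arr 8) m) hs.n (by omega) (by decide) (by decide) ?_ ?_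
    (fun _ h => h) ?_
  · exact ⟨by simp, by simp, by simp, by simp, by simp⟩
  · intro m hm s₁ hf₁ hm₁ hrep
    have hs₁ := hs.frame hf₁ (by decide) (by decide)
    set rep := s₁.arr 8 with hrep8
    refine Det.wp_seq (t := X.n * (X.n * (26 * X.n + 40) + 20) + 7) ?_
      (by simp only [HCmd.cost]; omega)
    simp only [HCmd.wp, ok_var, eval_var, hm₁, true_and]
    refine Det.seq (t := X.n * (X.n * (26 * X.n + 40) + 20) + 4) (t' := 1)
      (R := fun s' => (s'.var 25 = m ∧ ∀ c < m, rep c = c → f c = f m →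
          2 * X.k ^ 2 ≤ X.dist f q m c) ∨ (s'.var 25 < m ∧ rep (s'.var 25) = s'.var 25 ∧
          f (s'.var 25) = f m ∧ X.dist f q m (s'.var 25) < 2 * X.k ^ 2)) ?_ ?_ (by omega)
    · refine Det.for (n := X.n) (fun _ => X.n * (26 * X.n + 40) + 16)
        (fun j s' => (s'.var 25 = m ∧ ∀ c < j, c < m → rep c = c → f c = f m →
          2 * X.k ^ 2 ≤ X.dist f q m c) ∨ (s'.var 25 < m ∧ rep (s'.var 25) = s'.var 25 ∧
          f (s'.var 25) = f m ∧ X.dist f q m (s'.var 25) < 2 * X.k ^ 2))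
        (by simpa using hs₁.n) (by omega) (by decide) (by decide) (by simp) ?_ ?_ ?_
      · intro j hj s₂ hf₂ hj₂ hInv
        have hs₂ := (hs₁.frame (c := .assign 25 (.lit 0)) ((Frame.refl _ s₁).setVar (by decide) m)
          (by decide) (by decide)).frame hf₂ (by decide) (by decide)
        have e15 : s₂.var 15 = m := by rw [hf₂.var 15 (by decide)]; simpa using hm₁
        have e8 : s₂.arr 8 = rep := by rw [hf₂.arr 8 (by decide)]; rfl
        have e5 : s₂.arr 5 = f := by
          rw [hf₂.arr 5 (by decide)]; exact hf₁.arr 5 (by decide)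
        have e40 : s₂.var 40 = q := by
          rw [hf₂.var 40 (by decide)]; simp [hf₁.var 40 (by decide), h40]
        have e41 : s₂.var 41 = 2 * X.k ^ 2 := by
          rw [hf₂.var 41 (by decide)]; simp [hf₁.var 41 (by decide), h41]
        have hguard : ((HExpr.var 24).lt (.var 15) * ((HExpr.arr 8 (.var 24)).eq (.var 24) *
            (HExpr.arr 5 (.var 24)).eq (.arr 5 (.var 15)))).eval Γ s₂ ≠ 0 ↔
            j < m ∧ rep j = j ∧ f j = f m := by
          by_cases h1 : j < m <;> by_cases h2 : rep j = j <;> by_cases h3 : f j = f m <;>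
            simp [hj₂, e15, e8, e5, h1, h2, h3]
        refine Det.cond (t := X.n * (26 * X.n + 40) + 15) ?_ (fun hg => ?_) (fun hg => ?_) le_rfl
        · have hI : 1 < Γ.I := by omega
          by_cases h1 : j < m <;> by_cases h2 : rep j = j <;> by_cases h3 : f j = f m <;>
            simp [hj₂, e15, e8, e5, h1, h2, h3] <;> omega
        · obtain ⟨h1, h2, h3⟩ := hguard.1 hg
          refine Det.seq (t' := 4) (det_distance hX hs₂ hm hj e15 hj₂ e40) ?_ (by omega)
          intro s₃ hf₃ h39
          rw [e5] at h39
          have b25 : s₃.var 25 = s₂.var 25 := hf₃.var 25 (by decide)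
          have b41 : s₃.var 41 = 2 * X.k ^ 2 := by rw [hf₃.var 41 (by decide), e41]
          have b24 : s₃.var 24 = j := by rw [hf₃.var 24 (by decide), hj₂]
          refine Det.of_wp ?_ (by simp [HCmd.cost])
          simp only [HCmd.wp, ok_lt, ok_var, eval_lt, eval_var, h39, b41, b24, St.setVar_var,
            Nat.reduceEqDiff, ↓reduceIte, b25, true_and]
          refine ⟨fun h => .inr ⟨h1, h2, h3, indicator_ne_zero.1 h⟩, fun h => ?_⟩
          have h : ¬ X.dist f q m j < 2 * X.k ^ 2 := fun h' => indicator_ne_zero.2 h' h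
          refine hInv.imp (fun h' => ⟨h'.1, fun c hc hcm hcc hcf => ?_⟩) id
          rcases Nat.lt_succ_iff_lt_or_eq.1 hc with hc | rfl
          · exact h'.2 c hc hcm hcc hcf
          · omega
        · refine Det.skip ?_ (by omega)
          simp only [St.setVar_var, Nat.reduceEqDiff, ↓reduceIte]
          refine hInv.imp (fun h' => ⟨h'.1, fun c hc hcm hcc hcf => ?_⟩) id
          rcases Nat.lt_succ_iff_lt_or_eq.1 hc with hc | rfl
          · exact h'.2 c hc hcm hcc hcf
          · exact absurd hg (hguard.2 ⟨hcm, hcc, hcf⟩)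
      · intro s₂ hInv
        exact hInv.imp (fun h => ⟨h.1, fun c hc => h.2 c (by omega) hc⟩) id
      · simp only [Finset.sum_const, Finset.card_range, smul_eq_mul]; linarith
    · intro s₂ hf₂ hr
      have e15 : s₂.var 15 = m := by rw [hf₂.var 15 (by decide)]; simpa using hm₁
      have e8 : s₂.arr 8 = rep := by rw [hf₂.arr 8 (by decide)]; rfl
      refine Det.of_wp ?_ le_rfl
      simp only [HCmd.wp, ok_var, eval_var, e15, St.setArr_arr_eq, ↓reduceIte, St.setVar_arr, e8,
        true_and]
      generalize s₂.var 25 = r at hr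
      have hrm : r ≤ m := by rcases hr with h | h <;> omega
      have hold : ∀ a < m, Function.update rep m r a = rep a := fun a ha =>
        Function.update_of_ne (by omega) _ _
      have hrr : Function.update rep m r r = r := by
        rcases hr with h | h
        · rw [h.1, Function.update_self]
        · rw [hold r h.1, h.2.1]
      refine ⟨by decide, fun a ha => ?_, fun a ha => ?_, fun a ha => ?_, fun a ha => ?_,
        fun a ha c hc haa hcc hcf => ?_⟩
      all_goals rcases Nat.lt_succ_iff_lt_or_eq.1 ha with ha' | rfl
      · rw [hold a ha']; exact hrep.le a ha'
      · rw [Function.update_self]; exact hrm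
      · have := hrep.le a ha'
        rw [hold a ha', hold _ (by omega)]; exact hrep.idem a ha'
      · rw [Function.update_self]; exact hrr
      · rw [hold a ha']; exact hrep.color a ha'
      · rw [Function.update_self]
        rcases hr with h | h
        · rw [h.1]
        · exact h.2.2.1
      · rw [hold a ha']; exact hrep.near a ha'
      · rw [Function.update_self]
        rcases hr with h | h
        · rw [h.1]; simpa [Inst.dist] using hk2
        · exact h.2.2.2
      · rw [hold a ha'] at haa
        rw [hold c (by omega)] at hcc
        exact hrep.far a ha' c hc haa hcc hcf
      · rw [Function.update_self] at haa
        rw [hold c hc] at hcc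
        rcases hr with h | h
        · exact h.2 c hc hcc hcf
        · omega
  · simp only [Finset.sum_const, Finset.card_range, smul_eq_mul]; linarith

/-- Stores the biclique of the representative in variable `24` in the row of array `1` given by
variable `4`. -/
def storeRow : HCmd :=
  .count 26 15 1 17 (.assign 17 ((HExpr.arr 8 (.var 15)).eq (.var 24))) ;;
  .for 15 1 (nbrCount 16 17 15 (.assign 17 ((HExpr.arr 8 (.var 9)).eq (.var 24))) ;;
    .cond ((HExpr.arr 8 (.var 15)).eq (.var 24)) (.store 1 (.var 4 * .var 1 + .var 15) (.lit 1))
      (.cond ((HExpr.arr 5 (.var 15)).eq (.var 40) * (HExpr.var 16).eq (.var 26))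
        (.store 1 (.var 4 * .var 1 + .var 15) (.lit 2))
        (.store 1 (.var 4 * .var 1 + .var 15) (.lit 0))))

/-- Whether all vertices of a set are neighbors of `v` can be decided by counting in the neighbor
list. -/
theorem Inst.countP_eq_card_iff {X : Inst} (hX : X.Graph Γ) {v : ℕ} (hv : v < X.n)
    (P : ℕ → Prop) [DecidablePred P] :
    (X.nbr v).countP P = ((Finset.range X.n).filter P).card ↔ ∀ a < X.n, P a → a ∈ X.nbr v := by
  classical
  have h1 : (X.nbr v).countP P = ((X.nbr v).toFinset.filter P).card := by
    rw [List.countP_eq_length_filter, ← List.toFinset_card_of_nodup ((hX.nodup v hv).filter _)]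
    congr 1
    ext u
    simp
  have hsub : (X.nbr v).toFinset.filter P ⊆ (Finset.range X.n).filter P :=
    Finset.filter_subset_filter _ fun u hu =>
      Finset.mem_range.2 (hX.lt v hv u (List.mem_toFinset.1 hu))
  rw [h1]
  constructor
  · intro h a ha hP
    have := (Finset.eq_of_subset_of_card_le hsub h.ge).symm ▸
      (Finset.mem_filter.2 ⟨Finset.mem_range.2 ha, hP⟩ : a ∈ (Finset.range X.n).filter P)
    exact List.mem_toFinset.1 (Finset.mem_filter.1 this).1
  · intro h
    refine congrArg Finset.card (Finset.Subset.antisymm hsub fun a ha => ?_)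
    obtain ⟨ha, hP⟩ := Finset.mem_filter.1 ha
    exact Finset.mem_filter.2 ⟨List.mem_toFinset.2 (h a (Finset.mem_range.1 ha) hP), hP⟩

/-- The row `l` of the table is filled in, and the rows before it are kept. -/
theorem det_storeRow {X : Inst} (hX : X.Graph Γ) {s : St} (hs : X.HoldsGraph s) {c q l : ℕ}
    (h24 : s.var 24 = c) (h40 : s.var 40 = q) (h4 : s.var 4 = l) (hlI : l * X.n + X.n < Γ.I) :
    Det Γ storeRow s (X.n * (13 * X.n + 40) + 20) fun s' =>
      (∀ v < X.n, s'.arr 1 (l * X.n + v) = X.row (s.arr 5) q (s.arr 8) c v) ∧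
      ∀ i < l * X.n, s'.arr 1 i = s.arr 1 i := by
  classical
  have hn := hX.n_lt
  refine Det.seq (t := X.n * 11 + 10) (t' := X.n * (13 * X.n + 26) + 4)
    (Det.count (m := X.n) (fun _ => 1) (fun a => s.arr 8 a = c) hs.n (by omega) (by decide)
      (by decide) (by decide) (by decide) ?_ ?_) ?_ (by nlinarith)
  · intro a ha s₁ hf₁ ha₁
    refine Det.of_wp ?_ le_rfl
    simp [HCmd.wp, ha₁, hf₁.arr 8 (by decide), hf₁.var 24 (by decide), h24]
  · simp only [Finset.sum_const, Finset.card_range, smul_eq_mul]; omega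
  intro s₁ hf₁ h26
  have hs₁ := hs.frame hf₁ (by decide) (by decide)
  refine Det.for (n := X.n) (fun _ => 13 * X.n + 22) (fun m s' =>
    (∀ v < m, s'.arr 1 (l * X.n + v) = X.row (s.arr 5) q (s.arr 8) c v) ∧
      ∀ i < l * X.n, s'.arr 1 i = s.arr 1 i) hs₁.n (by omega) (by decide) (by decide) ?_ ?_
      (fun _ h => h) ?_
  · simp [hf₁.arr 1 (by decide)]
  · rintro m hm s₂ hf₂ hm₂ ⟨i1, i2⟩
    have hs₂ := hs₁.frame hf₂ (by decide) (by decide)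
    refine Det.seq (t := 13 * X.n + 12) (t' := 5) (det_nbrCount hX 1 (fun a => s.arr 8 a = c)
      hs₂.hd hm₂ hm (by decide) (by decide) (by decide) (by decide) (by decide) ?_ ?_) ?_ (by omega)
    · intro a ha s₃ hf₃ ha₃
      refine Det.of_wp ?_ le_rfl
      simp [HCmd.wp, ha₃, hf₃.arr 8 (by decide), hf₃.var 24 (by decide), hf₂.arr 8 (by decide),
        hf₂.var 24 (by decide), hf₁.arr 8 (by decide), hf₁.var 24 (by decide), h24]
    · have := Nat.mul_le_mul_left 13 (hX.length_nbr_le hm)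
      omega
    intro s₃ hf₃ h16
    have e8 : s₃.arr 8 = s.arr 8 := by
      rw [hf₃.arr 8 (by decide), hf₂.arr 8 (by decide), hf₁.arr 8 (by decide)]
    have e5 : s₃.arr 5 = s.arr 5 := by
      rw [hf₃.arr 5 (by decide), hf₂.arr 5 (by decide), hf₁.arr 5 (by decide)]
    have e1 : s₃.arr 1 = s₂.arr 1 := hf₃.arr 1 (by decide)
    have e24 : s₃.var 24 = c := by
      rw [hf₃.var 24 (by decide), hf₂.var 24 (by decide), hf₁.var 24 (by decide), h24]
    have e40 : s₃.var 40 = q := by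
      rw [hf₃.var 40 (by decide), hf₂.var 40 (by decide), hf₁.var 40 (by decide), h40]
    have e4 : s₃.var 4 = l := by
      rw [hf₃.var 4 (by decide), hf₂.var 4 (by decide), hf₁.var 4 (by decide), h4]
    have e26 : s₃.var 26 = ((Finset.range X.n).filter fun a => s.arr 8 a = c).card := by
      rw [hf₃.var 26 (by decide), hf₂.var 26 (by decide), h26]
    have e15 : s₃.var 15 = m := by rw [hf₃.var 15 (by decide), hm₂]
    have en : s₃.var 1 = X.n := (hs₂.frame hf₃ (by decide) (by decide)).n
    have hall := X.countP_eq_card_iff hX hm (fun a => s.arr 8 a = c)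
    rw [← h16, ← e26] at hall
    have key : ∀ z, z = X.row (s.arr 5) q (s.arr 8) c m → ∀ b : ℕ → ℕ,
        b = Function.update (s₂.arr 1) (l * X.n + m) z →
        (∀ v < m + 1, b (l * X.n + v) = X.row (s.arr 5) q (s.arr 8) c v) ∧
          ∀ i < l * X.n, b i = s.arr 1 i := by
      rintro _ rfl _ rfl
      refine ⟨fun v hv => ?_, fun i hi => ?_⟩
      · rcases Nat.lt_succ_iff_lt_or_eq.1 hv with hv | rfl
        · rw [Function.update_of_ne (by omega)]; exact i1 v hv
        · rw [Function.update_self]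
      · rw [Function.update_of_ne (by omega)]; exact i2 i hi
    have hmul : l * X.n + m < Γ.I := by omega
    have hI : 1 < Γ.I := by omega
    refine Det.of_wp ?_ (by decide)
    simp only [HCmd.wp, ok_eq, ok_arr, ok_var, ok_lit, ok_add, ok_mul, eval_eq, eval_arr, eval_var,
      eval_lit, eval_add, eval_mul, e8, e5, e24, e40, e4, e15, en, St.setVar_arr, St.setArr_arr_eq,
      ↓reduceIte, e1]
    refine ⟨⟨⟨by decide, trivial⟩, trivial⟩, fun h => ⟨by decide,
      ⟨⟨trivial, trivial, by omega⟩, trivial, hmul⟩, by decide, ?_⟩,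
      fun h => ⟨⟨⟨⟨by decide, trivial⟩, trivial⟩, ⟨trivial, trivial⟩, ?_⟩, fun h' => ⟨by decide,
      ⟨⟨trivial, trivial, by omega⟩, trivial, hmul⟩, by decide, ?_⟩, fun h' => ⟨by decide,
      ⟨⟨trivial, trivial, by omega⟩, trivial, hmul⟩, by decide, ?_⟩⟩⟩
    · refine key 1 ?_ _ rfl
      rw [Inst.row, if_pos (indicator_ne_zero.1 h)]
    · by_cases h1 : s.arr 5 m = q <;> by_cases h2 : s₃.var 16 = s₃.var 26 <;> simp [h1, h2] <;> omega
    · refine key 2 ?_ _ rfl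
      rw [Inst.row, if_neg (fun h1 => indicator_ne_zero.2 h1 h), if_pos]
      exact ⟨indicator_ne_zero.1 (left_ne_zero_of_mul h'),
        hall.1 (indicator_ne_zero.1 (right_ne_zero_of_mul h'))⟩
    · refine key 0 ?_ _ rfl
      rw [Inst.row, if_neg (fun h1 => indicator_ne_zero.2 h1 h), if_neg]
      rintro ⟨h1, h2⟩
      exact mul_ne_zero (indicator_ne_zero.2 h1) (indicator_ne_zero.2 (hall.2 h2)) h'
  · simp only [Finset.sum_const, Finset.card_range, smul_eq_mul]; linarith

/-- The state of the table of bicliques (in array `1`, with the number of rows in variable `4`).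
Variable `43` tells that the table got too large; unless a coloring can be found, this does not
happen, there are at most `b` rows, and the rows in `S` are present. -/
structure Inst.Table (X : Inst) (f : ℕ → ℕ) (s : St) (b : ℕ) (S : Set (ℕ → ℕ)) : Prop where
  le : s.var 4 ≤ X.k ^ 3
  rows : ∀ j < s.var 4, ∃ q rep c, ∀ v < X.n, s.arr 1 (j * X.n + v) = X.row f q rep c v
  flag : ¬ X.Found → s.var 43 = 0 ∧ s.var 4 ≤ b ∧
    ∀ σ ∈ S, ∃ j < s.var 4, ∀ v < X.n, s.arr 1 (j * X.n + v) = σ v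

theorem Inst.Table.congr {X : Inst} {f : ℕ → ℕ} {s s' : St} {b b' : ℕ} {S S' : Set (ℕ → ℕ)}
    (h : X.Table f s b S) (h4 : s'.var 4 = s.var 4) (h43 : s'.var 43 = s.var 43)
    (h1 : s'.arr 1 = s.arr 1) (hb : ¬ X.Found → b ≤ b') (hS : S' ⊆ S) : X.Table f s' b' S' where
  le := by rw [h4]; exact h.le
  rows := by rw [h4, h1]; exact h.rows
  flag hno := by
    obtain ⟨e1, e2, e3⟩ := h.flag hno
    have := hb hno
    rw [h4, h43, h1]
    exact ⟨e1, by omega, fun σ hσ => e3 σ (hS hσ)⟩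

/-- Adds the biclique of the representative in variable `24` to the table. -/
def addRow : HCmd :=
  .cond ((HExpr.var 4).lt (.var 42)) (storeRow ;; .assign 4 (.var 4 + .lit 1)) (.assign 43 (.lit 1))

theorem det_addRow {X : Inst} (hX : X.Graph Γ) {s : St} (hs : X.HoldsGraph s) {c q b : ℕ}
    {S : Set (ℕ → ℕ)} {f : ℕ → ℕ} (h24 : s.var 24 = c) (h40 : s.var 40 = q)
    (h42 : s.var 42 = X.k ^ 3) (hkI : X.k ^ 3 * X.n + X.k ^ 3 + X.n + 16 < Γ.I)
    (hf : s.arr 5 = f) (hT : X.Table f s b S) (hb : ¬ X.Found → b < X.k ^ 3) :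
    Det Γ addRow s (X.n * (13 * X.n + 40) + 23) fun s' =>
      X.Table f s' (b + 1) (insert (X.row f q (s.arr 8) c) S) := by
  refine Det.cond (t := X.n * (13 * X.n + 40) + 22) (by simp) (fun h => ?_) (fun h => ?_) le_rfl
  · have hlt : s.var 4 < X.k ^ 3 := by
      rw [eval_lt, eval_var, eval_var, h42] at h
      exact indicator_ne_zero.1 h
    have hidx : s.var 4 * X.n + X.n ≤ X.k ^ 3 * X.n := by
      rw [← Nat.succ_mul]; exact Nat.mul_le_mul_right _ hlt
    refine Det.seq (t' := 1) (det_storeRow hX hs h24 h40 rfl (by omega)) ?_ (by omega)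
    rintro s₁ hf₁ ⟨hnew, hold⟩
    have e4 : s₁.var 4 = s.var 4 := hf₁.var 4 (by decide)
    have e43 : s₁.var 43 = s.var 43 := hf₁.var 43 (by decide)
    rw [hf] at hnew
    have hsame : ∀ j < s.var 4, ∀ v < X.n, s₁.arr 1 (j * X.n + v) = s.arr 1 (j * X.n + v) :=
      fun j hj v hv => hold _ (idx_lt hj hv)
    refine Det.assign (by simp; omega) ?_ le_rfl
    simp only [eval_add, eval_var, eval_lit, e4]
    refine ⟨by simp; omega, fun j hj => ?_, fun hno => ?_⟩
    · simp only [St.setVar_var, ↓reduceIte, St.setVar_arr] at hj ⊢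
      rcases Nat.lt_succ_iff_lt_or_eq.1 hj with hj | rfl
      · obtain ⟨q', rep, c', h'⟩ := hT.rows j hj
        exact ⟨q', rep, c', fun v hv => by rw [hsame j hj v hv, h' v hv]⟩
      · exact ⟨_, _, _, hnew⟩
    · obtain ⟨t1, t2, t3⟩ := hT.flag hno
      simp only [St.setVar_var, ↓reduceIte, St.setVar_arr, Nat.reduceEqDiff, e43]
      refine ⟨t1, by omega, fun σ hσ => ?_⟩
      rcases Set.mem_insert_iff.1 hσ with rfl | hσ
      · exact ⟨_, by omega, hnew⟩
      · obtain ⟨j, hj, h'⟩ := t3 σ hσ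
        exact ⟨j, by omega, fun v hv => by rw [hsame j hj v hv, h' v hv]⟩
  · have hge : ¬ s.var 4 < X.k ^ 3 := fun h' => by simp [h42, h'] at h
    refine Det.assign (by simp) ⟨hT.le, hT.rows, fun hno => ?_⟩ (by omega)
    have h1 := hb hno
    have h2 := (hT.flag hno).2.1
    omega

/-- Adds the bicliques of all representatives, which are the vertices represented by themselves. -/
def addRows : HCmd := .for 24 1 (.cond ((HExpr.arr 8 (.var 24)).eq (.var 24)) addRow .skip)

theorem det_addRows {X : Inst} (hX : X.Graph Γ) {s : St} (hs : X.HoldsGraph s) {q q₀ : ℕ}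
    {S : Set (ℕ → ℕ)} {f : ℕ → ℕ} (h40 : s.var 40 = q) (h42 : s.var 42 = X.k ^ 3)
    (hkI : X.k ^ 3 * X.n + X.k ^ 3 + X.n + 16 < Γ.I) (hf5 : s.arr 5 = f) (hfc : X.Colored f)
    (hk : 2 ≤ X.k) (hcol : ∀ v < X.n, f v < X.k) (hrep : X.Represents f q (s.arr 8) X.n)
    (hq₀ : q₀ < X.k - 1) (hT : X.Table f s (q₀ * X.k ^ 2) S) :
    Det Γ addRows s (X.n * (X.n * (13 * X.n + 40) + 28) + 4) fun s' =>
      X.Table f s' ((q₀ + 1) * X.k ^ 2)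
        (S ∪ {σ | ∃ c < X.n, s.arr 8 c = c ∧ σ = X.row f q (s.arr 8) c}) := by
  classical
  have hn := hX.n_lt
  set rep := s.arr 8 with hrep8
  have hcount : ∀ m ≤ X.n, ¬ X.Found →
      ((Finset.range m).filter fun c => rep c = c).card ≤ X.k ^ 2 := fun m hm hno =>
    (Finset.card_le_card (Finset.filter_subset_filter _ (Finset.range_mono hm))).trans
      (hrep.card_le hX hfc hk hcol hno)
  have hk3 : (q₀ + 1) * X.k ^ 2 < X.k ^ 3 := by
    have h1 : (q₀ + 1) * X.k ^ 2 < X.k * X.k ^ 2 :=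
      Nat.mul_lt_mul_of_pos_right (by omega) (by positivity)
    linarith [pow_succ' X.k 2]
  refine Det.for (n := X.n) (fun _ => X.n * (13 * X.n + 40) + 24) (fun m s' =>
    X.Table f s' (q₀ * X.k ^ 2 + ((Finset.range m).filter fun c => rep c = c).card)
      (S ∪ {σ | ∃ c < m, rep c = c ∧ σ = X.row f q rep c})) hs.n (by omega) (by decide) (by decide)
    ?_ ?_ ?_ ?_
  · refine hT.congr rfl rfl rfl (by simp) ?_
    simp
  · intro m hm s₁ hf₁ hm₁ hT₁
    have hs₁ := hs.frame hf₁ (by decide) (by decide)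
    have e8 : s₁.arr 8 = rep := hf₁.arr 8 (by decide)
    refine Det.cond (t := X.n * (13 * X.n + 40) + 23) (by simp) (fun h => ?_) (fun h => ?_) le_rfl
    · have hfix : rep m = m := by
        rw [eval_eq, eval_arr, eval_var, hm₁, e8] at h
        exact indicator_ne_zero.1 h
      refine (det_addRow hX hs₁ hm₁ (by rw [hf₁.var 40 (by decide), h40])
        (by rw [hf₁.var 42 (by decide), h42]) hkI (by rw [hf₁.arr 5 (by decide), hf5]) hT₁
        fun hno => ?_).conseq le_rfl fun s₂ _ hT₂ => ?_
      · have := hcount m (by omega) hno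
        have h2 : (q₀ + 1) * X.k ^ 2 = q₀ * X.k ^ 2 + X.k ^ 2 := by ring
        omega
      · refine hT₂.congr rfl rfl rfl (fun _ => ?_) ?_
        · rw [Finset.range_add_one, Finset.filter_insert, if_pos hfix,
            Finset.card_insert_of_notMem (by simp)]
          omega
        · rw [e8]
          rintro σ (hσ | ⟨c, hc, hcc, rfl⟩)
          · exact .inr (.inl hσ)
          · rcases Nat.lt_succ_iff_lt_or_eq.1 hc with hc | rfl
            · exact .inr (.inr ⟨c, hc, hcc, rfl⟩)
            · exact .inl rfl
    · have hfix : rep m ≠ m := fun h' => by simp [hm₁, e8, h'] at h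
      refine Det.skip (hT₁.congr rfl rfl rfl (fun _ => ?_) ?_) (by omega)
      · rw [Finset.range_add_one, Finset.filter_insert, if_neg hfix]
      · rintro σ (hσ | ⟨c, hc, hcc, rfl⟩)
        · exact .inl hσ
        · rcases Nat.lt_succ_iff_lt_or_eq.1 hc with hc | rfl
          · exact .inr ⟨c, hc, hcc, rfl⟩
          · exact absurd hcc hfix
  · intro s₁ hT₁
    refine hT₁.congr rfl rfl rfl (fun hno => ?_) (Set.Subset.refl _)
    have := hcount X.n le_rfl hno
    have h2 : (q₀ + 1) * X.k ^ 2 = q₀ * X.k ^ 2 + X.k ^ 2 := by ring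
    omega
  · simp only [Finset.sum_const, Finset.card_range, smul_eq_mul]; linarith

/-- Computes the bicliques of all representatives, for all colors. -/
def buildTable : HCmd := .for 38 20 (.assign 40 (.var 38 + .lit 1) ;; represent ;; addRows)

theorem det_buildTable {X : Inst} (hX : X.Graph Γ) {s : St} (hs : X.HoldsGraph s)
    {f : ℕ → ℕ} (h20 : s.var 20 = X.k - 1) (h41 : s.var 41 = 2 * X.k ^ 2)
    (h42 : s.var 42 = X.k ^ 3) (h4 : s.var 4 = 0) (h43 : s.var 43 = 0)
    (hkI : X.k ^ 3 * X.n + X.k ^ 3 + X.n + 16 < Γ.I) (hf5 : s.arr 5 = f) (hfc : X.Colored f)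
    (hk : 2 ≤ X.k) (hcol : ∀ v < X.n, f v < X.k) :
    Det Γ buildTable s ((X.k - 1) * (X.n * (X.n * (X.n * (26 * X.n + 40) + 20) + 15) +
        X.n * (X.n * (13 * X.n + 40) + 28) + 20) + 4) fun s' =>
      ∃ S, X.Table f s' (X.k ^ 3) S ∧ ∀ q < X.k - 1, ∃ rep, X.Represents f (q + 1) rep X.n ∧
        ∀ c < X.n, rep c = c → X.row f (q + 1) rep c ∈ S := by
  have hn := hX.n_lt
  have hkk : X.k ≤ X.k ^ 3 := Nat.le_self_pow (by omega) _
  refine Det.for (n := X.k - 1) (fun _ => X.n * (X.n * (X.n * (26 * X.n + 40) + 20) + 15) +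
        X.n * (X.n * (13 * X.n + 40) + 28) + 16) (fun m s' =>
      ∃ S, X.Table f s' (m * X.k ^ 2) S ∧ ∀ q < m, ∃ rep, X.Represents f (q + 1) rep X.n ∧
        ∀ c < X.n, rep c = c → X.row f (q + 1) rep c ∈ S) h20 (by omega) (by decide) (by decide)
    ⟨∅, ⟨by simp [h4], by simp [h4], by simp [h4, h43]⟩, by simp⟩ ?_ ?_ ?_
  · rintro m hm s₁ hf₁ hm₁ ⟨S, hT, hS⟩
    have hs₁ := hs.frame hf₁ (by decide) (by decide)
    refine Det.wp_seq (t := X.n * (X.n * (X.n * (26 * X.n + 40) + 20) + 15) +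
        X.n * (X.n * (13 * X.n + 40) + 28) + 14) ?_ (by simp only [HCmd.cost]; omega)
    simp only [HCmd.wp, ok_add, ok_var, ok_lit, eval_add, eval_var, eval_lit, hm₁]
    refine ⟨⟨trivial, by omega, by omega⟩, ?_⟩
    have hs₂ : X.HoldsGraph (s₁.setVar 40 (m + 1)) := hs₁.frame (c := .assign 40 (.lit 0))
      ((Frame.refl _ s₁).setVar (by decide) _) (by decide) (by decide)
    refine Det.seq (det_represent hX hs₂ (q := m + 1) hk (by simp)
      (by simp [hf₁.var 41 (by decide), h41])) (t' := X.n * (X.n * (13 * X.n + 40) + 28) + 4) ?_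
      (by omega)
    intro s₃ hf₃ hrep
    have e5 : s₁.arr 5 = f := by rw [hf₁.arr 5 (by decide), hf5]
    rw [St.setVar_arr, e5] at hrep
    refine (det_addRows hX (hs₂.frame hf₃ (by decide) (by decide)) (q := m + 1) (q₀ := m) (S := S)
      (by rw [hf₃.var 40 (by decide)]; simp)
      (by rw [hf₃.var 42 (by decide)]; simp [hf₁.var 42 (by decide), h42]) hkI
      (by rw [hf₃.arr 5 (by decide)]; simp [e5]) hfc hk hcol hrep hm
      (hT.congr ?_ ?_ ?_ (fun _ => le_rfl) (Set.Subset.refl _))).conseq le_rfl ?_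
    · rw [hf₃.var 4 (by decide)]; simp
    · rw [hf₃.var 43 (by decide)]; simp
    · rw [hf₃.arr 1 (by decide)]; simp
    intro s₄ _ hT₄
    refine ⟨_, hT₄.congr rfl rfl rfl (fun _ => le_rfl) (Set.Subset.refl _), fun q hq => ?_⟩
    rcases Nat.lt_succ_iff_lt_or_eq.1 hq with hq | rfl
    · obtain ⟨rep, h1, h2⟩ := hS q hq
      exact ⟨rep, h1, fun c hc hcc => .inl (h2 c hc hcc)⟩
    · exact ⟨_, hrep, fun c hc hcc => .inr ⟨c, hc, hcc, rfl⟩⟩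
  · rintro s₁ ⟨S, hT, hS⟩
    refine ⟨S, hT.congr rfl rfl rfl (fun _ => ?_) (Set.Subset.refl _), hS⟩
    rw [pow_succ' X.k 2]
    exact Nat.mul_le_mul_right _ (by omega)
  · simp only [Finset.sum_const, Finset.card_range, smul_eq_mul]; linarith

/-! ### Partial Grundy Coloring -/

/-- The search among the bicliques in the table, which leave maximum degree at most `2 * k ^ 4`. -/
def searchTable : HCmd :=
  .cond (.var 43) (.assign 0 (.lit 1))
    (.assign 3 (.lit 2 * ((.var 2 * .var 2) * (.var 2 * .var 2))) ;;
      .assign 5 (.var 2 * (.var 3 + .lit 1)) ;; search)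

/-- The instance for the search that is given by the table of bicliques. -/
def Inst.withTable (X : Inst) (s : St) : Inst where
  n := X.n
  k := X.k
  d := 2 * X.k ^ 4
  l := s.var 4
  nbr := X.nbr
  side j v := if j < s.var 4 ∧ v < X.n then s.arr 1 (j * X.n + v) else 0
  hd := X.hd

theorem Inst.row_le_two (X : Inst) (f : ℕ → ℕ) (q : ℕ) (rep : ℕ → ℕ) (c v : ℕ) :
    X.row f q rep c v ≤ 2 := by
  unfold Inst.row
  split_ifs <;> omega

theorem Inst.withTable_side {X : Inst} {s : St} {j v : ℕ} (hj : j < s.var 4) (hv : v < X.n) :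
    (X.withTable s).side j v = s.arr 1 (j * X.n + v) := if_pos ⟨hj, hv⟩

/-- Both sides of each row of the table are completely joined, whatever the representatives are. So
the answer "Yes" of the search is correct in any case. -/
theorem Inst.Table.models {n : ℕ} {G : SimpleGraph (Fin n)} {X : Inst} (hX : X.Graph Γ)
    (hG : X.Models G) {f : ℕ → ℕ} {s : St} {b : ℕ} {S : Set (ℕ → ℕ)} (hT : X.Table f s b S) :
    (X.withTable s).Models G where
  n_eq := hG.n_eq
  adj := hG.adj
  joined j hj u hu v hv h1 h2 := by
    change j < s.var 4 at hj
    change u < X.n at hu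
    change v < X.n at hv
    rw [Inst.withTable_side hj hu] at h1
    rw [Inst.withTable_side hj hv] at h2
    obtain ⟨q, rep, c, h⟩ := hT.rows j hj
    rw [h u hu, Inst.row] at h1
    rw [h v hv, Inst.row] at h2
    have hu' : rep u = c := by
      by_contra hne
      rw [if_neg hne] at h1
      split_ifs at h1
      omega
    have hv' : ∀ a < X.n, rep a = c → a ∈ X.nbr v := by
      split_ifs at h2 with _ h3
      · omega
      · exact h3.2
    exact hX.symm v hv u (hv' u hu hu')

/-- Unless a coloring can be found, every set of vertices contains one of small degree in the set
once the bicliques in the table are deleted. -/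
theorem Inst.Table.not_dense {X : Inst} (hX : X.Graph Γ) (hk : 2 ≤ X.k) {f : ℕ → ℕ} {s : St} {b : ℕ}
    {S : Set (ℕ → ℕ)} (hf : X.Colored f) (hcol : ∀ v < X.n, 0 < f v ∧ f v < X.k)
    (hT : X.Table f s b S)
    (hS : ∀ q < X.k - 1, ∃ rep, X.Represents f (q + 1) rep X.n ∧
      ∀ c < X.n, rep c = c → X.row f (q + 1) rep c ∈ S) (hno : ¬ X.Found) :
    ¬ ∃ U : Finset ℕ, U.Nonempty ∧ (∀ v ∈ U, v < (X.withTable s).n) ∧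
      ∀ v ∈ U, (X.withTable s).d < (((X.withTable s).keep v).filter fun u => u ∈ U).card := by
  rintro ⟨U, ⟨v, hv⟩, hU, hdeg⟩
  have hgraph : (X.withTable s).Graph Γ := ⟨hX.len, hX.deg, hX.get, hX.nodup, hX.lt, hX.symm,
    hX.irrefl, hX.len_lt, hX.n_lt⟩
  have h1 := Inst.card_keep_le (X := X.withTable s) hgraph hf hk hno hcol (fun q hq => ?_) (hU v hv)
  · have h2 := Finset.card_filter_le ((X.withTable s).keep v) fun u => u ∈ U
    have h3 := hdeg v hv
    change 2 * X.k ^ 4 < _ at h3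
    change _ ≤ 2 * X.k ^ 4 at h1
    omega
  · obtain ⟨rep, hrep, hrow⟩ := hS q hq
    refine ⟨rep, ⟨hrep.le, hrep.idem, hrep.color, hrep.near, hrep.far⟩, fun c hc hcc => ?_⟩
    obtain ⟨j, hj, h⟩ := (hT.flag hno).2.2 _ (hrow c hc hcc)
    exact ⟨j, hj, fun v hv =>
      (Inst.withTable_side hj hv).trans (h v hv)⟩

/-- If the table is incomplete, or the removal of vertices of small degree gets stuck, a coloring
exists. Otherwise the search is correct for the bicliques in the table. -/
theorem exec_searchTable {n : ℕ} {G : SimpleGraph (Fin n)} {X : Inst} (hX : X.Graph Γ)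
    (hG : X.Models G) (hk : 2 ≤ X.k) (hkn : X.k ≤ X.n) (hI : 6 * X.n ^ 5 + 16 < Γ.I) {f : ℕ → ℕ}
    {s : St} (hs : X.HoldsGraph s) (h0 : s.var 0 = 0) {b : ℕ} {S : Set (ℕ → ℕ)}
    (hf : X.Colored f) (hcol : ∀ v < X.n, 0 < f v ∧ f v < X.k) (hT : X.Table f s b S)
    (hS : ∀ q < X.k - 1, ∃ rep, X.Represents f (q + 1) rep X.n ∧
      ∀ c < X.n, rep c = c → X.row f (q + 1) rep c ∈ S)
    {p : ℝ} (hp : 1 / 3 ≤ p) (hno : ¬ HasPartialGrundyColoring G X.k → 1 ≤ p) :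
    Exec Γ searchTable s (600 * ((X.k * (2 * X.k ^ 4 + 1)) ^ (2 * X.k ^ 2 + X.k) *
        2 ^ (X.k ^ 3 * X.k) * X.size) + 5) p
      fun s' p' => (s'.var 0 ≠ 0 ∧ HasPartialGrundyColoring G X.k ∧ 0 ≤ p') ∨
        (s'.var 0 = 0 ∧ 1 ≤ p') := by
  have hyes : X.Found → HasPartialGrundyColoring G X.k := fun ⟨C, h1, h2⟩ =>
    hG.hasPartialGrundyColoring (by omega) h1 h2 hX.lt
  set M := 600 * ((X.k * (2 * X.k ^ 4 + 1)) ^ (2 * X.k ^ 2 + X.k) * 2 ^ (X.k ^ 3 * X.k) * X.size)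
  refine .conseq (.cond (t := M + 4) (by simp) ?_) (by omega) le_rfl fun _ _ h => h
  split_ifs with h43
  · have hfound : X.Found := by
      by_contra hno
      exact h43 (hT.flag hno).1
    exact .conseq (.assign (Q := fun s' p' => s'.var 0 ≠ 0 ∧ HasPartialGrundyColoring G X.k ∧ 0 ≤ p')
      (by simp) ⟨by simp, hyes hfound, by linarith⟩) (by omega) le_rfl fun _ _ h => .inl h
  have hkp : ∀ i ≤ 5, X.k ^ i ≤ X.n ^ 5 := fun i hi =>
    (Nat.pow_le_pow_left hkn i).trans (Nat.pow_le_pow_right (by omega) hi)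
  have k1 := hkp 1 (by omega)
  have k2 := hkp 2 (by omega)
  have k3 := hkp 3 (by omega)
  have k4 := hkp 4 (by omega)
  have k5 := hkp 5 (by omega)
  rw [pow_one] at k1
  have hn1 : X.n ≤ X.n ^ 5 := Nat.le_self_pow (by omega) _
  have e2 : X.k * X.k = X.k ^ 2 := by ring
  have e4 : X.k ^ 2 * X.k ^ 2 = X.k ^ 4 := by ring
  have hle := hT.le
  have e5 : X.k * (2 * X.k ^ 4 + 1) = 2 * X.k ^ 5 + X.k := by ring
  have hlk : s.var 4 * X.k ≤ X.k ^ 4 := by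
    rw [show X.k ^ 4 = X.k ^ 3 * X.k by ring]; exact Nat.mul_le_mul_right _ hle
  have hln : s.var 4 * X.n ≤ X.n ^ 5 := by
    calc s.var 4 * X.n ≤ X.n ^ 3 * X.n :=
          Nat.mul_le_mul_right _ (hle.trans (Nat.pow_le_pow_left hkn 3))
      _ = X.n ^ 4 := by ring
      _ ≤ _ := Nat.pow_le_pow_right (by omega) (by omega)
  have hkk : X.k * (X.k + 1) = X.k ^ 2 + X.k := by ring
  have hwf : (X.withTable s).Wf Γ :=
    { len := hX.len
      deg := hX.deg
      get := hX.get
      nodup := hX.nodup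
      lt := hX.lt
      symm := hX.symm
      irrefl := hX.irrefl
      len_lt := hX.len_lt
      n_lt := hX.n_lt
      two_le := hk
      k_le := hkn
      side_le := by
        intro j v
        simp only [Inst.withTable]
        split_ifs with h
        · obtain ⟨q, rep, c, hrow⟩ := hT.rows j h.1
          rw [hrow v h.2]
          exact X.row_le_two _ _ _ _ _
        · omega
      l_lt := by change s.var 4 * X.n + s.var 4 + X.n + 16 < Γ.I; omega
      B_lt := by change X.k * (2 * X.k ^ 4 + 1) + 2 * X.k ^ 4 + 16 < Γ.I; omega
      E_lt := by change X.k * (X.k + 1) + s.var 4 * X.k + s.var 4 + 16 < Γ.I; omega }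
  have htime : (X.withTable s).searchTime ≤ M := by
    refine ((X.withTable s).searchTime_le hk hkn).trans (Nat.mul_le_mul_left _
      (Nat.mul_le_mul_right _ (Nat.mul_le_mul_left _ (Nat.pow_le_pow_right (by omega) ?_))))
    exact Nat.mul_le_mul_right _ hle
  refine Exec.wp_seq (t := M + 2) ?_ (by simp only [HCmd.cost]; omega)
  simp only [HCmd.wp, ok_mul, ok_var, ok_lit, eval_mul, eval_var, eval_lit, hs.k, e2, e4]
  refine ⟨⟨by omega, ⟨⟨trivial, trivial, by omega⟩, ⟨trivial, trivial, by omega⟩, by omega⟩,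
    by omega⟩, ?_⟩
  refine Exec.wp_seq (t := M) ?_ (by simp only [HCmd.cost]; omega)
  simp only [HCmd.wp, ok_mul, ok_var, ok_add, ok_lit, eval_mul, eval_add, eval_var, eval_lit,
    St.setVar_var, ↓reduceIte, Nat.reduceEqDiff, hs.k]
  refine ⟨⟨trivial, ⟨trivial, by omega, by omega⟩, by omega⟩, ?_⟩
  refine .conseq (exec_search_models hwf (hT.models hX hG) hp hno
    ⟨⟨?_, ?_, ?_⟩, ?_, ?_, ?_, ?_⟩ ?_) htime le_rfl ?_
  · simpa [Inst.withTable] using hs.n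
  · simpa [Inst.withTable] using hs.k
  · simpa [Inst.withTable] using hs.hd
  · simp [Inst.withTable]
  · simp [Inst.withTable]
  · simp [Inst.withTable]
  · intro j hj v hv
    refine Eq.trans ?_ (Inst.withTable_side hj hv).symm
    simp [Inst.withTable]
  · simpa using h0
  · rintro s' p' (⟨h0, hres, hp0⟩ | h)
    · refine .inl ⟨h0, hres.elim id fun hU => ?_, hp0⟩
      by_cases hfound : X.Found
      · exact hyes hfound
      · exact absurd hU (hT.not_dense hX hk hf hcol hS hfound)
    · exact .inr h

/-- Finds the vertices that the greedy algorithm could not color. -/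
def findUncolored : HCmd := .count 39 15 1 17 (.assign 17 ((HExpr.arr 5 (.var 15)).eq (.lit 0)))

/-- The algorithm for Partial Grundy Coloring. -/
def general : HCmd :=
  .assign 1 (.inp (.lit 0)) ;; .assign 2 (.inp (.lit 1)) ;;
  .cond ((HExpr.var 2).lt (.lit 2)) (.assign 0 (.lit 1))
    (.cond ((HExpr.var 1).lt (.var 2)) .skip
      ((.assign 6 (.lit 2) ;; .assign 20 (.var 2 - .lit 1) ;;
        .assign 41 (.lit 2 * (.var 2 * .var 2)) ;; .assign 42 (.var 2 * (.var 2 * .var 2))) ;;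
        readGraph ;; greedyColoring ;; findUncolored ;;
        .cond (.var 39) (.assign 0 (.lit 1)) (buildTable ;; searchTable)))

theorem encodePGC_eq {n : ℕ} (k : ℕ) (adj : Fin n → List (Fin n)) :
    encodePGC k adj = [n, k] ++ encodeAdjacency adj ++ [] := by
  rw [encodePGC, List.append_nil]

section
variable {n k : ℕ} {G : SimpleGraph (Fin n)} {adj : Fin n → List (Fin n)}

/-- The graph in the input, without any bicliques. -/
def plainInst (k : ℕ) (adj : Fin n → List (Fin n)) : Inst where
  n := n
  k := k
  d := 0
  l := 0
  nbr := toNat adj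
  side _ _ := 0
  hd v := 2 + ∑ u ∈ Finset.range v, ((toNat adj u).length + 1)

theorem plainInst_models (hadj : IsAdjacencyList G adj) : (plainInst k adj).Models G where
  n_eq := rfl
  adj v u := by
    change (u : ℕ) ∈ toNat adj v ↔ _
    rw [mem_toNat_coe, (hadj v).2]
  joined j hj := absurd hj (Nat.not_lt_zero j)

theorem det_findUncolored {s : St} (h1 : s.var 1 = n) (hn : n + 16 < Γ.I) :
    Det Γ findUncolored s (11 * n + 10) fun s' => s'.var 39 ≠ 0 ↔ ∃ v < n, s.arr 5 v = 0 := by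
  refine Det.exists (m := n) (fun _ => 1) (fun v => s.arr 5 v = 0) h1 (by omega) (by decide)
    (by decide) (by decide) (by decide) ?_ ?_
  · intro v hv s' hf hv'
    refine Det.of_wp ?_ le_rfl
    simp only [HCmd.wp, ok_eq, ok_arr, ok_var, ok_lit, eval_eq, eval_arr, eval_var, eval_lit, hv',
      hf.arr 5 (by decide), St.setVar_var, ↓reduceIte]
    exact ⟨⟨⟨by omega, trivial⟩, by omega⟩, by simp⟩
  · simp only [Finset.sum_const, Finset.card_range, smul_eq_mul]
    omega

/-- The postcondition is the one of `exec_structural`. The bound on `I` covers all numbers in the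
construction of the table, since `k ≤ n` in all cases that get so far. -/
theorem exec_general (hn : 0 < n) (hadj : IsAdjacencyList G adj) (hx : Γ.x = encodePGC k adj)
    (hxI : Γ.x.length + 16 < Γ.I) (hI : 6 * n ^ 5 + 16 < Γ.I)
    {p : ℝ} (hp : 1 / 3 ≤ p) (hno : ¬ HasPartialGrundyColoring G k → 1 ≤ p) :
    Exec Γ general ⟨fun _ => 0, fun _ _ => 0⟩ (400 * n ^ 5 + 600 *
        ((k * (2 * k ^ 4 + 1)) ^ (2 * k ^ 2 + k) * 2 ^ (k ^ 3 * k) * (plainInst k adj).size)) p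
      fun s' p' => (s'.var 0 ≠ 0 ∧ HasPartialGrundyColoring G k ∧ 0 ≤ p') ∨
        (s'.var 0 = 0 ∧ 1 ≤ p') := by
  set X := plainInst k adj with hXdef
  have hG : X.Models G := plainInst_models hadj
  set M := 600 * ((k * (2 * k ^ 4 + 1)) ^ (2 * k ^ 2 + k) * 2 ^ (k ^ 3 * k) * X.size) with hM
  have hxe := hx
  rw [encodePGC_eq] at hxe
  have hlen2 : 2 ≤ Γ.x.length := by rw [hxe]; simp
  have i0 : Γ.x.getD 0 0 = n := by rw [hxe]; rfl
  have i1 : Γ.x.getD 1 0 = k := by rw [hxe]; rfl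
  have hn5 : 0 < n ^ 5 := by positivity
  -- the first two commands
  have hstart : ∀ {c : HCmd} {t : ℕ} {p : ℝ} {Q : St → ℝ → Prop},
      Exec Γ c (((⟨fun _ => 0, fun _ _ => 0⟩ : St).setVar 1 n).setVar 2 k) t p Q →
      Exec Γ (.assign 1 (.inp (.lit 0)) ;; .assign 2 (.inp (.lit 1)) ;; c)
        ⟨fun _ => 0, fun _ _ => 0⟩ (t + 4) p Q := by
    intro c t p Q h
    refine Exec.wp_seq (t := t + 2) ?_ (by simp only [HCmd.cost]; omega)
    simp only [HCmd.wp, ok_inp, ok_lit, eval_inp, eval_lit, i0]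
    refine ⟨⟨by omega, by omega⟩, ?_⟩
    refine Exec.wp_seq (t := t) ?_ (by simp only [HCmd.cost]; omega)
    simp only [HCmd.wp, ok_inp, ok_lit, eval_inp, eval_lit, i1]
    exact ⟨⟨by omega, by omega⟩, h⟩
  by_cases hk : k < 2
  · have hyes := hasPartialGrundyColoring_of_lt_two G hn hk
    refine .conseq (hstart (.cond (t := 1) (by simp) ?_)) (by omega) le_rfl fun _ _ h => h
    rw [if_pos (by simp [hk])]
    exact .assign (by simp) (.inl ⟨by simp, hyes, by linarith⟩)
  by_cases hkn : n < k
  · have hno' : ¬ HasPartialGrundyColoring G k := fun h => by have := h.le_card; omega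
    refine .conseq (hstart (.cond (t := 2) (by simp) ?_)) (by omega) le_rfl fun _ _ h => h
    rw [if_neg (by simp [hk])]
    refine .cond (by simp) ?_
    rw [if_pos (by simp [hkn])]
    exact .skip (.inr ⟨by simp, hno hno'⟩)
  have hX : X.Graph Γ := Inst.graph_of_encode (X := X) hadj hxe rfl rfl
    (fun v => by simp [hXdef, plainInst]) hxI
  have hkp : ∀ i ≤ 5, k ^ i ≤ n ^ 5 := fun i hi =>
    (Nat.pow_le_pow_left (by omega) i).trans (Nat.pow_le_pow_right (by omega) hi)
  have k1 := hkp 1 (by omega)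
  have k2 := hkp 2 (by omega)
  have k3 := hkp 3 (by omega)
  rw [pow_one] at k1
  have hn1 : n ≤ n ^ 5 := Nat.le_self_pow (by omega) _
  have hkk : k * k = k ^ 2 := by ring
  have hkkk : k * k ^ 2 = k ^ 3 := by ring
  have hk3n : k ^ 3 * n ≤ n ^ 5 :=
    calc k ^ 3 * n ≤ n ^ 3 * n := Nat.mul_le_mul_right _ (Nat.pow_le_pow_left (by omega) 3)
      _ = n ^ 4 := by ring
      _ ≤ _ := Nat.pow_le_pow_right (by omega) (by omega)
  have hpow : ∀ i ≤ 5, n ^ i ≤ n ^ 5 := fun i hi => Nat.pow_le_pow_right (by omega) hi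
  have n1 := hpow 1 (by omega)
  have n2 := hpow 2 (by omega)
  have n3 := hpow 3 (by omega)
  have n4 := hpow 4 (by omega)
  rw [pow_one] at n1
  have tg : (k - 1) * (n * (13 * n + 21) + 10) + 4 ≤ 48 * n ^ 5 := by
    calc (k - 1) * (n * (13 * n + 21) + 10) + 4 ≤ n * (n * (13 * n + 21) + 10) + 4 :=
          Nat.add_le_add_right (Nat.mul_le_mul_right _ (by omega)) _
      _ = 13 * n ^ 3 + 21 * n ^ 2 + 10 * n + 4 := by ring
      _ ≤ _ := by omega
  have tb : (k - 1) * (n * (n * (n * (26 * n + 40) + 20) + 15) +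
      n * (n * (13 * n + 40) + 28) + 20) + 4 ≤ 206 * n ^ 5 := by
    calc _ ≤ n * (n * (n * (n * (26 * n + 40) + 20) + 15) + n * (n * (13 * n + 40) + 28) + 20) + 4 :=
          Nat.add_le_add_right (Nat.mul_le_mul_right _ (by omega)) _
      _ = 26 * n ^ 5 + 53 * n ^ 4 + 60 * n ^ 3 + 43 * n ^ 2 + 20 * n + 4 := by ring
      _ ≤ _ := by omega
  refine .conseq (hstart (.cond (t := 390 * n ^ 5 + M + 5) (by simp) ?_)) (by omega)
    le_rfl fun _ _ h => h
  rw [if_neg (by simp [hk])]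
  refine .conseq (.cond (t := 390 * n ^ 5 + M + 4) (by simp) ?_) (by omega) le_rfl fun _ _ h => h
  rw [if_neg (by simp [hkn])]
  refine Exec.wp_seq (t := 375 * n ^ 5 + M) ?_ (by simp only [HCmd.cost]; omega)
  simp only [HCmd.wp, ok_lit, eval_lit, ok_mul, ok_var, ok_sub, eval_mul, eval_sub,
    eval_var, St.setVar_var, ↓reduceIte, Nat.reduceEqDiff, hkk, hkkk]
  refine ⟨by omega, ⟨trivial, by omega⟩, ⟨by omega, ⟨trivial, trivial, by omega⟩, by omega⟩,
    ⟨trivial, ⟨trivial, trivial, by omega⟩, by omega⟩, ?_⟩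
  refine Exec.seq' (t := 11 * n ^ 5) (t' := 360 * n ^ 5 + M)
    (det_readGraph hX (by rfl) (p := 2) (by rfl) (fun v => rfl) (by
      change 7 * n + 4 ≤ _; omega) p) ?_ (by omega)
  rintro s₁ _ hf₁ ⟨rfl, -, hhd⟩
  have hs₁ : X.HoldsGraph s₁ := by
    refine ⟨?_, ?_, hhd⟩
    · simp [hf₁.var 1 (by decide), hXdef, plainInst]
    · simp [hf₁.var 2 (by decide), hXdef, plainInst]
  have h5₁ : s₁.arr 5 = fun _ => 0 := by simp [hf₁.arr 5 (by decide)]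
  have h20 : s₁.var 20 = k - 1 := by simp [hf₁.var 20 (by decide)]
  have h41 : s₁.var 41 = 2 * k ^ 2 := by simp [hf₁.var 41 (by decide)]
  have h42 : s₁.var 42 = k ^ 3 := by simp [hf₁.var 42 (by decide)]
  have h4 : s₁.var 4 = 0 := by simp [hf₁.var 4 (by decide)]
  have h43 : s₁.var 43 = 0 := by simp [hf₁.var 43 (by decide)]
  have h0 : s₁.var 0 = 0 := by simp [hf₁.var 0 (by decide)]
  clear hf₁
  refine Exec.seq' (t := 48 * n ^ 5) (t' := 300 * n ^ 5 + M)
    ((det_greedyColoring hX hs₁ (by change k - 1 + 16 < _; omega) h20 h5₁ _).conseq tg le_rfl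
      fun _ _ h => h) ?_ (by omega)
  rintro s₂ _ hf₂ ⟨rfl, hg⟩
  have hs₂ := hs₁.frame hf₂ (by decide) (by decide)
  refine Exec.seq' (t := 21 * n ^ 5) (t' := 250 * n ^ 5 + M)
    ((det_findUncolored hs₂.n hX.n_lt _).conseq (by change 11 * n + 10 ≤ _; omega) le_rfl
      fun _ _ h => h) ?_ (by omega)
  rintro s₃ _ hf₃ ⟨rfl, h39⟩
  have hs₃ := hs₂.frame hf₃ (by decide) (by decide)
  refine .conseq (.cond (t := 240 * n ^ 5 + M) (by simp) ?_) (by omega) le_rfl fun _ _ h => h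
  split_ifs with hun
  · obtain ⟨v₀, hv₀, hv₀'⟩ := h39.1 hun
    obtain ⟨C, h1, h2⟩ := hg.found hX (by change 2 ≤ k; omega) hv₀ hv₀'
    have hyes := hG.hasPartialGrundyColoring (by change 0 < k; omega) h1 h2 hX.lt
    exact .conseq (.assign (Q := fun s' p' => s'.var 0 ≠ 0 ∧ HasPartialGrundyColoring G k ∧ 0 ≤ p')
      (by simp) ⟨by simp, hyes, by linarith⟩) (by omega) le_rfl fun _ _ h => .inl h
  have hpos : ∀ v < X.n, 0 < s₂.arr 5 v := by
    intro v hv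
    by_contra h
    exact hun (h39.2 ⟨v, hv, by omega⟩)
  have hcol : ∀ v < X.n, 0 < s₂.arr 5 v ∧ s₂.arr 5 v < X.k := by
    intro v hv
    have h1 := hpos v hv
    have h2 := hg.le v hv
    omega
  have hf : X.Colored (s₂.arr 5) := fun v hv u hu huv =>
    absurd (hg.proper v hv u hu huv) (hpos v hv).ne'
  refine Exec.seq' (t := 206 * n ^ 5) (t' := M + 5)
    ((det_buildTable hX hs₃ (f := s₂.arr 5) ?_ ?_ ?_ ?_ ?_ ?_ ?_ hf (by change 2 ≤ k; omega)
      (fun v hv => (hcol v hv).2) _).conseq tb le_rfl fun _ _ h => h) ?_ (by omega)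
  · rw [hf₃.var 20 (by decide), hf₂.var 20 (by decide), h20]; rfl
  · rw [hf₃.var 41 (by decide), hf₂.var 41 (by decide), h41]; rfl
  · rw [hf₃.var 42 (by decide), hf₂.var 42 (by decide), h42]; rfl
  · rw [hf₃.var 4 (by decide), hf₂.var 4 (by decide), h4]
  · rw [hf₃.var 43 (by decide), hf₂.var 43 (by decide), h43]
  · change k ^ 3 * n + k ^ 3 + n + 16 < _
    omega
  · rw [hf₃.arr 5 (by decide)]
  rintro s₄ _ hf₄ ⟨rfl, S, hT, hS⟩
  refine exec_searchTable hX hG (by change 2 ≤ k; omega) (by change k ≤ n; omega) hI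
    (hs₃.frame hf₄ (by decide) (by decide)) ?_ hf hcol hT hS hp hno
  rw [hf₄.var 0 (by decide), hf₃.var 0 (by decide), hf₂.var 0 (by decide), h0]

end

theorem pow_mul_pow_le {k : ℕ} (hk : 0 < k) :
    (k * (2 * k ^ 4 + 1)) ^ (2 * k ^ 2 + k) * 2 ^ (k ^ 3 * k) ≤ 2 ^ (22 * k ^ 4) := by
  have hpow : ∀ i ≤ 4, k ^ i ≤ k ^ 4 := fun i hi => Nat.pow_le_pow_right hk hi
  have k2 := hpow 2 (by omega)
  have k3 := hpow 3 (by omega)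
  have hB : k * (2 * k ^ 4 + 1) ≤ 2 ^ (7 * k) := by
    have h1 : 0 < k ^ 4 := by positivity
    calc k * (2 * k ^ 4 + 1) ≤ k * (4 * k ^ 4) := Nat.mul_le_mul_left _ (by omega)
      _ = 2 ^ 2 * k ^ 5 := by ring
      _ ≤ 2 ^ 2 * (2 ^ k) ^ 5 := Nat.mul_le_mul_left _ (Nat.pow_le_pow_left Nat.lt_two_pow_self.le 5)
      _ = 2 ^ (2 + k * 5) := by rw [← pow_mul, ← pow_add]
      _ ≤ _ := Nat.pow_le_pow_right (by omega) (by omega)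
  calc _ ≤ (2 ^ (7 * k)) ^ (2 * k ^ 2 + k) * 2 ^ (k ^ 3 * k) :=
        Nat.mul_le_mul_right _ (Nat.pow_le_pow_left hB _)
    _ = 2 ^ (14 * k ^ 3 + 7 * k ^ 2 + k ^ 4) := by
        rw [← pow_mul, ← pow_add]; congr 1; ring
    _ ≤ _ := Nat.pow_le_pow_right (by omega) (by omega)

/-- The algorithm for Partial Grundy Coloring, for all sufficiently large words. -/
theorem general_spec : ∃ (P : WordRAM.Cmd) (c C : ℕ),
    ∀ (n k : ℕ) (G : SimpleGraph (Fin n)) (adj : Fin n → List (Fin n)),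
      0 < n → 0 < k → IsAdjacencyList G adj →
      ∀ w : ℕ, WordRAM.Admissible c w (encodePGC k adj) →
        WordRAM.DecidesOneSided P w (C * 2 ^ (C * k ^ 4) * n ^ C) (encodePGC k adj)
          (HasPartialGrundyColoring G k) := by
  obtain ⟨C, hC⟩ : ∃ C, 2000 ≤ C := ⟨2000, le_rfl⟩
  -- register `1` becomes `n * (n + 1) + 2`, which is at least the length of the input
  refine ⟨.seq (.assign 1 (.bin .add (.bin .mul (.load (.const 0)) (.bin .add (.load (.const 0))
    (.const 1))) (.const 2))) general.compile, 9, C, fun n k G adj hn hk hadj w hw => ?_⟩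
  set x := encodePGC k adj with hx
  have hxe := encodePGC_eq k adj
  rw [← hx] at hxe
  -- all numbers are bounded by powers of `N`
  set N := x.length + x.sum + 2 with hN
  have hlen : x.length = 2 + ∑ v ∈ Finset.range n, ((toNat adj v).length + 1) := by
    rw [hxe, List.append_nil, List.length_append, encodeAdjacency_eq, length_flatMap_range]
    rfl
  have hsum : n + k ≤ x.sum := by
    rw [hxe, List.append_nil, List.sum_append]
    simp only [List.sum_cons, List.sum_nil]
    omega
  have hnbr : ∀ v, (toNat adj v).length ≤ n := by
    intro v
    rw [toNat]
    split_ifs with h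
    · simpa using (hadj ⟨v, h⟩).1.length_le_card
    · simp
  have hsize : ∑ v ∈ Finset.range n, ((toNat adj v).length + 1) ≤ n * (n + 1) := by
    refine (Finset.sum_le_card_nsmul _ _ (n + 1) fun v _ => ?_).trans (by simp)
    exact Nat.add_le_add_right (hnbr v) 1
  have hb : x.length ≤ n * (n + 1) + 2 := by omega
  have hN4 : n + 4 ≤ N := by omega
  have hN7 : 6 ≤ N := by omega
  have hN5 : n ^ 5 ≤ N ^ 5 := Nat.pow_le_pow_left (by omega) 5
  have h56 : 6 ^ 2 * N ^ 5 ≤ N ^ 7 := by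
    rw [show N ^ 7 = N ^ 2 * N ^ 5 by ring]
    exact Nat.mul_le_mul_right _ (Nat.pow_le_pow_left hN7 2)
  have h79 : 6 ^ 2 * N ^ 7 ≤ N ^ 9 := by
    rw [show N ^ 9 = N ^ 2 * N ^ 7 by ring]
    exact Nat.mul_le_mul_right _ (Nat.pow_le_pow_left hN7 2)
  have h1 : N ≤ N ^ 5 := Nat.le_self_pow (by omega) _
  have h2 : n * (n + 1) ≤ N ^ 5 :=
    calc n * (n + 1) ≤ N * N := Nat.mul_le_mul (by omega) (by omega)
      _ = N ^ 2 := by ring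
      _ ≤ _ := Nat.pow_le_pow_right (by omega) (by omega)
  have hw' : N ^ 9 ≤ 2 ^ w := hw
  obtain ⟨p, hp, hno, hyes⟩ := exists_failure_bound (HasPartialGrundyColoring G k)
  have hex := exec_general (Γ := ⟨x, N ^ 7⟩) (k := k) hn hadj hx
    (by simp only; omega) (by simp only; omega) hp hno
  have hroom : Room ⟨x, N ^ 7⟩ (n * (n + 1) + 2) w :=
    { len := hb
      entries := getD_lt_of_sum_lt (by simp only; omega)
      small := by simp only; omega
      large := by simp only; omega }
  refine decidesOneSided_of_exec hroom ?_ hex ?_ hyes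
  · have e0 : x.getD 0 0 = n := by rw [hxe]; rfl
    have hn0 := eval_load_const (w := w) (a := 0) (r := fun _ => 0) (x := x) (by omega)
    rw [e0] at hn0
    exact eval_add_of_lt (eval_mul_of_lt hn0 (eval_add_of_lt hn0 (eval_const_of_lt (by omega))
      (by omega)) (by omega)) (eval_const_of_lt (by omega)) (by omega)
  · have hM := pow_mul_pow_le hk
    have hA : 0 < 2 ^ (22 * k ^ 4) := by positivity
    have hsz : (plainInst k adj).size ≤ 2 * n ^ 5 := by
      refine hsize.trans ?_
      have : n ^ 2 ≤ n ^ 5 := Nat.pow_le_pow_right hn (by omega)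
      have : n ≤ n ^ 5 := Nat.le_self_pow (by omega) _
      rw [show n * (n + 1) = n ^ 2 + n by ring]
      omega
    have h3 := Nat.mul_le_mul hM hsz
    have h4 : 2 ^ (22 * k ^ 4) * n ^ 5 ≤ 2 ^ (C * k ^ 4) * n ^ C :=
      Nat.mul_le_mul (Nat.pow_le_pow_right (by omega) (Nat.mul_le_mul_right _ (by omega)))
        (Nat.pow_le_pow_right hn (by omega))
    have h5 : n ^ 5 ≤ 2 ^ (22 * k ^ 4) * n ^ 5 := Nat.le_mul_of_pos_left _ hA
    have h6 : 0 < n ^ 5 := by positivity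
    rw [mul_assoc C]
    rw [show 2 ^ (22 * k ^ 4) * (2 * n ^ 5) = 2 * (2 ^ (22 * k ^ 4) * n ^ 5) by ring] at h3
    have h7 := Nat.mul_le_mul_right (2 ^ (C * k ^ 4) * n ^ C) hC
    omega

end ArrayLang

theorem mainTheorem7 :
    (∃ (P : WordRAM.Cmd) (c C : ℕ),
      ∀ (n k : ℕ) (G : SimpleGraph (Fin n)) (adj : Fin n → List (Fin n)),
        0 < n → 0 < k → IsAdjacencyList G adj →
        ∀ w : ℕ, WordRAM.Admissible c w (encodePGC k adj) →
          WordRAM.DecidesOneSided P w (C * 2 ^ (C * k ^ 4) * n ^ C) (encodePGC k adj)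
            (HasPartialGrundyColoring G k)) ∧
    (∃ (P : WordRAM.Cmd) (c C : ℕ),
      ∀ (n k d ℓ : ℕ) (G : SimpleGraph (Fin n)) (adj : Fin n → List (Fin n))
        (L R : Fin ℓ → List (Fin n)),
        0 < n → 0 < k → IsAdjacencyList G adj → IsSPGCInstance G d ℓ L R →
        ∀ w : ℕ, WordRAM.Admissible c w (encodeSPGC k d ℓ adj L R) →
          WordRAM.DecidesOneSided P w
            (C * ((k * (d + 1)) ^ (2 * k ^ 2 + k) * 2 ^ (ℓ * k) * (G.edgeSet.ncard + n)))
            (encodeSPGC k d ℓ adj L R) (HasPartialGrundyColoring G k)) := by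
  exact ⟨ArrayLang.general_spec, ArrayLang.structural_spec⟩
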